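/- Let $n\ge 1$ and $1<p<\infty$. Write points of $\mathbb{R}^n=\mathbb{R}^{n-1}\times\mathbb{R}$ as $(x,t)$, and dual variables as $(\xi,\tau)$. Let $\nabla$ be the gradient in $x$ only. Let $\|(x,t)\|$ be the parabolic norm: for $(x,t)\ne 0$ it is the unique $\rho>0$ with $|x|^2/\rho^2+t^2/\rho^4=1$, and $\|0\|=0$. Define $\mathbb{D}$, $\mathbb{D}_n$ and $D^t_{1/2}$ on Schwartz functions by $$(\mathbb{D}\varphi)^\wedge(\xi,\tau)=\|(\xi,\tau)\|\,\widehat\varphi(\xi,\tau),\qquad (\mathbb{D}_n\varphi)^\wedge(\xi,\tau)=\frac{\tau}{\|(\xi,\tau)\|}\,\widehat\varphi(\xi,\tau),$$ and by letting $D^t_{1/2}$ act on $\varphi(x,\cdot)$, for each fixed $x$, as the one-dimensional Fourier multiplier $|\tau|^{1/2}$; here $\widehat\varphi(\zeta)=\int\varphi(z)e^{-2\pi i z\cdot\zeta}\,dz$. Let $\mathcal{A}$ be the class of measurable functions $f:\mathbb{R}^n\to\mathbb{C}$ (real-valued ones in particular) with $$\int_{\mathbb{R}^n}|f(x,t)|\left(\frac{1}{(1+|x|+|t|^{1/2})^{n+2}}+\frac{1}{(1+|x|)^{n}(1+|t|^{1/2})^{3}}\right)dx\,dt<\infty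 .$$ It contains the constants and $L^q(\mathbb{R}^n)$ for $1\le q\le\infty$. For $f\in\mathcal{A}$ and $T\in\{\mathbb{D},\mathbb{D}_n,D^t_{1/2},\nabla\}$ define $Tf$ as a distribution by duality, $\langle Tf,\varphi\rangle=\int f\,T'\varphi$ for Schwartz $\varphi$, with $T'$ the transpose of $T$. Let $\|Tf\|_{L^p}\in[0,\infty]$ be the $L^p(\mathbb{R}^n)$ norm of the $L^p$ function representing $Tf$, and $\infty$ if there is none. There is a finite constant $C$, depending only on $n$ and $p$, such that for all $f\in\mathcal{A}$ $$\|\mathbb{D}_nf\|_{L^p}\le C\left(\|D^t_{1/2}f\|_{L^p}+\|\nabla f\|_{L^p}\right),$$ $$C^{-1}\|\mathbb{D}f\|_{L^p}\le \|D^t_{1/2}f\|_{L^p}+\|\nabla f\|_{L^p}\le C\,\|\mathbb{D}f\|_{L^p},$$ and for all measurable $f:\mathbb{R}^n\to\mathbb{C}$ $$C^{-1}\left(\|\mathbb{D}f\|_{L^p}+\|f\|_{L^p}\right)\le \|D^t_{1/2}f\|_{L^p}+\|\nabla f\|_{L^p}+\|f\|_{L^p}\le C\left(\|\mathbb{D}f\|_{L^p}+\|f\|_{L^p}\right),$$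 where all three expressions are $\infty$ if $f\notin L^p(\mathbb{R}^n)$. -/

import Mathlib

open MeasureTheory
open scoped ENNReal NNReal FourierTransform SchwartzMap

noncomputable section

namespace Parabolic

/-- The space `ℝⁿ = ℝᵈ × ℝ` with `n = d + 1`. A point is `(x, t)`: the first `d` coordinates are the
spatial variable `x`, the last coordinate is the time variable `t`. -/
abbrev Pt (d : ℕ) := EuclideanSpace ℝ (Fin (d + 1))

variable {d : ℕ}

/-- The spatial part `x` of `z = (x, t)`. -/
def spaceVar (z : Pt d) : EuclideanSpace ℝ (Fin d) := WithLp.toLp 2 fun i => z i.castSucc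

/-- The time `t` of `z = (x, t)`. -/
def timeVar (z : Pt d) : ℝ := z (Fin.last d)

/-- The point `(x, s)` for `z = (x, t)`. -/
def withTime (z : Pt d) (s : ℝ) : Pt d := WithLp.toLp 2 (Function.update z.ofLp (Fin.last d) s)

/-- The parabolic norm `‖(x, t)‖`, the positive solution `ρ` of `|x|² / ρ² + t² / ρ⁴ = 1`
(and `0` at the origin), in closed form; see `parNorm_pos` and `eq_parNorm_iff`. -/
def parNorm (z : Pt d) : ℝ :=
  √((‖spaceVar z‖ ^ 2 + √(‖spaceVar z‖ ^ 4 + 4 * timeVar z ^ 2)) / 2)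

theorem spaceVar_ne_or_timeVar_ne {z : Pt d} (hz : z ≠ 0) : spaceVar z ≠ 0 ∨ timeVar z ≠ 0 := by
  by_contra! h
  apply hz
  ext i
  refine Fin.lastCases ?_ (fun j => ?_) i
  · simpa [timeVar] using h.2
  · have := congrArg (fun v : EuclideanSpace ℝ (Fin d) => v j) h.1
    simpa [spaceVar] using this

theorem parNorm_pos {z : Pt d} (hz : z ≠ 0) : 0 < parNorm z := by
  unfold parNorm
  apply Real.sqrt_pos.2
  rcases spaceVar_ne_or_timeVar_ne hz with h | h
  · have := norm_pos_iff.2 h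
    positivity
  · have : 0 < timeVar z ^ 2 := by positivity
    have : 0 < √(‖spaceVar z‖ ^ 4 + 4 * timeVar z ^ 2) := Real.sqrt_pos.2 (by positivity)
    positivity

/-- Away from the origin the parabolic norm is the unique positive solution of its equation. -/
theorem eq_parNorm_iff {z : Pt d} (hz : z ≠ 0) {ρ : ℝ} (hρ : 0 < ρ) :
    ρ = parNorm z ↔ ‖spaceVar z‖ ^ 2 / ρ ^ 2 + timeVar z ^ 2 / ρ ^ 4 = 1 := by
  have hS : √(‖spaceVar z‖ ^ 4 + 4 * timeVar z ^ 2) ^ 2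
      = ‖spaceVar z‖ ^ 4 + 4 * timeVar z ^ 2 := Real.sq_sqrt (by positivity)
  have hS0 := Real.sqrt_nonneg (‖spaceVar z‖ ^ 4 + 4 * timeVar z ^ 2)
  have hQ : parNorm z ^ 2
      = (‖spaceVar z‖ ^ 2 + √(‖spaceVar z‖ ^ 4 + 4 * timeVar z ^ 2)) / 2 :=
    Real.sq_sqrt (by positivity)
  have hP := parNorm_pos hz
  generalize √(‖spaceVar z‖ ^ 4 + 4 * timeVar z ^ 2) = S at *
  generalize parNorm z = P at *
  generalize ‖spaceVar z‖ = a at *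
  generalize timeVar z = t at *
  have key : a ^ 2 / ρ ^ 2 + t ^ 2 / ρ ^ 4 = 1 ↔ ρ ^ 4 - a ^ 2 * ρ ^ 2 - t ^ 2 = 0 := by
    have h4 : ρ ^ 4 ≠ 0 := by positivity
    have : a ^ 2 / ρ ^ 2 + t ^ 2 / ρ ^ 4 = (a ^ 2 * ρ ^ 2 + t ^ 2) / ρ ^ 4 := by
      field_simp
    rw [this, div_eq_one_iff_eq h4]
    constructor <;> intro h <;> linarith
  rw [key]
  have hfac : ρ ^ 4 - a ^ 2 * ρ ^ 2 - t ^ 2 = (ρ ^ 2 - P ^ 2) * (ρ ^ 2 + (S - a ^ 2) / 2) := by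
    rw [hQ]; linear_combination (1 / 4 : ℝ) * hS
  have hSa : a ^ 2 ≤ S := by nlinarith [sq_nonneg t, sq_nonneg a, sq_nonneg (S - a ^ 2)]
  have hpos : ρ ^ 2 + (S - a ^ 2) / 2 ≠ 0 := by
    have : 0 < ρ ^ 2 := by positivity
    linarith
  rw [hfac, mul_eq_zero, or_iff_left hpos, sub_eq_zero, sq_eq_sq₀ hρ.le hP.le]

/-- The operator with Fourier multiplier `m`, on Schwartz functions: `(T_m φ)^ = m φ^`, where
`φ^(ζ) = ∫ φ(z) exp(-2πi z·ζ) dz`. -/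
def fourierMul (m : Pt d → ℝ) (φ : 𝓢(Pt d, ℂ)) : Pt d → ℂ :=
  𝓕⁻ (fun ζ : Pt d => (m ζ : ℂ) * (𝓕 φ : 𝓢(Pt d, ℂ)) ζ)

/-- The symbol `‖(ξ, τ)‖` of `𝔻`. -/
def symbolD (ζ : Pt d) : ℝ := parNorm ζ

/-- The symbol `τ / ‖(ξ, τ)‖` of `𝔻ₙ`. -/
def symbolDn (ζ : Pt d) : ℝ := timeVar ζ / parNorm ζ

/-- The half derivative in time `D^t_{1/2} φ` of a Schwartz function: for every fixed `x`, the
one-dimensional Fourier multiplier `|τ|^{1/2}` is applied to `s ↦ φ(x, s)`. -/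
def halfTime (φ : 𝓢(Pt d, ℂ)) (z : Pt d) : ℂ :=
  𝓕⁻ (fun τ : ℝ => (√|τ| : ℂ) * 𝓕 (fun s : ℝ => φ (withTime z s)) τ) (timeVar z)

/-- For a Schwartz function `φ`, `𝔻 φ` and `𝔻ₙ φ` are bounded by a multiple of the first summand and
`D^t_{1/2} φ` is bounded by a multiple of the second one. -/
def pairingWeight (z : Pt d) : ℝ :=
  1 / (1 + ‖spaceVar z‖ + √|timeVar z|) ^ (d + 3)
    + 1 / ((1 + ‖spaceVar z‖) ^ (d + 1) * (1 + √|timeVar z|) ^ 3)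

/-- The functions to which `𝔻`, `𝔻ₙ`, `D^t_{1/2}` and `∇` are applied, by duality with Schwartz
functions: the growth condition makes all the pairings below absolutely convergent. It holds for
constants and for all functions in `L^q`, `1 ≤ q ≤ ∞`. -/
def Admissible (f : Pt d → ℂ) : Prop :=
  Integrable fun z => (pairingWeight z : ℂ) * f z

/-- `‖T f‖_{L^p}` for the distribution `T f : φ ↦ ∫ f · (T' φ)`, where `T'` is the transpose of `T`:
the `L^p` norm of the function `g` in `L^p` which represents `T f`, and `∞` if there is none. -/
def distNorm (T' : 𝓢(Pt d, ℂ) → Pt d → ℂ) (p : ℝ≥0∞) (f : Pt d → ℂ) : ℝ≥0∞ :=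
  ⨅ (g : Pt d → ℂ) (_ : MemLp g p ∧ ∀ φ : 𝓢(Pt d, ℂ), ∫ z, f z * T' φ z = ∫ z, g z * φ z),
    eLpNorm g p

/-- `‖𝔻 f‖_{L^p}`. The transpose of the operator with multiplier `m(ζ)` has multiplier `m(-ζ)`. -/
def normD (p : ℝ≥0∞) (f : Pt d → ℂ) : ℝ≥0∞ :=
  distNorm (fourierMul fun ζ => symbolD (-ζ)) p f

/-- `‖𝔻ₙ f‖_{L^p}`. -/
def normDn (p : ℝ≥0∞) (f : Pt d → ℂ) : ℝ≥0∞ :=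
  distNorm (fourierMul fun ζ => symbolDn (-ζ)) p f

/-- `‖D^t_{1/2} f‖_{L^p}`. The operator `D^t_{1/2}` is its own transpose. -/
def normHalfTime (p : ℝ≥0∞) (f : Pt d → ℂ) : ℝ≥0∞ :=
  distNorm halfTime p f

/-- `‖∇ f‖_{L^p}` for the distributional gradient in the spatial variables: the `L^p` norm of the
vector field in `L^p` which represents `∇ f`, and `∞` if there is none. -/
def normGrad (p : ℝ≥0∞) (f : Pt d → ℂ) : ℝ≥0∞ :=
  ⨅ (g : Pt d → EuclideanSpace ℂ (Fin d))
    (_ : MemLp g p ∧ ∀ (i : Fin d) (φ : 𝓢(Pt d, ℂ)),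
      ∫ z, f z * fderiv ℝ φ z (EuclideanSpace.single i.castSucc 1) = - ∫ z, g z i * φ z),
    eLpNorm g p

end Parabolic

end

/-!
The theorem is a statement about Fourier multipliers which respect the parabolic dilations
`(ξ, τ) ↦ (rξ, r²τ)`. Write `ρ` for `‖(ξ, τ)‖` and `N` for `(τ² + |ξ|⁴)^{1/4}`, both smooth away
from the origin and homogeneous of degree one.

* A symbol which is smooth away from the origin and homogeneous of degree zero is an `Lᵖ` multiplier
  (`HomSymbol.exists_lpMul`). A dyadic truncation of the symbol has a kernel with a Hörmander bound
  and an `L²` bound that do not depend on the truncation. Stopping at parabolic dyadic cubes gives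
  an estimate at every height, with the `L²` norm of the small values and the `L¹` norm of the large
  ones (`weak_type_estimate`); integrated in the height, it gives `Lᵖ` for `p < 2`
  (`strong_type_estimate`).
  Plancherel is the case `p = 2`, and duality the case `p > 2`.
* The quotient `|τ|^{1/2} / N` is homogeneous of degree zero, but it is not smooth where `τ = 0`. It
  is an average, with integrable weight, of isotropic dilates of the smooth symbol
  `τ² / (τ² + |ξ|⁴)`, and an isotropic dilation does not change the norm of a multiplier
  (`exists_lpMul_halfTimeFraction`).
* A symbol `σ` of degree one can be written as `m₀ |τ|^{1/2} + ∑ mᵢ ξᵢ`, where the `mᵢ` are `Lᵖ`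
  multipliers (`eq_timePart_add_spacePart`). With `σ = ρ` and `σ = τ / ρ` this bounds `𝔻 f` and
  `𝔻ₙ f` by `D^t_{1/2} f` and `∇ f`. Conversely `ξᵢ = (ξᵢ / ρ) ρ` and
  `|τ|^{1/2} = (|τ|^{1/2} / N) (N / ρ) ρ`.

These factorizations are applied to the test functions, since `f` itself need not have a Fourier
transform that is a function. The multipliers do not preserve Schwartz functions, because their
symbols are singular where the frequency, or only its time component, vanishes; so the test
functions are first stripped of their low frequencies. What is removed tends to zero against every
admissible `f` (`LowFrequency.integral_eq_of_forall_cut`). The isotropic cutoff, adapted to `𝔻` and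
`𝔻ₙ`, is controlled by the first summand of `pairingWeight`, and the cutoff in `τ` alone, adapted to
`D^t_{1/2}`, by the second one.

The inequalities with `‖f‖_{Lᵖ}` follow from those for admissible functions, because `pairingWeight`
lies in every `L^q` with `1 < q < ∞`, so that `Lᵖ` functions are admissible by Hölder's inequality.
-/

/-! ### Parabolic geometry of `ℝᵈ × ℝ` -/

noncomputable section

namespace Parabolic

variable {d : ℕ}

/-- `spaceVar` as a continuous linear map. -/
def spaceL : Pt d →L[ℝ] EuclideanSpace ℝ (Fin d) :=
  LinearMap.toContinuousLinearMap
    { toFun := spaceVar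
      map_add' := fun x y => by ext i; simp [spaceVar]
      map_smul' := fun c x => by ext i; simp [spaceVar] }

/-- `timeVar` as a continuous linear map. -/
def timeL : Pt d →L[ℝ] ℝ :=
  LinearMap.toContinuousLinearMap
    { toFun := timeVar
      map_add' := fun x y => by simp [timeVar]
      map_smul' := fun c x => by simp [timeVar] }

theorem spaceVar_apply (z : Pt d) (i : Fin d) : spaceVar z i = z i.castSucc := rfl

@[simp] theorem spaceVar_add (z w : Pt d) : spaceVar (z + w) = spaceVar z + spaceVar w :=
  spaceL.map_add z w

@[simp] theorem spaceVar_sub (z w : Pt d) : spaceVar (z - w) = spaceVar z - spaceVar w :=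
  spaceL.map_sub z w

@[simp] theorem spaceVar_neg (z : Pt d) : spaceVar (-z) = -spaceVar z := spaceL.map_neg z

@[simp] theorem timeVar_add (z w : Pt d) : timeVar (z + w) = timeVar z + timeVar w :=
  timeL.map_add z w

@[simp] theorem timeVar_sub (z w : Pt d) : timeVar (z - w) = timeVar z - timeVar w :=
  timeL.map_sub z w

@[simp] theorem timeVar_neg (z : Pt d) : timeVar (-z) = -timeVar z := timeL.map_neg z

theorem continuous_spaceVar : Continuous (spaceVar : Pt d → _) := spaceL.continuous

theorem continuous_timeVar : Continuous (timeVar : Pt d → ℝ) := timeL.continuous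

theorem inner_eq_split (z w : Pt d) :
    inner ℝ z w = inner ℝ (spaceVar z) (spaceVar w) + timeVar z * timeVar w := by
  simp only [PiLp.inner_apply, Fin.sum_univ_castSucc, spaceVar, timeVar]
  simp [mul_comm]

theorem norm_sq_split (z : Pt d) : ‖z‖ ^ 2 = ‖spaceVar z‖ ^ 2 + timeVar z ^ 2 := by
  rw [← real_inner_self_eq_norm_sq, ← real_inner_self_eq_norm_sq, inner_eq_split, sq]

theorem norm_spaceVar_le (z : Pt d) : ‖spaceVar z‖ ≤ ‖z‖ :=
  abs_le_of_sq_le_sq' (by rw [norm_sq_split z]; nlinarith [sq_nonneg (timeVar z)]) (norm_nonneg _)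
    |>.2

theorem abs_timeVar_le (z : Pt d) : |timeVar z| ≤ ‖z‖ :=
  abs_le_of_sq_le_sq (by rw [norm_sq_split z]; nlinarith [sq_nonneg ‖spaceVar z‖]) (norm_nonneg _)

theorem norm_le_split (z : Pt d) : ‖z‖ ≤ ‖spaceVar z‖ + |timeVar z| := by
  apply le_of_sq_le_sq _ (by positivity)
  rw [norm_sq_split z]
  nlinarith [mul_nonneg (norm_nonneg (spaceVar z)) (abs_nonneg (timeVar z)), sq_abs (timeVar z)]

theorem pt_ext {z w : Pt d} (h₁ : spaceVar z = spaceVar w) (h₂ : timeVar z = timeVar w) :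
    z = w := by
  have : ‖z - w‖ ^ 2 = 0 := by rw [norm_sq_split]; simp [h₁, h₂]
  simpa [sub_eq_zero] using this

/-- The parabolic gauge `|x| + |t|^{1/2}`: it is subadditive and homogeneous under `dil`. -/
def gauge (z : Pt d) : ℝ := ‖spaceVar z‖ + √|timeVar z|

theorem gauge_nonneg (z : Pt d) : 0 ≤ gauge z := by unfold gauge; positivity

theorem sqrt_abs_add_le (a b : ℝ) : √|a + b| ≤ √|a| + √|b| :=
  (Real.sqrt_le_sqrt (abs_add_le a b)).trans
    (Real.sqrt_le_iff.2 ⟨by positivity, by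
      nlinarith [Real.sq_sqrt (abs_nonneg a), Real.sq_sqrt (abs_nonneg b),
        mul_nonneg (Real.sqrt_nonneg |a|) (Real.sqrt_nonneg |b|)]⟩)

theorem gauge_add_le (z w : Pt d) : gauge (z + w) ≤ gauge z + gauge w := by
  unfold gauge
  rw [spaceVar_add, timeVar_add]
  linarith [norm_add_le (spaceVar z) (spaceVar w), sqrt_abs_add_le (timeVar z) (timeVar w)]

theorem gauge_neg (z : Pt d) : gauge (-z) = gauge z := by simp [gauge]

theorem gauge_le_sub_add (z w : Pt d) : gauge z ≤ gauge (z - w) + gauge w := by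
  simpa using gauge_add_le (z - w) w

theorem continuous_gauge : Continuous (gauge : Pt d → ℝ) := by
  unfold gauge
  exact continuous_spaceVar.norm.add continuous_timeVar.abs.sqrt

theorem one_add_gauge_le (z : Pt d) : 1 + gauge z ≤ 2 * (1 + ‖z‖) := by
  have h : √|timeVar z| ≤ 1 + |timeVar z| := by
    rw [Real.sqrt_le_iff]
    constructor
    · positivity
    · nlinarith [abs_nonneg (timeVar z)]
  unfold gauge
  linarith [norm_spaceVar_le z, abs_timeVar_le z]

theorem norm_le_gauge (z : Pt d) : ‖z‖ ≤ gauge z * (1 + gauge z) := by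
  have h := Real.sq_sqrt (abs_nonneg (timeVar z))
  have := norm_le_split z
  have h1 := Real.sqrt_nonneg |timeVar z|
  have h2 := norm_nonneg (spaceVar z)
  unfold gauge
  nlinarith [mul_nonneg h1 h2]

/-- The parabolic dilation `(x, t) ↦ (r x, r² t)`. -/
def dil (r : ℝ) : Pt d →L[ℝ] Pt d :=
  LinearMap.toContinuousLinearMap
    { toFun := fun z => WithLp.toLp 2 fun i => (if i = Fin.last d then r ^ 2 else r) * z i
      map_add' := fun x y => by ext i; simp [mul_add]
      map_smul' := fun c x => by ext i; simp [mul_left_comm] }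

theorem dil_apply (r : ℝ) (z : Pt d) (i : Fin (d + 1)) :
    dil r z i = (if i = Fin.last d then r ^ 2 else r) * z i := rfl

@[simp] theorem spaceVar_dil (r : ℝ) (z : Pt d) : spaceVar (dil r z) = r • spaceVar z := by
  ext i
  simp [spaceVar_apply, dil_apply, (Fin.castSucc_lt_last i).ne]

@[simp] theorem timeVar_dil (r : ℝ) (z : Pt d) : timeVar (dil r z) = r ^ 2 * timeVar z := by
  simp [timeVar, dil_apply]

theorem dil_dil (r s : ℝ) (z : Pt d) : dil r (dil s z) = dil (r * s) z := by
  apply pt_ext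
  · simp [mul_smul]
  · simp; ring

@[simp] theorem dil_one (z : Pt d) : dil 1 z = z := by apply pt_ext <;> simp

theorem inner_dil (r : ℝ) (z w : Pt d) : inner ℝ (dil r z) w = inner ℝ z (dil r w) := by
  simp only [inner_eq_split, spaceVar_dil, timeVar_dil, inner_smul_left, inner_smul_right]
  simp; ring

theorem gauge_dil {r : ℝ} (hr : 0 ≤ r) (z : Pt d) : gauge (dil r z) = r * gauge z := by
  unfold gauge
  rw [spaceVar_dil, timeVar_dil, norm_smul, abs_mul, Real.sqrt_mul (abs_nonneg _), abs_pow,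
    Real.sqrt_sq (abs_nonneg r), Real.norm_eq_abs, abs_of_nonneg hr]
  ring

theorem norm_dil_le_of_le_one {r : ℝ} (hr : 0 ≤ r) (hr1 : r ≤ 1) (z : Pt d) :
    ‖dil r z‖ ≤ r * ‖z‖ := by
  apply le_of_sq_le_sq _ (by positivity)
  rw [norm_sq_split, mul_pow, norm_sq_split z, spaceVar_dil, timeVar_dil, norm_smul,
    Real.norm_eq_abs, abs_of_nonneg hr]
  have : r ^ 4 ≤ r ^ 2 := pow_le_pow_of_le_one hr hr1 (by norm_num)
  nlinarith [sq_nonneg (timeVar z), mul_nonneg (sub_nonneg.2 this) (sq_nonneg (timeVar z))]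

theorem norm_dil_le_of_one_le {r : ℝ} (hr : 1 ≤ r) (z : Pt d) : ‖dil r z‖ ≤ r ^ 2 * ‖z‖ := by
  apply le_of_sq_le_sq _ (by positivity)
  rw [norm_sq_split, mul_pow, norm_sq_split z, spaceVar_dil, timeVar_dil, norm_smul,
    Real.norm_eq_abs, abs_of_nonneg (by linarith)]
  have : r ^ 2 ≤ r ^ 4 := pow_le_pow_right₀ hr (by norm_num)
  nlinarith [mul_nonneg (sub_nonneg.2 this) (sq_nonneg ‖spaceVar z‖)]

theorem le_norm_dil_of_one_le {r : ℝ} (hr : 1 ≤ r) (z : Pt d) : r * ‖z‖ ≤ ‖dil r z‖ := by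
  have h := norm_dil_le_of_le_one (r := r⁻¹) (by positivity) (inv_le_one_of_one_le₀ hr) (dil r z)
  rw [dil_dil, inv_mul_cancel₀ (by positivity), dil_one] at h
  rwa [inv_mul_eq_div, le_div_iff₀ (by positivity), mul_comm] at h

theorem det_dil (r : ℝ) : LinearMap.det (dil (d := d) r : Pt d →ₗ[ℝ] Pt d) = r ^ (d + 2) := by
  rw [← LinearMap.det_toMatrix (EuclideanSpace.basisFun (Fin (d + 1)) ℝ).toBasis]
  have : LinearMap.toMatrix (EuclideanSpace.basisFun (Fin (d + 1)) ℝ).toBasis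
      (EuclideanSpace.basisFun (Fin (d + 1)) ℝ).toBasis (dil (d := d) r : Pt d →ₗ[ℝ] Pt d)
      = Matrix.diagonal fun i => if i = Fin.last d then r ^ 2 else r := by
    ext i j
    rw [LinearMap.toMatrix_apply, Matrix.diagonal_apply]
    simp only [OrthonormalBasis.coe_toBasis, EuclideanSpace.basisFun_apply,
      OrthonormalBasis.coe_toBasis_repr_apply, EuclideanSpace.basisFun_repr,
      ContinuousLinearMap.coe_coe, dil_apply]
    by_cases h : i = j
    · simp [h]
    · simp [h]
  rw [this, Matrix.det_diagonal, Fin.prod_univ_castSucc]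
  simp [(Fin.castSucc_lt_last _).ne]
  ring

theorem map_dil_volume {r : ℝ} (hr : 0 < r) :
    Measure.map (dil r : Pt d → Pt d) volume = ENNReal.ofReal ((r ^ (d + 2))⁻¹) • volume := by
  have h := Measure.map_linearMap_addHaar_eq_smul_addHaar (μ := (volume : Measure (Pt d)))
    (f := (dil (d := d) r : Pt d →ₗ[ℝ] Pt d)) (by rw [det_dil]; positivity)
  rw [det_dil, abs_of_pos (by positivity)] at h
  exact h

/-- The parabolic dilation as a homeomorphism. -/
def dilHomeo (r : ℝ) (hr : 0 < r) : Pt d ≃ₜ Pt d where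
  toFun := dil r
  invFun := dil r⁻¹
  left_inv z := by simp [dil_dil, inv_mul_cancel₀ hr.ne']
  right_inv z := by simp [dil_dil, mul_inv_cancel₀ hr.ne']
  continuous_toFun := (dil r).continuous
  continuous_invFun := (dil r⁻¹).continuous

theorem measurableEmbedding_dil {r : ℝ} (hr : 0 < r) : MeasurableEmbedding (dil (d := d) r) :=
  (dilHomeo r hr).measurableEmbedding

theorem lintegral_comp_dil {r : ℝ} (hr : 0 < r) (F : Pt d → ℝ≥0∞) :
    ∫⁻ z, F (dil r z) = ENNReal.ofReal ((r ^ (d + 2))⁻¹) * ∫⁻ z, F z := by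
  rw [← (measurableEmbedding_dil hr).lintegral_map, map_dil_volume hr, lintegral_smul_measure,
    smul_eq_mul]

theorem integral_comp_dil {E : Type*} [NormedAddCommGroup E] [NormedSpace ℝ E] {r : ℝ}
    (hr : 0 < r) (F : Pt d → E) : ∫ z, F (dil r z) = (r ^ (d + 2))⁻¹ • ∫ z, F z := by
  rw [← (measurableEmbedding_dil hr).integral_map, map_dil_volume hr, integral_smul_measure,
    ENNReal.toReal_ofReal (by positivity)]

theorem integrable_comp_dil {E : Type*} [NormedAddCommGroup E] {r : ℝ}
    (hr : 0 < r) {F : Pt d → E} (hF : Integrable F) : Integrable fun z => F (dil r z) := by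
  have := (measurableEmbedding_dil hr).integrable_map_iff (μ := (volume : Measure (Pt d))) (g := F)
  rw [map_dil_volume hr] at this
  exact this.1 (hF.smul_measure ENNReal.ofReal_ne_top)

/-- The identification of `ℝⁿ` with `ℝᵈ × ℝ`. -/
def splitEquiv (d : ℕ) : Pt d ≃ᵐ EuclideanSpace ℝ (Fin d) × ℝ :=
  (((MeasurableEquiv.toLp 2 (Fin (d + 1) → ℝ)).symm.trans
    (MeasurableEquiv.piFinSuccAbove (fun _ => ℝ) (Fin.last d))).trans
      MeasurableEquiv.prodComm).trans
        ((MeasurableEquiv.toLp 2 (Fin d → ℝ)).prodCongr (MeasurableEquiv.refl ℝ))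

theorem splitEquiv_apply (z : Pt d) : splitEquiv d z = (spaceVar z, timeVar z) := by
  refine Prod.ext ?_ rfl
  ext i
  exact congrArg z.ofLp (Fin.succAbove_last_apply i)

theorem measurePreserving_splitEquiv (d : ℕ) : MeasurePreserving (splitEquiv d) := by
  have h1 := EuclideanSpace.volume_preserving_symm_measurableEquiv_toLp (Fin (d + 1))
  have h2 := volume_preserving_piFinSuccAbove (fun _ : Fin (d + 1) => ℝ) (Fin.last d)
  have h3 : MeasurePreserving (Prod.swap : ℝ × (Fin d → ℝ) → (Fin d → ℝ) × ℝ) volume volume :=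
    Measure.measurePreserving_swap
  have h4 := (EuclideanSpace.volume_preserving_symm_measurableEquiv_toLp (Fin d)).symm
  have h5 := h4.prod (MeasurePreserving.id (volume : Measure ℝ))
  exact h5.comp (h3.comp (h2.comp h1))

/-- The point `(x, t)`. -/
def joinPt (x : EuclideanSpace ℝ (Fin d)) (t : ℝ) : Pt d := (splitEquiv d).symm (x, t)

@[simp] theorem spaceVar_joinPt (x : EuclideanSpace ℝ (Fin d)) (t : ℝ) :
    spaceVar (joinPt x t) = x := by
  have := splitEquiv_apply (joinPt x t)
  rw [joinPt, MeasurableEquiv.apply_symm_apply] at this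
  exact (congrArg Prod.fst this).symm

@[simp] theorem timeVar_joinPt (x : EuclideanSpace ℝ (Fin d)) (t : ℝ) :
    timeVar (joinPt x t) = t := by
  have := splitEquiv_apply (joinPt x t)
  rw [joinPt, MeasurableEquiv.apply_symm_apply] at this
  exact (congrArg Prod.snd this).symm

theorem withTime_eq (z : Pt d) (s : ℝ) : withTime z s = joinPt (spaceVar z) s := by
  apply pt_ext
  · ext i
    simp [withTime, spaceVar_apply, (Fin.castSucc_lt_last _).ne]
  · rw [timeVar_joinPt]; simp [withTime, timeVar]

theorem measurePreserving_joinPt :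
    MeasurePreserving (fun p : EuclideanSpace ℝ (Fin d) × ℝ => joinPt p.1 p.2) :=
  (measurePreserving_splitEquiv d).symm

theorem integrable_split {E : Type*} [NormedAddCommGroup E]
    {F : EuclideanSpace ℝ (Fin d) × ℝ → E} (hF : Integrable F) :
    Integrable fun z : Pt d => F (spaceVar z, timeVar z) := by
  have := (measurePreserving_splitEquiv d).integrable_comp_of_integrable hF
  simpa [Function.comp_def, splitEquiv_apply] using this

theorem integrable_one_add_sqrt {β : ℝ} (hβ : 2 < β) :
    Integrable fun t : ℝ => (1 + √|t|) ^ (-β) := by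
  have h := integrable_one_add_norm (E := ℝ) (μ := volume) (r := β / 2) (by simp; linarith)
  refine h.mono' (Continuous.aestronglyMeasurable ?_) (Filter.Eventually.of_forall fun t => ?_)
  · refine Continuous.rpow_const (by fun_prop) fun t => Or.inl (by positivity)
  · rw [Real.norm_of_nonneg (by positivity), Real.norm_eq_abs]
    have h1 : 1 + |t| ≤ (1 + √|t|) ^ (2 : ℝ) := by
      have := Real.sq_sqrt (abs_nonneg t)
      have := Real.sqrt_nonneg |t|
      norm_cast
      nlinarith
    calc (1 + √|t|) ^ (-β) = ((1 + √|t|) ^ (2 : ℝ)) ^ (-(β / 2)) := by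
          rw [← Real.rpow_mul (by positivity)]; ring_nf
      _ ≤ (1 + |t|) ^ (-(β / 2)) :=
          Real.rpow_le_rpow_of_nonpos (by positivity) h1 (by linarith)

theorem integrable_split_weight {α β : ℝ} (hα : (d : ℝ) < α) (hβ : 2 < β) :
    Integrable fun z : Pt d => (1 + ‖spaceVar z‖) ^ (-α) * (1 + √|timeVar z|) ^ (-β) := by
  have h := (integrable_one_add_norm (E := EuclideanSpace ℝ (Fin d)) (μ := volume) (r := α)
    (by simpa using hα)).mul_prod (integrable_one_add_sqrt hβ)
  exact integrable_split h

/-- The homogeneous dimension of `ℝᵈ × ℝ` with parabolic dilations is `d + 2`. -/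
theorem integrable_gauge {s : ℝ} (hs : (d : ℝ) + 2 < s) :
    Integrable fun z : Pt d => (1 + gauge z) ^ (-s) := by
  have h := integrable_split_weight (d := d) (α := (s + d - 2) / 2) (β := (s - d + 2) / 2)
    (by linarith) (by linarith)
  refine h.mono' (Continuous.aestronglyMeasurable ?_) (Filter.Eventually.of_forall fun z => ?_)
  · refine Continuous.rpow_const (continuous_const.add continuous_gauge) fun t => Or.inl ?_
    have := gauge_nonneg t
    positivity
  · have hg := gauge_nonneg z
    rw [Real.norm_of_nonneg (by positivity)]
    have : -s = -((s + d - 2) / 2) + -((s - d + 2) / 2) := by ring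
    rw [this, Real.rpow_add (by positivity)]
    gcongr ?_ * ?_
    · apply Real.rpow_le_rpow_of_nonpos (by positivity) _ _
      · unfold gauge; linarith [Real.sqrt_nonneg |timeVar z|]
      · have : (0 : ℝ) ≤ d := by positivity
        linarith
    · apply Real.rpow_le_rpow_of_nonpos (by positivity) _ (by linarith)
      · unfold gauge; linarith [norm_nonneg (spaceVar z)]

/-- Schwartz functions decay faster than any power of the gauge. -/
theorem exists_gauge_decay {E : Type*} [NormedAddCommGroup E] [NormedSpace ℝ E] (φ : 𝓢(Pt d, E))
    (M : ℕ) : ∃ C : ℝ, 0 ≤ C ∧ ∀ z, (1 + gauge z) ^ M * ‖φ z‖ ≤ C := by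
  have h := fun z => φ.one_add_le_sup_seminorm_apply (𝕜 := ℝ) (m := (M, 0)) (k := M) (n := 0)
    le_rfl le_rfl z
  simp only [norm_iteratedFDeriv_zero] at h
  refine ⟨2 ^ M * (2 ^ M * ((Finset.Iic (M, 0)).sup fun m =>
    SchwartzMap.seminorm ℝ m.1 m.2) φ), by positivity, fun z => ?_⟩
  have hg := gauge_nonneg z
  calc (1 + gauge z) ^ M * ‖φ z‖ ≤ (2 * (1 + ‖z‖)) ^ M * ‖φ z‖ := by
        gcongr; exact one_add_gauge_le z
    _ = 2 ^ M * ((1 + ‖z‖) ^ M * ‖φ z‖) := by rw [mul_pow, mul_assoc]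
    _ ≤ _ := mul_le_mul_of_nonneg_left (h z) (by positivity)

end Parabolic

end

/-! ### Homogeneous symbols and smooth cutoffs -/

noncomputable section

namespace Parabolic

open Filter Topology
open scoped ContDiff

variable {d : ℕ}

theorem gauge_eq_zero {z : Pt d} : gauge z = 0 ↔ z = 0 := by
  constructor
  · intro h
    have := norm_le_gauge z
    rw [h, zero_mul] at this
    exact norm_le_zero_iff.1 this
  · rintro rfl
    have h := gauge_dil (le_refl (0 : ℝ)) (0 : Pt d)
    simpa using h

theorem gauge_pos {z : Pt d} (hz : z ≠ 0) : 0 < gauge z :=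
  lt_of_le_of_ne (gauge_nonneg z) fun h => hz (gauge_eq_zero.1 h.symm)

theorem dil_ne_zero {r : ℝ} (hr : 0 < r) {z : Pt d} (hz : z ≠ 0) : dil r z ≠ 0 := fun h => by
  have := gauge_dil hr.le z
  rw [h, gauge_eq_zero.2 rfl] at this
  exact (mul_pos hr (gauge_pos hz)).ne this

theorem isCompact_gaugeSphere : IsCompact {z : Pt d | gauge z = 1} := by
  refine Metric.isCompact_of_isClosed_isBounded (isClosed_eq continuous_gauge continuous_const) ?_
  refine (Metric.isBounded_closedBall (x := (0 : Pt d)) (r := 2)).subset fun z hz => ?_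
  have := norm_le_gauge z
  simp only [Set.mem_ofPred_eq] at hz
  rw [hz] at this
  simp only [Metric.mem_closedBall, dist_zero_right]
  linarith

/-- `m` is smooth away from the origin and homogeneous of degree `a` for the parabolic dilations. -/
structure HomSymbol (a : ℤ) (m : Pt d → ℝ) : Prop where
  smooth : ∀ z, z ≠ 0 → ContDiffAt ℝ ∞ m z
  hom : ∀ r, 0 < r → ∀ z, m (dil r z) = r ^ a * m z

namespace HomSymbol

variable {a : ℤ} {m : Pt d → ℝ}

theorem comp_neg (h : HomSymbol a m) : HomSymbol a fun z => m (-z) where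
  smooth z hz := (h.smooth (-z) (neg_ne_zero.2 hz)).comp z contDiff_neg.contDiffAt
  hom r hr z := by rw [← map_neg, h.hom r hr]

theorem measurable (h : HomSymbol a m) : Measurable m := by
  have h1 : ContinuousOn m {0}ᶜ := fun z hz => (h.smooth z hz).continuousAt.continuousWithinAt
  exact measurable_of_continuousOn_compl_singleton 0 h1

/-- By homogeneity it is enough to bound the symbol on the compact gauge sphere. -/
theorem exists_bound (h : HomSymbol a m) :
    ∃ B : ℝ, 0 ≤ B ∧ ∀ z, z ≠ 0 → |m z| ≤ B * gauge z ^ a := by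
  have hc : ContinuousOn m {z : Pt d | gauge z = 1} := fun z hz =>
    (h.smooth z fun h0 => by simp [gauge_eq_zero.2 h0] at hz).continuousAt.continuousWithinAt
  obtain ⟨B, hB⟩ := isCompact_gaugeSphere.exists_bound_of_continuousOn hc
  refine ⟨max B 0, le_max_right _ _, fun z hz => ?_⟩
  have hg := gauge_pos hz
  have h1 := h.hom (gauge z) hg (dil (gauge z)⁻¹ z)
  rw [dil_dil, mul_inv_cancel₀ hg.ne', dil_one] at h1
  have h2 := hB (dil (gauge z)⁻¹ z) (by
    simp [gauge_dil (inv_nonneg.2 hg.le), inv_mul_cancel₀ hg.ne'])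
  rw [h1, abs_mul, abs_of_pos (zpow_pos hg a), mul_comm]
  gcongr
  exact h2.trans (le_max_left _ _)

theorem exists_bound_zero {m : Pt d → ℝ} (h : HomSymbol 0 m) :
    ∃ B : ℝ, 0 ≤ B ∧ ∀ z, |m z| ≤ B := by
  obtain ⟨B, hB0, hB⟩ := h.exists_bound
  refine ⟨max B |m 0|, le_max_of_le_left hB0, fun z => ?_⟩
  by_cases hz : z = 0
  · rw [hz]; exact le_max_right _ _
  · have := hB z hz
    rw [zpow_zero, mul_one] at this
    exact this.trans (le_max_left _ _)

end HomSymbol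

/-- A smooth cutoff: `1` on the unit ball, `0` off the ball of radius `2`. -/
def chi : Pt d → ℝ := ((⟨1, 2, one_pos, one_lt_two⟩ : ContDiffBump (0 : Pt d)) : Pt d → ℝ)

theorem chi_contDiff : ContDiff ℝ ∞ (chi : Pt d → ℝ) := ContDiffBump.contDiff _

theorem chi_nonneg (z : Pt d) : 0 ≤ chi z := ContDiffBump.nonneg _

theorem chi_le_one (z : Pt d) : chi z ≤ 1 := ContDiffBump.le_one _

theorem abs_chi_sub_chi_le (z w : Pt d) : |chi z - chi w| ≤ 1 := by
  have h1 := chi_nonneg z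
  have h2 := chi_nonneg w
  have h3 := chi_le_one z
  have h4 := chi_le_one w
  rw [abs_le]
  constructor <;> linarith

theorem chi_eq_one {z : Pt d} (hz : ‖z‖ ≤ 1) : chi z = 1 :=
  ContDiffBump.one_of_mem_closedBall _ (by simpa using hz)

theorem chi_eq_zero {z : Pt d} (hz : 2 ≤ ‖z‖) : chi z = 0 :=
  ContDiffBump.zero_of_le_dist _ (by simpa using hz)

theorem chi_hasCompactSupport : HasCompactSupport (chi : Pt d → ℝ) :=
  ContDiffBump.hasCompactSupport _

/-- The building block of a dyadic partition of unity: it is supported in `1/4 ≤ ‖z‖ ≤ 2`, and its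
sums over dyadic dilations telescope. -/
def psi (z : Pt d) : ℝ := chi z - chi (dil 2 z)

theorem psi_contDiff : ContDiff ℝ ∞ (psi : Pt d → ℝ) :=
  chi_contDiff.sub (chi_contDiff.comp (dil 2).contDiff)

theorem psi_eq_zero_of_le {z : Pt d} (hz : ‖z‖ ≤ 1 / 4) : psi z = 0 := by
  have := norm_dil_le_of_one_le (r := 2) (by norm_num) z
  rw [psi, chi_eq_one (by linarith), chi_eq_one (by linarith), sub_self]

theorem psi_eq_zero_of_ge {z : Pt d} (hz : 2 ≤ ‖z‖) : psi z = 0 := by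
  have := le_norm_dil_of_one_le (r := 2) (by norm_num) z
  rw [psi, chi_eq_zero (by linarith), chi_eq_zero (by linarith), sub_self]

/-- A function which is smooth off the origin and vanishes near the origin is smooth. -/
theorem contDiff_of_eq_zero_near {F : Pt d → ℝ} (hF : ∀ z, z ≠ 0 → ContDiffAt ℝ ∞ F z)
    {ε : ℝ} (hε : 0 < ε) (h0 : ∀ z, ‖z‖ ≤ ε → F z = 0) : ContDiff ℝ ∞ F := by
  rw [contDiff_iff_contDiffAt]
  intro z
  by_cases hz : z = 0
  · have : F =ᶠ[𝓝 z] fun _ => 0 := by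
      filter_upwards [Metric.ball_mem_nhds z hε] with w hw
      apply h0
      rw [hz] at hw
      simpa using (Metric.mem_ball.1 hw).le
    exact contDiffAt_const.congr_of_eventuallyEq this
  · exact hF z hz

/-- A dyadic piece of a symbol, as a Schwartz function. -/
theorem HomSymbol.exists_piece {a : ℤ} {m : Pt d → ℝ} (h : HomSymbol a m) :
    ∃ θ : 𝓢(Pt d, ℂ), ∀ z, θ z = ((m z * psi z : ℝ) : ℂ) := by
  have h1 : ContDiff ℝ ∞ fun z : Pt d => m z * psi z := by
    apply contDiff_of_eq_zero_near (ε := 1 / 4) _ (by norm_num)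
    · intro z hz
      rw [psi_eq_zero_of_le hz, mul_zero]
    · intro z hz
      exact (h.smooth z hz).mul psi_contDiff.contDiffAt
  have h2 : HasCompactSupport fun z : Pt d => ((m z * psi z : ℝ) : ℂ) := by
    refine HasCompactSupport.of_support_subset_isCompact (isCompact_closedBall (0 : Pt d) 2) ?_
    intro z hz
    by_contra h3
    apply hz
    simp only [Metric.mem_closedBall, dist_zero_right, not_le] at h3
    simp [psi_eq_zero_of_ge h3.le]
  exact ⟨h2.toSchwartzMap (Complex.ofRealCLM.contDiff.comp h1), fun z => rfl⟩

/-- `chi`, as a Schwartz function. -/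
theorem exists_chi_schwartz : ∃ θ : 𝓢(Pt d, ℂ), ∀ z, θ z = (chi z : ℂ) :=
  ⟨(chi_hasCompactSupport.comp_left (g := Complex.ofReal) Complex.ofReal_zero).toSchwartzMap
    (Complex.ofRealCLM.contDiff.comp chi_contDiff), fun _ => rfl⟩

/-- The derivatives of a homogeneous symbol grow at most polynomially away from the origin: they
are bounded on the gauge sphere, and the dilation which maps `z` to it is a contraction. -/
theorem HomSymbol.exists_iteratedFDeriv_bound {a : ℤ} {m : Pt d → ℝ} (h : HomSymbol a m) (n : ℕ) :
    ∃ C : ℝ, 0 ≤ C ∧ ∀ z, 1 ≤ gauge z →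
      ‖iteratedFDeriv ℝ n m z‖ ≤ C * (1 + ‖z‖) ^ a.natAbs := by
  have ho : IsOpen ({0}ᶜ : Set (Pt d)) := isOpen_compl_singleton
  have hon : ContDiffOn ℝ ∞ m {0}ᶜ := fun z hz => (h.smooth z hz).contDiffWithinAt
  have hc : ContinuousOn (iteratedFDeriv ℝ n m) {z : Pt d | gauge z = 1} := by
    have h1 := hon.continuousOn_iteratedFDerivWithin (m := n) (mod_cast le_top) ho.uniqueDiffOn
    have h2 : ContinuousOn (iteratedFDeriv ℝ n m) {0}ᶜ :=
      h1.congr fun z hz => (iteratedFDerivWithin_of_isOpen n ho hz).symm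
    refine h2.mono fun z hz h0 => ?_
    simp only [Set.mem_singleton_iff] at h0
    simp [gauge_eq_zero.2 h0] at hz
  obtain ⟨B, hB⟩ := isCompact_gaugeSphere.exists_bound_of_continuousOn hc
  refine ⟨max B 0 * 2 ^ a.natAbs, by positivity, fun z hz => ?_⟩
  have hg : 0 < gauge z := by linarith
  have hz0 : z ≠ 0 := fun h0 => by rw [gauge_eq_zero.2 h0] at hg; exact lt_irrefl _ hg
  have hs : 0 < (gauge z)⁻¹ := inv_pos.2 hg
  have hpre : (dil (d := d) (gauge z)⁻¹ ⁻¹' {0}ᶜ) = {0}ᶜ := by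
    ext w
    simp only [Set.mem_preimage, Set.mem_compl_iff, Set.mem_singleton_iff]
    refine not_congr ⟨fun hw => ?_, fun hw => by rw [hw, map_zero]⟩
    by_contra hw'
    exact dil_ne_zero hs hw' hw
  have hm : m = (gauge z) ^ a • (m ∘ dil (gauge z)⁻¹) := by
    ext w
    simp only [Pi.smul_apply, Function.comp, smul_eq_mul]
    rw [h.hom _ hs, ← mul_assoc, inv_zpow, mul_inv_cancel₀ (zpow_pos hg a).ne', one_mul]
  have h3 : iteratedFDeriv ℝ n (m ∘ dil (gauge z)⁻¹) z
      = (iteratedFDeriv ℝ n m (dil (gauge z)⁻¹ z)).compContinuousLinearMap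
        fun _ => dil (gauge z)⁻¹ := by
    have h4 := (dil (d := d) (gauge z)⁻¹).iteratedFDerivWithin_comp_right hon ho.uniqueDiffOn
      (by rw [hpre]; exact ho.uniqueDiffOn) (x := z) (dil_ne_zero hs hz0) (i := n)
      (mod_cast le_top)
    rwa [hpre, iteratedFDerivWithin_of_isOpen n ho hz0,
      iteratedFDerivWithin_of_isOpen n ho (dil_ne_zero hs hz0)] at h4
  have hop : ‖dil (d := d) (gauge z)⁻¹‖ ≤ 1 :=
    ContinuousLinearMap.opNorm_le_bound _ zero_le_one fun w =>
      (norm_dil_le_of_le_one hs.le (inv_le_one_of_one_le₀ hz) w).trans (by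
        have := inv_le_one_of_one_le₀ hz
        gcongr)
  have h5 : ‖iteratedFDeriv ℝ n (m ∘ dil (gauge z)⁻¹) z‖ ≤ max B 0 := by
    rw [h3]
    refine (ContinuousMultilinearMap.norm_compContinuousLinearMap_le _ _).trans ?_
    have h6 := hB (dil (gauge z)⁻¹ z) (by
      simp [gauge_dil hs.le, inv_mul_cancel₀ hg.ne'])
    calc _ ≤ max B 0 * ∏ _i : Fin n, (1 : ℝ) := by
          gcongr
          · exact h6.trans (le_max_left _ _)
      _ = _ := by simp
  have h7 : iteratedFDeriv ℝ n m z = gauge z ^ a • iteratedFDeriv ℝ n (m ∘ dil (gauge z)⁻¹) z := by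
    conv_lhs => rw [hm]
    apply iteratedFDeriv_const_smul_apply
    have := (h.smooth _ (dil_ne_zero hs hz0)).comp z (dil (d := d) (gauge z)⁻¹).contDiff.contDiffAt
    exact this.of_le (mod_cast le_top)
  have h8 : gauge z ^ a ≤ (2 * (1 + ‖z‖)) ^ a.natAbs := by
    calc gauge z ^ a ≤ gauge z ^ (a.natAbs : ℤ) :=
          zpow_le_zpow_right₀ hz Int.le_natAbs
      _ = gauge z ^ a.natAbs := zpow_natCast _ _
      _ ≤ _ := by
          gcongr
          linarith [one_add_gauge_le z]
  rw [h7, norm_smul, Real.norm_of_nonneg (zpow_pos hg a).le]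
  calc _ ≤ (2 * (1 + ‖z‖)) ^ a.natAbs * max B 0 := by gcongr
    _ = _ := by rw [mul_pow]; ring

theorem HomSymbol.contDiff_cut {a : ℤ} {m : Pt d → ℝ} (h : HomSymbol a m) :
    ContDiff ℝ ∞ fun z : Pt d => (1 - chi z) * m z :=
  contDiff_of_eq_zero_near (fun z hz =>
    (contDiffAt_const.sub chi_contDiff.contDiffAt).mul (h.smooth z hz)) one_pos fun z hz => by
      rw [chi_eq_one hz, sub_self, zero_mul]

theorem HomSymbol.hasTemperateGrowth_cut_one {a : ℤ} {m : Pt d → ℝ} (h : HomSymbol a m) :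
    Function.HasTemperateGrowth fun z : Pt d => (1 - chi z) * m z := by
  refine ⟨h.contDiff_cut, fun n => ?_⟩
  obtain ⟨C, hC0, hC⟩ := h.exists_iteratedFDeriv_bound n
  have hcont : Continuous (iteratedFDeriv ℝ n fun z : Pt d => (1 - chi z) * m z) :=
    h.contDiff_cut.continuous_iteratedFDeriv (mod_cast le_top)
  obtain ⟨B, hB⟩ := (isCompact_closedBall (0 : Pt d) 2).exists_bound_of_continuousOn
    hcont.continuousOn
  refine ⟨a.natAbs, max B C, fun z => ?_⟩
  have h1 : (1 : ℝ) ≤ (1 + ‖z‖) ^ a.natAbs := one_le_pow₀ (by linarith [norm_nonneg z])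
  by_cases hz : ‖z‖ ≤ 2
  · calc _ ≤ B := hB z (by simpa using hz)
      _ ≤ max B C * 1 := by rw [mul_one]; exact le_max_left _ _
      _ ≤ _ := by
          have := hC0.trans (le_max_right B C)
          gcongr
  · push Not at hz
    have he : (fun z : Pt d => (1 - chi z) * m z) =ᶠ[𝓝 z] m := by
      filter_upwards [(isOpen_lt continuous_const continuous_norm).mem_nhds hz] with w hw
      rw [chi_eq_zero (le_of_lt hw), sub_zero, one_mul]
    have hg : 1 ≤ gauge z := by
      by_contra! hg
      have := norm_le_gauge z
      nlinarith [gauge_nonneg z]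
    rw [he.iteratedFDeriv ℝ n |>.eq_of_nhds]
    refine (hC z hg).trans ?_
    gcongr
    exact le_max_right _ _

/-- Away from the origin a homogeneous symbol acts on Schwartz functions. -/
theorem HomSymbol.hasTemperateGrowth_cut {a : ℤ} {m : Pt d → ℝ} (h : HomSymbol a m) {r : ℝ}
    (hr : 0 < r) : Function.HasTemperateGrowth fun z : Pt d => (1 - chi (dil r z)) * m z := by
  have h1 := (Function.HasTemperateGrowth.const ((r ^ a)⁻¹ : ℝ) (E := Pt d)).mul
    (h.hasTemperateGrowth_cut_one.comp (dil (d := d) r).hasTemperateGrowth)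
  have h2 : (fun z : Pt d => (1 - chi (dil r z)) * m z)
      = fun z => (r ^ a)⁻¹ * ((1 - chi (dil r z)) * m (dil r z)) := by
    ext z
    rw [h.hom r hr]
    field_simp [(zpow_pos hr a).ne']
  rw [h2]
  exact h1

end Parabolic

end

/-! ### Fourier multipliers on Schwartz functions and their low frequency parts -/

noncomputable section

namespace Parabolic

open Filter Topology
open scoped ContDiff

variable {d e : ℕ}

theorem integrable_char_smul (z : Pt d) {f : Pt d → ℂ} (hf : Integrable f) :
    Integrable fun ζ => 𝐞 (inner ℝ ζ z) • f ζ := by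
  refine hf.norm.mono' (AEStronglyMeasurable.smul (f := fun ζ => 𝐞 (inner ℝ ζ z)) ?_
    hf.aestronglyMeasurable) (Eventually.of_forall fun ζ => by simp)
  exact (Real.continuous_fourierChar.comp (by fun_prop)).aestronglyMeasurable

theorem fourierMul_apply (m : Pt d → ℝ) (φ : 𝓢(Pt d, ℂ)) (z : Pt d) :
    fourierMul m φ z = ∫ ζ, 𝐞 (inner ℝ ζ z) • ((m ζ : ℂ) * (𝓕 φ : 𝓢(Pt d, ℂ)) ζ) := by
  rw [fourierMul, Real.fourierInv_eq]

theorem fourier_inversion (φ : 𝓢(Pt d, ℂ)) (z : Pt d) :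
    φ z = ∫ ζ, 𝐞 (inner ℝ ζ z) • (𝓕 φ : 𝓢(Pt d, ℂ)) ζ := by
  rw [← Real.fourierInv_eq, ← SchwartzMap.fourierInv_coe, FourierTransform.fourierInv_fourier_eq]

theorem fourierMul_eq_of_fourier_eq {m a b : Pt d → ℝ} {φ Φ : 𝓢(Pt d, ℂ)}
    (hΦ : ∀ ζ, (𝓕 Φ : 𝓢(Pt d, ℂ)) ζ = (a ζ : ℂ) * (𝓕 φ : 𝓢(Pt d, ℂ)) ζ)
    (hb : ∀ ζ, (𝓕 φ : 𝓢(Pt d, ℂ)) ζ = 0 ∨ m ζ * a ζ = b ζ) :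
    fourierMul m Φ = fourierMul b φ := by
  ext z
  simp only [fourierMul_apply]
  congr 1
  ext ζ
  rw [hΦ]
  rcases hb ζ with h | h
  · rw [h]; simp
  · rw [← h]; push_cast; rw [mul_assoc]

theorem fourierMul_one (φ : 𝓢(Pt d, ℂ)) : fourierMul (fun _ => 1) φ = φ := by
  ext z
  rw [fourierMul_apply, fourier_inversion φ z]
  simp

/-- A multiplier of temperate growth maps Schwartz functions to Schwartz functions. -/
theorem exists_fourier_eq_mul {a : Pt d → ℝ} (ha : Function.HasTemperateGrowth a)
    (φ : 𝓢(Pt d, ℂ)) :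
    ∃ Φ : 𝓢(Pt d, ℂ), ∀ ζ, (𝓕 Φ : 𝓢(Pt d, ℂ)) ζ = (a ζ : ℂ) * (𝓕 φ : 𝓢(Pt d, ℂ)) ζ := by
  refine ⟨𝓕⁻ (SchwartzMap.smulLeftCLM ℂ a (𝓕 φ)), fun ζ => ?_⟩
  rw [FourierTransform.fourier_fourierInv_eq, SchwartzMap.smulLeftCLM_apply_apply ha]
  simp

theorem coe_eq_fourierMul {a : Pt d → ℝ} {φ Φ : 𝓢(Pt d, ℂ)}
    (hΦ : ∀ ζ, (𝓕 Φ : 𝓢(Pt d, ℂ)) ζ = (a ζ : ℂ) * (𝓕 φ : 𝓢(Pt d, ℂ)) ζ) :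
    (Φ : Pt d → ℂ) = fourierMul a φ := by
  rw [← fourierMul_one Φ]
  exact fourierMul_eq_of_fourier_eq hΦ fun ζ => Or.inr (one_mul _)

/-- Multipliers of at most polynomial growth give absolutely convergent Fourier integrals. -/
theorem integrable_mul_fourier {m : Pt d → ℝ} (hm : Measurable m) {B : ℝ} {k : ℕ}
    (hB : ∀ ζ, |m ζ| ≤ B * (1 + ‖ζ‖) ^ k) (φ : 𝓢(Pt d, ℂ)) :
    Integrable fun ζ => (m ζ : ℂ) * (𝓕 φ : 𝓢(Pt d, ℂ)) ζ := by
  have h1 : Integrable fun ζ => (1 + ‖ζ‖) ^ k * ‖(𝓕 φ : 𝓢(Pt d, ℂ)) ζ‖ := by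
    have h2 := fun j : ℕ => (𝓕 φ : 𝓢(Pt d, ℂ)).integrable_pow_mul (μ := volume) j
    have h3 : (fun ζ => (1 + ‖ζ‖) ^ k * ‖(𝓕 φ : 𝓢(Pt d, ℂ)) ζ‖) = fun ζ =>
        ∑ j ∈ Finset.range (k + 1), (k.choose j : ℝ) * (‖ζ‖ ^ j * ‖(𝓕 φ : 𝓢(Pt d, ℂ)) ζ‖) := by
      ext ζ
      rw [add_comm, add_pow, Finset.sum_mul]
      exact Finset.sum_congr rfl fun j _ => by ring
    rw [h3]
    exact integrable_finsetSum _ fun j _ => (h2 j).const_mul _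
  refine (h1.const_mul B).mono' ?_ (Eventually.of_forall fun ζ => ?_)
  · exact (Complex.measurable_ofReal.comp hm).aestronglyMeasurable.mul
      (𝓕 φ : 𝓢(Pt d, ℂ)).continuous.aestronglyMeasurable
  · rw [norm_mul, Complex.norm_real, Real.norm_eq_abs, ← mul_assoc]
    gcongr
    exact hB ζ

/-- The multiplier `θ ∘ A` acts by integration against the inverse Fourier transform of `θ`,
transported by the transpose `A'` of `A`. -/
theorem fourierMul_eq_integral_kernel (θ : 𝓢(Pt e, ℂ)) (A : Pt d →L[ℝ] Pt e)
    (A' : Pt e →L[ℝ] Pt d) (hA : ∀ ζ v, inner ℝ (A ζ) v = inner ℝ ζ (A' v)) {m : Pt d → ℝ}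
    (hm : ∀ ζ, (m ζ : ℂ) = θ (A ζ)) (φ : 𝓢(Pt d, ℂ)) (z : Pt d) :
    fourierMul m φ z = ∫ v, (𝓕⁻ θ : 𝓢(Pt e, ℂ)) v * φ (z - A' v) := by
  have h1 : ∀ ζ, (m ζ : ℂ) = ∫ v, 𝐞 (-inner ℝ v (A ζ)) • (𝓕⁻ θ : 𝓢(Pt e, ℂ)) v := fun ζ => by
    rw [hm, ← Real.fourier_eq, ← SchwartzMap.fourier_coe, FourierTransform.fourier_fourierInv_eq]
  have h2 : Integrable (fun p : Pt d × Pt e =>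
      ((𝐞 (inner ℝ p.1 (z - A' p.2)) : Circle) : ℂ) *
        ((𝓕 φ : 𝓢(Pt d, ℂ)) p.1 * (𝓕⁻ θ : 𝓢(Pt e, ℂ)) p.2)) (volume.prod volume) := by
    refine Integrable.bdd_mul (c := 1)
      ((𝓕 φ : 𝓢(Pt d, ℂ)).integrable.mul_prod (𝓕⁻ θ : 𝓢(Pt e, ℂ)).integrable) ?_ ?_
    · refine Continuous.aestronglyMeasurable ?_
      have : Continuous fun p : Pt d × Pt e => inner ℝ p.1 (z - A' p.2) := by fun_prop
      exact continuous_induced_dom.comp (Real.continuous_fourierChar.comp this)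
    · exact Eventually.of_forall fun p => (Circle.norm_coe _).le
  rw [fourierMul_apply]
  have h3 : ∀ ζ, 𝐞 (inner ℝ ζ z) • ((m ζ : ℂ) * (𝓕 φ : 𝓢(Pt d, ℂ)) ζ)
      = ∫ v, ((𝐞 (inner ℝ ζ (z - A' v)) : Circle) : ℂ) *
        ((𝓕 φ : 𝓢(Pt d, ℂ)) ζ * (𝓕⁻ θ : 𝓢(Pt e, ℂ)) v) := fun ζ => by
    rw [h1, ← integral_mul_const, Circle.smul_def, smul_eq_mul, ← integral_const_mul]
    congr 1
    ext v
    rw [real_inner_comm (A ζ) v, hA, inner_sub_right, sub_eq_add_neg, AddChar.map_add_eq_mul]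
    simp only [Circle.smul_def, smul_eq_mul, Circle.coe_mul]
    ring
  simp_rw [h3]
  rw [integral_integral_swap h2]
  congr 1
  ext v
  rw [fourier_inversion φ (z - A' v), ← integral_const_mul]
  congr 1
  ext ζ
  simp only [Circle.smul_def, smul_eq_mul]
  ring

/-- Smooth multipliers living at frequencies of parabolic size `1 / r` spread a Schwartz function
to scale `r`. In applications `π` is the identity or the projection to the time axis. -/
theorem norm_kernel_integral_le (θ : 𝓢(Pt e, ℂ)) (k : ℕ) :
    ∃ C : ℝ, 0 ≤ C ∧ ∀ (φ : Pt e → ℂ) (W : ℝ) (u : Pt e), 0 ≤ W →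
      (∀ w, ‖φ w‖ ≤ W * (1 + gauge (u - w)) ^ (-((2 * e + k + 5 : ℕ) : ℝ))) →
      ∀ r : ℝ, 1 ≤ r → ‖∫ v, (𝓕⁻ θ : 𝓢(Pt e, ℂ)) v * φ (dil r v)‖
        ≤ C * W * (r ^ k / (r + gauge u) ^ (e + 2 + k)) := by
  obtain ⟨C, hC0, hC⟩ := exists_gauge_decay (𝓕⁻ θ : 𝓢(Pt e, ℂ)) (e + 2 + k)
  have hint : Integrable fun w : Pt e => (1 + gauge w) ^ (-((e : ℝ) + 3)) :=
    integrable_gauge (by linarith)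
  set I := ∫ w : Pt e, (1 + gauge w) ^ (-((e : ℝ) + 3)) with hI
  have hI0 : 0 ≤ I := integral_nonneg fun w => by
    have := gauge_nonneg w
    positivity
  refine ⟨C * I, by positivity, fun φ W u hW hφ r hr => ?_⟩
  have hr0 : 0 < r := by linarith
  set M := e + 2 + k with hM
  have hu := gauge_nonneg u
  -- the pointwise bound for the integrand after rescaling
  have hpt : ∀ w : Pt e, ‖(𝓕⁻ θ : 𝓢(Pt e, ℂ)) (dil r⁻¹ w) * φ w‖
      ≤ C * W * (r ^ M / (r + gauge u) ^ M) * (1 + gauge (u - w)) ^ (-((e : ℝ) + 3)) := fun w => by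
    have hw := gauge_nonneg w
    have huw := gauge_nonneg (u - w)
    have h1 := hC (dil r⁻¹ w)
    rw [gauge_dil (inv_nonneg.2 hr0.le)] at h1
    have h2 : ‖(𝓕⁻ θ : 𝓢(Pt e, ℂ)) (dil r⁻¹ w)‖ ≤ C * (r / (r + gauge w)) ^ M := by
      have h3 : 1 + r⁻¹ * gauge w = (r / (r + gauge w))⁻¹ := by field_simp
      rw [h3, inv_pow, inv_mul_le_iff₀ (by positivity)] at h1
      linarith
    -- the weight at `w` is compared with the weight at `u` at the cost of a power of `u - w`
    have h4 : (r / (r + gauge w)) ^ M ≤ r ^ M / (r + gauge u) ^ M * (1 + gauge (u - w)) ^ M := by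
      rw [div_pow, div_mul_eq_mul_div, div_le_div_iff₀ (by positivity) (by positivity), mul_assoc,
        ← mul_pow (1 + gauge (u - w))]
      gcongr
      nlinarith [gauge_le_sub_add u w, mul_nonneg huw hw]
    -- the assumed decay leaves `e + 3` powers, which are integrable in dimension `e + 2`
    have h5 : (1 + gauge (u - w)) ^ M * (1 + gauge (u - w)) ^ (-((2 * e + k + 5 : ℕ) : ℝ))
        = (1 + gauge (u - w)) ^ (-((e : ℝ) + 3)) := by
      rw [← Real.rpow_natCast, ← Real.rpow_add (by positivity)]
      congr 1
      rw [hM]; push_cast; ring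
    rw [norm_mul]
    calc _ ≤ (C * (r ^ M / (r + gauge u) ^ M * (1 + gauge (u - w)) ^ M))
          * (W * (1 + gauge (u - w)) ^ (-((2 * e + k + 5 : ℕ) : ℝ))) := by
          gcongr
          · exact h2.trans (by gcongr)
          · exact hφ w
      _ = C * W * (r ^ M / (r + gauge u) ^ M) * ((1 + gauge (u - w)) ^ M *
            (1 + gauge (u - w)) ^ (-((2 * e + k + 5 : ℕ) : ℝ))) := by ring
      _ = _ := by rw [h5]
  have hscale : ∫ v, (𝓕⁻ θ : 𝓢(Pt e, ℂ)) v * φ (dil r v)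
      = (r ^ (e + 2))⁻¹ • ∫ w, (𝓕⁻ θ : 𝓢(Pt e, ℂ)) (dil r⁻¹ w) * φ w := by
    rw [← integral_comp_dil hr0]
    simp_rw [dil_dil, inv_mul_cancel₀ hr0.ne', dil_one]
  have htr : ∫ w : Pt e, (1 + gauge (u - w)) ^ (-((e : ℝ) + 3)) = I :=
    integral_sub_left_eq_self (fun w : Pt e => (1 + gauge w) ^ (-((e : ℝ) + 3))) volume u
  rw [hscale, norm_smul, Real.norm_of_nonneg (by positivity)]
  have hbd : ‖∫ w, (𝓕⁻ θ : 𝓢(Pt e, ℂ)) (dil r⁻¹ w) * φ w‖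
      ≤ C * W * (r ^ M / (r + gauge u) ^ M) * I := by
    rw [← htr, ← integral_const_mul]
    refine norm_integral_le_of_norm_le ?_ (Eventually.of_forall hpt)
    exact (hint.comp_sub_left u).const_mul _
  calc _ ≤ (r ^ (e + 2))⁻¹ * (C * W * (r ^ M / (r + gauge u) ^ M) * I) := by gcongr
    _ = C * I * W * (r ^ k / (r + gauge u) ^ M) := by
      rw [hM, pow_add r (e + 2) k]
      field_simp

/-- Each term is dominated by a difference, so that the sum telescopes. -/
theorem sum_dyadic_le {g r : ℝ} (hg : 0 ≤ g) (hr : 0 < r) {K : ℕ} (hK : 1 ≤ K) (n : ℕ) :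
    ∑ i ∈ Finset.range n, 2 ^ i * r / (2 ^ i * r + g) ^ (K + 1) ≤ 2 / (r + g) ^ K := by
  have key : ∀ s : ℝ, 0 < s →
      s / (s + g) ^ (K + 1) ≤ 2 / (s + g) ^ K - 2 / (2 * s + g) ^ K := fun s hs => by
    have h1 : (s + g) ^ (K - 1) ≤ (2 * s + g) ^ (K - 1) := by gcongr; linarith
    obtain ⟨L, rfl⟩ : ∃ L, K = L + 1 := ⟨K - 1, by omega⟩
    simp only [Nat.add_sub_cancel] at h1
    have h2 : 2 / (2 * s + g) ^ (L + 1) ≤ 2 / ((s + g) ^ L * (2 * s + g)) := by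
      rw [pow_succ]; gcongr
    have h3 : s / (s + g) ^ (L + 1 + 1)
        ≤ 2 / (s + g) ^ (L + 1) - 2 / ((s + g) ^ L * (2 * s + g)) := by
      rw [pow_succ (s + g) (L + 1), pow_succ (s + g) L]
      have e1 : 2 / ((s + g) ^ L * (s + g)) - 2 / ((s + g) ^ L * (2 * s + g))
          = 1 / (s + g) ^ L * (2 * s / ((s + g) * (2 * s + g))) := by
        field_simp
        ring
      have e2 : s / ((s + g) ^ L * (s + g) * (s + g))
          = 1 / (s + g) ^ L * (s / ((s + g) * (s + g))) := by field_simp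
      rw [e1, e2]
      gcongr 1 / (s + g) ^ L * ?_
      rw [div_le_div_iff₀ (by positivity) (by positivity)]
      have : 0 ≤ s * (s + g) * g := by positivity
      nlinarith
    linarith
  have h : ∀ n : ℕ, ∑ i ∈ Finset.range n, 2 ^ i * r / (2 ^ i * r + g) ^ (K + 1)
      ≤ 2 / (r + g) ^ K - 2 / (2 ^ n * r + g) ^ K := fun n => by
    induction n with
    | zero => simp
    | succ n ih =>
      rw [Finset.sum_range_succ]
      have := key (2 ^ n * r) (by positivity)
      rw [← mul_assoc, ← pow_succ'] at this
      linarith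
  have : 0 ≤ 2 / (2 ^ n * r + g) ^ K := by positivity
  linarith [h n]

theorem sum_psi (z : Pt d) (r : ℝ) (n : ℕ) :
    ∑ i ∈ Finset.range n, psi (dil (2 ^ i * r) z) = chi (dil r z) - chi (dil (2 ^ n * r) z) := by
  induction n with
  | zero => simp
  | succ n ih =>
    rw [Finset.sum_range_succ, ih, psi, dil_dil, ← mul_assoc, ← pow_succ']
    ring

theorem tendsto_chi_dil {z : Pt d} (hz : z ≠ 0) {r : ℝ} (hr : 0 < r) :
    ∀ᶠ n : ℕ in atTop, chi (dil (2 ^ n * r) z) = 0 := by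
  have h1 : Tendsto (fun n : ℕ => (2 : ℝ) ^ n * (r * ‖z‖)) atTop atTop :=
    (tendsto_pow_atTop_atTop_of_one_lt one_lt_two).atTop_mul_const
      (mul_pos hr (norm_pos_iff.2 hz))
  have h2 : Tendsto (fun n : ℕ => (2 : ℝ) ^ n * r) atTop atTop :=
    (tendsto_pow_atTop_atTop_of_one_lt one_lt_two).atTop_mul_const hr
  filter_upwards [h1.eventually_ge_atTop 2, h2.eventually_ge_atTop 1] with n h3 h4
  apply chi_eq_zero
  have := le_norm_dil_of_one_le h4 z
  rw [mul_assoc] at this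
  linarith

theorem HomSymbol.apply_zero {m : Pt d → ℝ} (h : HomSymbol 1 m) : m 0 = 0 := by
  have := h.hom 2 (by norm_num) 0
  simp at this
  linarith

theorem HomSymbol.exists_linear_bound {m : Pt d → ℝ} (h : HomSymbol 1 m) :
    ∃ B : ℝ, 0 ≤ B ∧ ∀ z, |m z| ≤ B * (1 + ‖z‖) := by
  obtain ⟨B, hB0, hB⟩ := h.exists_bound
  refine ⟨B * 2, by positivity, fun z => ?_⟩
  by_cases hz : z = 0
  · rw [hz, h.apply_zero]; simp; positivity
  · have h1 := hB z hz
    rw [zpow_one] at h1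
    have := one_add_gauge_le z
    have := gauge_nonneg z
    calc _ ≤ B * gauge z := h1
      _ ≤ B * (2 * (1 + ‖z‖)) := by gcongr; linarith
      _ = _ := by ring

/-- The low frequency part of an operator of order `1`: it gains the factor `1 / r` over an
average at scale `r`. -/
theorem exists_low_frequency_bound {σ : Pt e → ℝ} (hσ : HomSymbol 1 σ) (π : Pt d →L[ℝ] Pt e)
    (ι : Pt e →L[ℝ] Pt d) (hπ : ∀ ζ v, inner ℝ (π ζ) v = inner ℝ ζ (ι v)) :
    ∃ C : ℝ, 0 ≤ C ∧ ∀ (φ : 𝓢(Pt d, ℂ)) (W : ℝ) (z : Pt d), 0 ≤ W →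
      (∀ w, ‖φ (z - ι w)‖ ≤ W * (1 + gauge (π z - w)) ^ (-((2 * e + 2 + 5 : ℕ) : ℝ))) →
      ∀ r : ℝ, 1 ≤ r → ‖fourierMul (fun ζ => σ (π ζ) * chi (dil r (π ζ))) φ z‖
        ≤ C * W / (r + gauge (π z)) ^ (e + 3) := by
  obtain ⟨θ, hθ⟩ := hσ.exists_piece
  obtain ⟨C, hC0, hC⟩ := norm_kernel_integral_le θ 2
  refine ⟨2 * C, by positivity, fun φ W z hW hφ r hr => ?_⟩
  have hr0 : 0 < r := by linarith
  have hg := gauge_nonneg (π z)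
  obtain ⟨B, hB0, hB⟩ := hσ.exists_linear_bound
  have hπB : ∀ ζ, |σ (π ζ)| ≤ (B * (1 + ‖π‖)) * (1 + ‖ζ‖) ^ 1 := fun ζ => by
    rw [pow_one]
    refine (hB _).trans ?_
    rw [mul_assoc]
    gcongr
    nlinarith [π.le_opNorm ζ, norm_nonneg ζ, norm_nonneg π]
  have hmeas : Measurable fun ζ => σ (π ζ) := hσ.measurable.comp π.continuous.measurable
  -- the partial sums of the dyadic decomposition
  have hpart : ∀ n : ℕ,
      ‖fourierMul (fun ζ => σ (π ζ) * (chi (dil r (π ζ)) - chi (dil (2 ^ n * r) (π ζ)))) φ z‖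
        ≤ 2 * C * W / (r + gauge (π z)) ^ (e + 3) := fun n => by
    have hterm : ∀ i : ℕ, ‖fourierMul (fun ζ => σ (π ζ) * psi (dil (2 ^ i * r) (π ζ))) φ z‖
        ≤ C * W * (2 ^ i * r / (2 ^ i * r + gauge (π z)) ^ (e + 3 + 1)) := fun i => by
      -- `s σ` is `σ ∘ dil s`, so that the piece at scale `s` is a dilate of the unit piece `θ`
      set s := 2 ^ i * r with hs
      have hs1 : 1 ≤ s := by
        have : (1 : ℝ) ≤ 2 ^ i := one_le_pow₀ (by norm_num)
        nlinarith
      have hs0 : 0 < s := by linarith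
      have h1 : fourierMul (fun ζ => s * (σ (π ζ) * psi (dil s (π ζ)))) φ z
          = ∫ v, (𝓕⁻ θ : 𝓢(Pt e, ℂ)) v * φ (z - ι (dil s v)) := by
        refine fourierMul_eq_integral_kernel θ ((dil s).comp π) (ι.comp (dil s)) (fun ζ v => ?_)
          (fun ζ => ?_) φ z
        · simp [inner_dil, hπ]
        · simp only [ContinuousLinearMap.comp_apply]
          rw [hθ, hσ.hom s hs0, zpow_one]
          push_cast; ring
      have h2 := hC (fun w => φ (z - ι w)) W (π z) hW hφ s hs1
      rw [← h1] at h2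
      have h3 : fourierMul (fun ζ => s * (σ (π ζ) * psi (dil s (π ζ)))) φ z
          = s * fourierMul (fun ζ => σ (π ζ) * psi (dil s (π ζ))) φ z := by
        rw [fourierMul_apply, fourierMul_apply, ← integral_const_mul]
        congr 1
        ext ζ
        simp only [Circle.smul_def, smul_eq_mul]
        push_cast; ring
      rw [h3, norm_mul, Complex.norm_real, Real.norm_of_nonneg hs0.le] at h2
      rw [← mul_le_mul_iff_right₀ hs0]
      calc _ ≤ _ := h2
        _ = _ := by
          rw [show e + 2 + 2 = e + 3 + 1 from rfl]
          ring
    have hsum : fourierMul (fun ζ => σ (π ζ) * (chi (dil r (π ζ)) - chi (dil (2 ^ n * r) (π ζ))))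
        φ z = ∑ i ∈ Finset.range n,
          fourierMul (fun ζ => σ (π ζ) * psi (dil (2 ^ i * r) (π ζ))) φ z := by
      simp only [fourierMul_apply]
      rw [← integral_finsetSum]
      · congr 1
        ext ζ
        rw [← sum_psi, Finset.mul_sum]
        push_cast
        rw [Finset.sum_mul, Finset.smul_sum]
      · intro i _
        have hb : ∀ ζ, |σ (π ζ) * psi (dil (2 ^ i * r) (π ζ))|
            ≤ (B * (1 + ‖π‖)) * (1 + ‖ζ‖) ^ 1 := fun ζ => by
          rw [abs_mul]
          have : |psi (dil (2 ^ i * r) (π ζ))| ≤ 1 := abs_chi_sub_chi_le _ _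
          calc _ ≤ |σ (π ζ)| * 1 := by gcongr
            _ ≤ _ := by rw [mul_one]; exact hπB ζ
        have hi := integrable_mul_fourier (m := fun ζ => σ (π ζ) * psi (dil (2 ^ i * r) (π ζ)))
          (hmeas.mul ((psi_contDiff.continuous.comp
            ((dil (2 ^ i * r)).continuous.comp π.continuous)).measurable)) hb φ
        exact integrable_char_smul z hi
    rw [hsum]
    refine (norm_sum_le _ _).trans ((Finset.sum_le_sum fun i _ => hterm i).trans ?_)
    rw [← Finset.mul_sum]
    calc _ ≤ C * W * (2 / (r + gauge (π z)) ^ (e + 3)) := by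
          gcongr
          exact sum_dyadic_le hg hr0 (by omega) n
      _ = _ := by ring
  -- passage to the limit by dominated convergence
  have hlim : Tendsto (fun n : ℕ => fourierMul
      (fun ζ => σ (π ζ) * (chi (dil r (π ζ)) - chi (dil (2 ^ n * r) (π ζ)))) φ z) atTop
      (𝓝 (fourierMul (fun ζ => σ (π ζ) * chi (dil r (π ζ))) φ z)) := by
    simp only [fourierMul_apply]
    have hi := (integrable_mul_fourier hmeas hπB φ).norm
    refine tendsto_integral_of_dominated_convergence _ (fun n => ?_) hi (fun n => ?_) ?_
    · refine AEStronglyMeasurable.smul (f := fun ζ => 𝐞 (inner ℝ ζ z)) ?_ ?_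
      · exact (Real.continuous_fourierChar.comp (by fun_prop)).aestronglyMeasurable
      · refine AEStronglyMeasurable.mul ?_ (𝓕 φ : 𝓢(Pt d, ℂ)).continuous.aestronglyMeasurable
        refine (Complex.measurable_ofReal.comp (hmeas.mul ?_)).aestronglyMeasurable
        exact ((chi_contDiff.continuous.comp ((dil r).continuous.comp π.continuous)).sub
          (chi_contDiff.continuous.comp
            ((dil (2 ^ n * r)).continuous.comp π.continuous))).measurable
    · refine Eventually.of_forall fun ζ => ?_
      simp only [Circle.norm_smul, norm_mul, Complex.norm_real, Real.norm_eq_abs]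
      gcongr
      have : |chi (dil r (π ζ)) - chi (dil (2 ^ n * r) (π ζ))| ≤ 1 := abs_chi_sub_chi_le _ _
      calc _ ≤ |σ (π ζ)| * 1 := by gcongr
        _ = _ := mul_one _
    · refine Eventually.of_forall fun ζ => tendsto_const_nhds.congr' ?_
      by_cases hζ : π ζ = 0
      · exact Eventually.of_forall fun n => by rw [hζ, hσ.apply_zero]; simp
      · filter_upwards [tendsto_chi_dil hζ hr0] with n hn
        rw [hn, sub_zero]
  exact le_of_tendsto hlim.norm (Eventually.of_forall hpart)

end Parabolic

end

/-! ### Dyadic parabolic cubes and the Calderón–Zygmund decomposition -/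

noncomputable section

namespace Parabolic

open Filter Topology

variable {d : ℕ}

/-- The index of the dyadic cube of generation `k` that contains `z`; these cubes have side `2⁻ᵏ`
in space and `4⁻ᵏ` in time. -/
def cubeIndex (k : ℤ) (z : Pt d) : Fin (d + 1) → ℤ := fun i => ⌊dil ((2 : ℝ) ^ k) z i⌋

/-- The dyadic parabolic cube with generation `s.1` and index `s.2`. -/
def cube (s : ℤ × (Fin (d + 1) → ℤ)) : Set (Pt d) := {z | cubeIndex s.1 z = s.2}

theorem cubeIndex_pred {k : ℤ} {z w : Pt d} (h : cubeIndex k z = cubeIndex k w) :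
    cubeIndex (k - 1) z = cubeIndex (k - 1) w := by
  have key : ∀ (z : Pt d) (i : Fin (d + 1)), cubeIndex (k - 1) z i
      = cubeIndex k z i / ((if i = Fin.last d then 4 else 2 : ℕ) : ℤ) := fun z i => by
    have h2 : (2 : ℝ) ^ (k - 1) = 2 ^ k / 2 := by
      rw [zpow_sub₀ (by norm_num), zpow_one]
    unfold cubeIndex
    rw [← Int.floor_div_natCast]
    congr 1
    rw [dil_apply, dil_apply, h2]
    split_ifs
    · push_cast; ring
    · push_cast; ring
  ext i
  rw [key, key, h]

theorem cubeIndex_of_le {j k : ℤ} (hjk : j ≤ k) {z w : Pt d} (h : cubeIndex k z = cubeIndex k w) :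
    cubeIndex j z = cubeIndex j w := by
  obtain ⟨n, rfl⟩ : ∃ n : ℕ, j = k - n := ⟨(k - j).toNat, by omega⟩
  clear hjk
  induction n with
  | zero => simpa using h
  | succ n ih =>
    have := cubeIndex_pred ih
    rwa [sub_sub] at this

theorem measurableSet_cube (s : ℤ × (Fin (d + 1) → ℤ)) : MeasurableSet (cube s) := by
  have : Measurable (cubeIndex (d := d) s.1) := by
    refine measurable_pi_lambda _ fun i => Int.measurable_floor.comp ?_
    have : Continuous fun z : Pt d => dil ((2 : ℝ) ^ s.1) z i := by fun_prop
    exact this.measurable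
  exact this (measurableSet_singleton s.2)

theorem volume_cube_zero (q : Fin (d + 1) → ℤ) : volume (cube (0, q) : Set (Pt d)) = 1 := by
  have h1 : (cube (0, q) : Set (Pt d)) = (MeasurableEquiv.toLp 2 (Fin (d + 1) → ℝ)).symm ⁻¹'
      (Set.univ.pi fun i => Set.Ico (q i : ℝ) (q i + 1)) := by
    ext z
    simp only [cube, cubeIndex, Set.mem_ofPred_eq, zpow_zero, dil_one, Set.mem_preimage, Set.mem_pi,
      Set.mem_univ, true_implies, Set.mem_Ico, funext_iff, Int.floor_eq_iff]
    rfl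
  rw [h1, (EuclideanSpace.volume_preserving_symm_measurableEquiv_toLp
    (Fin (d + 1))).measure_preimage_equiv, Real.volume_pi_Ico]
  simp

theorem volume_cube (k : ℤ) (q : Fin (d + 1) → ℤ) :
    volume (cube (k, q) : Set (Pt d)) = ENNReal.ofReal ((((2 : ℝ) ^ k) ^ (d + 2))⁻¹) := by
  have hk : (0 : ℝ) < 2 ^ k := by positivity
  have h1 : (cube (k, q) : Set (Pt d)) = dil ((2 : ℝ) ^ k) ⁻¹' cube (0, q) := by
    ext z
    have h : cubeIndex 0 (dil ((2 : ℝ) ^ k) z) = cubeIndex k z := by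
      unfold cubeIndex
      simp
    simp [cube, h]
  have h2 := (measurableEmbedding_dil (d := d) hk).map_apply volume (cube (0, q))
  rw [map_dil_volume hk, Measure.smul_apply, volume_cube_zero, smul_eq_mul, mul_one] at h2
  rw [h1, ← h2]

theorem volume_cube_pos (s : ℤ × (Fin (d + 1) → ℤ)) : 0 < volume (cube s : Set (Pt d)) := by
  rw [← Prod.mk.eta (p := s), volume_cube]
  exact ENNReal.ofReal_pos.2 (by positivity)

theorem volume_cube_ne_top (s : ℤ × (Fin (d + 1) → ℤ)) : volume (cube s : Set (Pt d)) ≠ ∞ := by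
  rw [← Prod.mk.eta (p := s), volume_cube]
  exact ENNReal.ofReal_ne_top

/-- The corner of a dyadic cube. -/
def corner (s : ℤ × (Fin (d + 1) → ℤ)) : Pt d :=
  dil ((2 : ℝ) ^ s.1)⁻¹ (WithLp.toLp 2 fun i => (s.2 i : ℝ))

theorem gauge_le_of_coord {z : Pt d} (hz : ∀ i, |z i| ≤ 1) : gauge z ≤ d + 1 := by
  have h1 : ‖spaceVar z‖ ≤ d := by
    refine abs_le_of_sq_le_sq' ?_ (by positivity) |>.2
    rw [EuclideanSpace.norm_sq_eq]
    calc ∑ i, ‖spaceVar z i‖ ^ 2 ≤ ∑ _i : Fin d, (1 : ℝ) := by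
          refine Finset.sum_le_sum fun i _ => ?_
          rw [spaceVar_apply, Real.norm_eq_abs]
          exact pow_le_one₀ (abs_nonneg _) (hz _)
      _ = d := by simp
      _ ≤ (d : ℝ) ^ 2 := by
          norm_cast
          nlinarith [Nat.zero_le d, Nat.le_self_pow two_ne_zero d]
  have h2 : √|timeVar z| ≤ 1 := Real.sqrt_le_one.2 (hz _)
  unfold gauge
  linarith

theorem gauge_sub_corner_le {s : ℤ × (Fin (d + 1) → ℤ)} {w : Pt d} (hw : w ∈ cube s) :
    gauge (w - corner s) ≤ (d + 1) * ((2 : ℝ) ^ s.1)⁻¹ := by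
  have hk : (0 : ℝ) < 2 ^ s.1 := by positivity
  have h1 : w - corner s = dil ((2 : ℝ) ^ s.1)⁻¹
      (dil ((2 : ℝ) ^ s.1) w - WithLp.toLp 2 fun i => (s.2 i : ℝ)) := by
    rw [map_sub, dil_dil, inv_mul_cancel₀ hk.ne', dil_one, corner]
  rw [h1, gauge_dil (by positivity), mul_comm]
  gcongr
  refine gauge_le_of_coord fun i => ?_
  have h2 : ⌊dil ((2 : ℝ) ^ s.1) w i⌋ = s.2 i := congrFun hw i
  have h3 := Int.floor_le (dil ((2 : ℝ) ^ s.1) w i)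
  have h4 := Int.lt_floor_add_one (dil ((2 : ℝ) ^ s.1) w i)
  rw [h2] at h3 h4
  simp only [PiLp.sub_apply]
  rw [abs_le]
  constructor <;> linarith

theorem volume_gaugeBall {r : ℝ} (hr : 0 < r) (c : Pt d) :
    volume {z : Pt d | gauge (z - c) < r}
      = ENNReal.ofReal (r ^ (d + 2)) * volume {z : Pt d | gauge z < 1} := by
  have h1 : {z : Pt d | gauge (z - c) < r} = (fun z => z - c) ⁻¹' {z | gauge z < r} := rfl
  have h2 : {z : Pt d | gauge z < r} = dil r⁻¹ ⁻¹' {z | gauge z < 1} := by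
    ext z
    simp only [Set.mem_ofPred_eq, Set.mem_preimage]
    rw [gauge_dil (by positivity), inv_mul_lt_iff₀ hr, mul_one]
  have h3 := (measurableEmbedding_dil (d := d) (inv_pos.2 hr)).map_apply volume
    {z : Pt d | gauge z < 1}
  rw [map_dil_volume (inv_pos.2 hr), Measure.smul_apply, smul_eq_mul] at h3
  rw [h1, (measurePreserving_sub_right volume c).measure_preimage
    ((measurableSet_lt continuous_gauge.measurable measurable_const).nullMeasurableSet), h2, ← h3]
  simp

theorem volume_gaugeBall_one_lt_top : volume {z : Pt d | gauge z < 1} < ∞ := by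
  refine ((Metric.isBounded_closedBall (x := (0 : Pt d)) (r := 2)).subset
    fun z hz => ?_).measure_lt_top
  have := norm_le_gauge z
  have h0 := gauge_nonneg z
  simp only [Set.mem_ofPred_eq] at hz
  simp only [Metric.mem_closedBall, dist_zero_right]
  nlinarith

/-- The constant comparing an enlarged cube with the cube itself. -/
def dilationConst (d : ℕ) : ℝ≥0∞ :=
  ENNReal.ofReal ((2 * ((d : ℝ) + 1)) ^ (d + 2)) * volume {z : Pt d | gauge z < 1}

theorem dilationConst_ne_top (d : ℕ) : dilationConst d ≠ ∞ :=
  ENNReal.mul_ne_top ENNReal.ofReal_ne_top volume_gaugeBall_one_lt_top.ne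

theorem volume_enlarged_cube (s : ℤ × (Fin (d + 1) → ℤ)) :
    volume {z : Pt d | gauge (z - corner s) < 2 * ((d + 1) * ((2 : ℝ) ^ s.1)⁻¹)}
      = dilationConst d * volume (cube s : Set (Pt d)) := by
  rw [volume_gaugeBall (by positivity), dilationConst, ← Prod.mk.eta (p := s), volume_cube,
    mul_right_comm, ← ENNReal.ofReal_mul (by positivity)]
  congr 2
  rw [← mul_assoc, mul_pow, inv_pow]

/-- The Calderón–Zygmund stopping cubes of a continuous integrable function at height `a`. -/
theorem exists_stopping_cubes {f : Pt d → ℂ} (hf : Continuous f) (hfi : Integrable f) {a : ℝ}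
    (ha : 0 < a) : ∃ S : Set (ℤ × (Fin (d + 1) → ℤ)),
      S.PairwiseDisjoint (cube : _ → Set (Pt d)) ∧
      (∀ s ∈ S, ENNReal.ofReal a * volume (cube s : Set (Pt d)) ≤ ∫⁻ z in cube s, ‖f z‖ₑ) ∧
      (∀ s ∈ S, ∫⁻ z in cube s, ‖f z‖ₑ
        ≤ 2 ^ (d + 2) * (ENNReal.ofReal a * volume (cube s : Set (Pt d)))) ∧
      ∀ z, z ∉ ⋃ s ∈ S, cube s → ‖f z‖ ≤ a := by
  set Big : ℤ × (Fin (d + 1) → ℤ) → Prop := fun s =>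
    ENNReal.ofReal a * volume (cube s : Set (Pt d)) < ∫⁻ z in cube s, ‖f z‖ₑ with hBig
  -- large cubes are never selected
  have hfar : ∃ k₀ : ℤ, ∀ k q, Big (k, q) → k₀ ≤ k := by
    obtain ⟨n, hn⟩ := pow_unbounded_of_one_lt ((∫⁻ z, ‖f z‖ₑ).toReal / a) one_lt_two
    refine ⟨-n, fun k q hk => ?_⟩
    by_contra! hlt
    refine hk.not_ge ((setLIntegral_le_lintegral _ _).trans ?_)
    rw [volume_cube, ← ENNReal.ofReal_mul ha.le, ← ENNReal.ofReal_toReal hfi.2.ne]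
    apply ENNReal.ofReal_le_ofReal
    rw [div_lt_iff₀' ha] at hn
    refine hn.le.trans ?_
    gcongr
    have h1 : (2 : ℝ) ^ k ≤ (2 ^ n)⁻¹ := by
      rw [← zpow_natCast, ← zpow_neg]
      exact zpow_le_zpow_right₀ (by norm_num) hlt.le
    have h2 : (2 : ℝ) ^ n ≤ (2 ^ k)⁻¹ := by
      rw [le_inv_comm₀ (by positivity) (by positivity)]; exact h1
    have h3 : (1 : ℝ) ≤ (2 ^ k)⁻¹ := le_trans (one_le_pow₀ (by norm_num)) h2
    rw [← inv_pow]
    exact h2.trans (le_self_pow₀ h3 (by omega))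
  obtain ⟨k₀, hk₀⟩ := hfar
  -- the maximal cubes on which the average of `‖f‖` exceeds `a`
  refine ⟨{s | Big s ∧ ∀ j < s.1, ∀ w ∈ cube s, ¬ Big (j, cubeIndex j w)}, ?_, ?_, ?_, ?_⟩
  · rintro ⟨k, q⟩ ⟨h1, h2⟩ ⟨k', q'⟩ ⟨h1', h2'⟩ hne
    rw [Function.onFun, Set.disjoint_left]
    intro z hz hz'
    rcases lt_trichotomy k k' with h | h | h
    · have := h2' k h z hz'
      rw [show cubeIndex k z = q from hz] at this
      exact this h1
    · subst h
      exact hne (by rw [← show cubeIndex k z = q from hz, ← show cubeIndex k z = q' from hz'])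
    · have := h2 k' h z hz
      rw [show cubeIndex k' z = q' from hz'] at this
      exact this h1'
  · exact fun s hs => hs.1.le
  · rintro ⟨k, q⟩ ⟨h1, h2⟩
    have hne : (cube (k, q) : Set (Pt d)).Nonempty :=
      nonempty_of_measure_ne_zero (volume_cube_pos _).ne'
    obtain ⟨w, hw⟩ := hne
    -- the parent of a selected cube is not selected
    have h3 := h2 (k - 1) (by simp) w hw
    simp only [hBig, not_lt] at h3
    have hsub : (cube (k, q) : Set (Pt d)) ⊆ cube (k - 1, cubeIndex (k - 1) w) := fun z hz =>
      cubeIndex_pred (hz.trans hw.symm)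
    refine (lintegral_mono_set hsub).trans (h3.trans (le_of_eq ?_))
    rw [volume_cube, volume_cube, mul_left_comm]
    congr 1
    rw [← ENNReal.ofReal_ofNat, ← ENNReal.ofReal_pow (by norm_num),
      ← ENNReal.ofReal_mul (by positivity)]
    congr 1
    rw [zpow_sub₀ (by norm_num), zpow_one, div_pow, inv_div, div_eq_mul_inv]
  · intro z hz
    by_contra! hlt
    -- small cubes around a point where `f` is large are selected
    have hbig : ∃ k : ℤ, Big (k, cubeIndex k z) := by
      obtain ⟨b, hab, hb⟩ := exists_between hlt
      have hU : {w | b < ‖f w‖} ∈ 𝓝 z :=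
        (isOpen_lt continuous_const hf.norm).mem_nhds hb
      obtain ⟨ε, hε, hball⟩ := Metric.mem_nhds_iff.1 hU
      obtain ⟨n, hn⟩ := pow_unbounded_of_one_lt (2 * (d + 1) * (1 + 2 * (d + 1)) / ε)
        (one_lt_two (α := ℝ))
      refine ⟨n, ?_⟩
      have hsub : (cube ((n : ℤ), cubeIndex n z) : Set (Pt d)) ⊆ {w | b < ‖f w‖} := by
        intro w hw
        apply hball
        have h1 := gauge_sub_corner_le hw
        have h2 := gauge_sub_corner_le (s := ((n : ℤ), cubeIndex n z)) (w := z) rfl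
        have h3 := gauge_add_le (w - corner ((n : ℤ), cubeIndex n z))
          (-(z - corner ((n : ℤ), cubeIndex n z)))
        rw [gauge_neg] at h3
        have h4 : w - corner ((n : ℤ), cubeIndex n z) + -(z - corner ((n : ℤ), cubeIndex n z))
          = w - z := by abel
        rw [h4] at h3
        simp only [zpow_natCast] at h1 h2
        have h5 : gauge (w - z) ≤ 2 * (d + 1) * (2 ^ n)⁻¹ := by linarith
        have h6 : ((2 : ℝ) ^ n)⁻¹ ≤ 1 := inv_le_one_of_one_le₀ (one_le_pow₀ (by norm_num))
        have h7 := norm_le_gauge (w - z)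
        have h8 := gauge_nonneg (w - z)
        rw [Metric.mem_ball, dist_eq_norm]
        have hd : (0 : ℝ) ≤ d := by positivity
        calc ‖w - z‖ ≤ gauge (w - z) * (1 + gauge (w - z)) := h7
          _ ≤ (2 * (d + 1) * (2 ^ n)⁻¹) * (1 + 2 * (d + 1) * 1) := by
              gcongr
              exact h5.trans (by gcongr)
          _ < ε := by
              rw [div_lt_iff₀ hε] at hn
              rw [mul_right_comm, ← div_eq_mul_inv, div_lt_iff₀ (by positivity)]
              linarith
      calc ENNReal.ofReal a * volume (cube ((n : ℤ), cubeIndex n z) : Set (Pt d))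
          < ENNReal.ofReal b * volume (cube ((n : ℤ), cubeIndex n z) : Set (Pt d)) := by
            have h9 : ENNReal.ofReal a < ENNReal.ofReal b :=
              (ENNReal.ofReal_lt_ofReal_iff (ha.trans hab)).2 hab
            exact (ENNReal.mul_lt_mul_iff_left (volume_cube_pos _).ne'
              (volume_cube_ne_top _)).2 h9
        _ = ∫⁻ _ in cube ((n : ℤ), cubeIndex n z), ENNReal.ofReal b := by
            rw [setLIntegral_const]
        _ ≤ _ := by
            refine setLIntegral_mono' (measurableSet_cube _) fun w hw => ?_
            rw [← ofReal_norm]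
            exact ENNReal.ofReal_le_ofReal (le_of_lt (hsub hw))
    obtain ⟨k, hk, hmin⟩ := Int.exists_least_of_bdd (P := fun k => Big (k, cubeIndex k z))
      ⟨k₀, fun k hk => hk₀ k _ hk⟩ hbig
    apply hz
    refine Set.mem_biUnion (x := (k, cubeIndex k z)) ⟨hk, fun j hj w hw hbad => ?_⟩ rfl
    rw [cubeIndex_of_le hj.le (show cubeIndex k w = cubeIndex k z from hw)] at hbad
    exact hj.not_ge (hmin j hbad)

end Parabolic

end

/-! ### The weak type estimate -/

noncomputable section

namespace Parabolic

open Filter Topology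

variable {d : ℕ}

/-- Hörmander's smoothness condition with constant `B`, in the parabolic geometry. -/
def HormanderBound (K : Pt d → ℂ) (B : ℝ≥0) : Prop :=
  ∀ (r : ℝ) (w : Pt d), 0 < r → gauge w ≤ r →
    ∫⁻ z in {z | 2 * r ≤ gauge z}, ‖K (z - w) - K z‖ₑ ≤ B

/-- Convolution with `K` is bounded on `L²` by `A`. -/
def L2Bound (K : Pt d → ℂ) (A : ℝ≥0) : Prop :=
  ∀ g : Pt d → ℂ, MemLp g 2 → ∫⁻ z, ‖∫ w, K (z - w) * g w‖ₑ ^ 2 ≤ A ^ 2 * ∫⁻ z, ‖g z‖ₑ ^ 2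

theorem enorm_average_mul_volume_le {Q : Set (Pt d)} (hQ0 : volume Q ≠ 0)
    (hQ : volume Q ≠ ∞) (f : Pt d → ℂ) :
    ‖⨍ z in Q, f z‖ₑ * volume Q ≤ ∫⁻ z in Q, ‖f z‖ₑ := by
  have h : (volume Q).toReal ≠ 0 := (ENNReal.toReal_pos hQ0 hQ).ne'
  have h1 : ‖∫ z in Q, f z‖ₑ = ‖⨍ z in Q, f z‖ₑ * volume Q := by
    rw [setAverage_eq, enorm_smul, mul_right_comm]
    conv_rhs => rw [← ENNReal.ofReal_toReal hQ]
    rw [measureReal_def, ← ofReal_norm (((volume Q).toReal)⁻¹), Real.norm_of_nonneg (by positivity),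
      ← ENNReal.ofReal_mul (by positivity), inv_mul_cancel₀ h]
    simp
  rw [← h1]
  exact enorm_integral_le_lintegral_enorm _

/-- The bad part of the Calderón–Zygmund decomposition: away from the enlarged cubes, mean value
zero on each cube is traded for the smoothness of the kernel. -/
theorem lintegral_bad_part_le {ι : Type*} [Countable ι] {K : Pt d → ℂ} (hK : Continuous K)
    {M : ℝ} (hKM : ∀ z, ‖K z‖ ≤ M) {B : ℝ≥0} (hB : HormanderBound K B) {Q : ι → Set (Pt d)}
    (hQm : ∀ s, MeasurableSet (Q s)) (hQd : Pairwise fun s t => Disjoint (Q s) (Q t))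
    {c : ι → Pt d} {r : ι → ℝ} (hr : ∀ s, 0 < r s)
    (hc : ∀ s, ∀ w ∈ Q s, gauge (w - c s) ≤ r s) {b : Pt d → ℂ} (hb : Integrable b)
    (hbm : Measurable b) (hb0 : ∀ s, ∫ w in Q s, b w = 0) (hbs : ∀ z, z ∉ ⋃ s, Q s → b z = 0) :
    ∫⁻ z in (⋃ s, {z | gauge (z - c s) < 2 * r s})ᶜ, ‖∫ w, K (z - w) * b w‖ₑ
      ≤ B * ∫⁻ z, ‖b z‖ₑ := by
  have hKb : ∀ z, Integrable fun w => K (z - w) * b w := fun z =>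
    hb.bdd_mul (c := M) (hK.comp (continuous_const.sub continuous_id)).aestronglyMeasurable
      (Eventually.of_forall fun w => hKM _)
  have hQU : MeasurableSet (⋃ s, Q s) := MeasurableSet.iUnion hQm
  have hpt : ∀ z, ‖∫ w, K (z - w) * b w‖ₑ
      ≤ ∑' s, ∫⁻ w in Q s, ‖K (z - w) - K (z - c s)‖ₑ * ‖b w‖ₑ := fun z => by
    have h1 : ∫ w, K (z - w) * b w = ∫ w in ⋃ s, Q s, K (z - w) * b w := by
      rw [setIntegral_eq_integral_of_forall_compl_eq_zero]
      intro w hw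
      rw [hbs w hw, mul_zero]
    have h2 : ∀ s, ∫ w in Q s, K (z - w) * b w
        = ∫ w in Q s, (K (z - w) - K (z - c s)) * b w := fun s => by
      simp_rw [sub_mul]
      rw [integral_sub (hKb z).integrableOn (hb.const_mul _).integrableOn, integral_const_mul,
        hb0, mul_zero, sub_zero]
    rw [h1, integral_iUnion hQm hQd (hKb z).integrableOn]
    refine enorm_tsum_le_tsum_enorm.trans (ENNReal.tsum_le_tsum fun s => ?_)
    rw [h2]
    refine (enorm_integral_le_lintegral_enorm _).trans (le_of_eq ?_)
    simp_rw [enorm_mul]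
  have hmeas : ∀ s, Measurable (Function.uncurry fun z w : Pt d =>
      ‖K (z - w) - K (z - c s)‖ₑ * ‖b w‖ₑ) := fun s => by
    refine Measurable.mul ?_ (hbm.comp measurable_snd).enorm
    have : Continuous fun p : Pt d × Pt d => K (p.1 - p.2) - K (p.1 - c s) := by fun_prop
    exact this.measurable.enorm
  calc _ ≤ ∫⁻ z in (⋃ s, {z | gauge (z - c s) < 2 * r s})ᶜ,
        ∑' s, ∫⁻ w in Q s, ‖K (z - w) - K (z - c s)‖ₑ * ‖b w‖ₑ :=
        lintegral_mono fun z => hpt z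
    _ = ∑' s, ∫⁻ z in (⋃ s, {z | gauge (z - c s) < 2 * r s})ᶜ,
        ∫⁻ w in Q s, ‖K (z - w) - K (z - c s)‖ₑ * ‖b w‖ₑ :=
        lintegral_tsum fun s => (hmeas s).lintegral_prod_right'.aemeasurable
    _ ≤ ∑' s, ∫⁻ w in Q s, B * ‖b w‖ₑ := by
        refine ENNReal.tsum_le_tsum fun s => ?_
        rw [lintegral_lintegral_swap (hmeas s).aemeasurable]
        refine setLIntegral_mono' (hQm s) fun w hw => ?_
        rw [lintegral_mul_const' _ _ enorm_ne_top]
        gcongr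
        have h1 := hB (r s) (w - c s) (hr s) (hc s w hw)
        have h2 : (⋃ s, {z : Pt d | gauge (z - c s) < 2 * r s})ᶜ
            ⊆ (fun z => z - c s) ⁻¹' {z | 2 * r s ≤ gauge z} := fun z hz => by
          simp only [Set.mem_compl_iff, Set.mem_iUnion, Set.mem_ofPred_eq, not_exists,
            not_lt] at hz
          exact hz s
        refine (lintegral_mono_set h2).trans (le_trans (le_of_eq ?_) h1)
        have h3 := (measurePreserving_sub_right (volume : Measure (Pt d))
          (c s)).setLIntegral_comp_preimage_emb (measurableEmbedding_subRight (c s))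
            (fun z => ‖K (z - (w - c s)) - K z‖ₑ) {z | 2 * r s ≤ gauge z}
        rw [← h3]
        congr 1
        ext z
        congr 3
        abel
    _ = B * ∑' s, ∫⁻ w in Q s, ‖b w‖ₑ := by
        simp_rw [lintegral_const_mul' _ _ ENNReal.coe_ne_top]
        rw [ENNReal.tsum_mul_left]
    _ ≤ _ := by
        gcongr
        rw [← lintegral_iUnion hQm hQd]
        exact setLIntegral_le_lintegral _ _

/-- The constant of the weak type estimate. -/
def weakConst (d : ℕ) (A B : ℝ≥0) : ℝ≥0∞ :=
  4 * A ^ 2 + 2 * (4 * A ^ 2 * (2 ^ (d + 2)) ^ 2 + dilationConst d + 4 * (B * 2 ^ (d + 2)))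

theorem weakConst_ne_top (d : ℕ) (A B : ℝ≥0) : weakConst d A B ≠ ∞ := by
  have := dilationConst_ne_top d
  unfold weakConst
  finiteness

/-- The Calderón–Zygmund estimate at a single height `a`: the small values of `f` enter through
their `L²` norm, the large ones through their `L¹` norm. -/
theorem weak_type_estimate {K : Pt d → ℂ} (hK : Continuous K) {M : ℝ} (hKM : ∀ z, ‖K z‖ ≤ M)
    {A B : ℝ≥0} (hA : L2Bound K A) (hB : HormanderBound K B) {f : Pt d → ℂ} (hf : Continuous f)
    (hfi : Integrable f) {a : ℝ} (ha : 0 < a) :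
    ENNReal.ofReal a ^ 2 * volume {z | a < ‖∫ w, K (z - w) * f w‖}
      ≤ weakConst d A B * ((∫⁻ z in {z | ‖f z‖ ≤ a}, ‖f z‖ₑ ^ 2)
        + ENNReal.ofReal a * ∫⁻ z in {z | a / 2 < ‖f z‖}, ‖f z‖ₑ) := by
  obtain ⟨S, hSd, hSl, hSu, hSc⟩ := exists_stopping_cubes hf hfi ha
  set Q : S → Set (Pt d) := fun s => cube s.1 with hQ
  have hQm : ∀ s, MeasurableSet (Q s) := fun s => measurableSet_cube _
  have hQd : Pairwise fun s t => Disjoint (Q s) (Q t) := fun s t hst =>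
    hSd s.2 t.2 fun h => hst (Subtype.ext h)
  have hQ0 : ∀ s, volume (Q s) ≠ 0 := fun s => (volume_cube_pos _).ne'
  have hQt : ∀ s, volume (Q s) ≠ ∞ := fun s => volume_cube_ne_top _
  set Ω : Set (Pt d) := ⋃ s, Q s with hΩ
  have hΩm : MeasurableSet Ω := MeasurableSet.iUnion hQm
  have hoff : ∀ z, z ∉ Ω → ‖f z‖ ≤ a := fun z hz => hSc z (by
    rwa [Set.biUnion_eq_iUnion])
  set L := ENNReal.ofReal a with hL
  have hL0 : L ≠ 0 := (ENNReal.ofReal_pos.2 ha).ne'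
  have hLt : L ≠ ∞ := ENNReal.ofReal_ne_top
  have hVsum : volume Ω = ∑' s, volume (Q s) := measure_iUnion hQd hQm
  have hIsum : ∫⁻ z in Ω, ‖f z‖ₑ = ∑' s, ∫⁻ z in Q s, ‖f z‖ₑ := lintegral_iUnion hQm hQd _
  have hV1 : L * volume Ω ≤ ∫⁻ z in Ω, ‖f z‖ₑ := by
    rw [hVsum, hIsum, ← ENNReal.tsum_mul_left]
    exact ENNReal.tsum_le_tsum fun s => hSl s.1 s.2
  have hV2 : ∫⁻ z in Ω, ‖f z‖ₑ ≤ 2 ^ (d + 2) * (L * volume Ω) := by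
    rw [hVsum, hIsum, ← ENNReal.tsum_mul_left, ← ENNReal.tsum_mul_left]
    exact ENNReal.tsum_le_tsum fun s => hSu s.1 s.2
  have hVt : volume Ω ≠ ∞ := by
    intro h
    rw [h, ENNReal.mul_top hL0, top_le_iff] at hV1
    exact (ne_top_of_le_ne_top hfi.2.ne (setLIntegral_le_lintegral _ _)) hV1
  -- the measure of the exceptional set is controlled by the large values of `f`, because the
  -- values below `a / 2` account for at most half of `a * volume Ω`
  have hV3 : L * volume Ω ≤ 2 * ∫⁻ z in {z | a / 2 < ‖f z‖}, ‖f z‖ₑ := by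
    have hms : MeasurableSet {z | a / 2 < ‖f z‖} :=
      measurableSet_lt measurable_const hf.norm.measurable
    have h1 : ∫⁻ z in Ω, ‖f z‖ₑ ≤ (∫⁻ z in {z | a / 2 < ‖f z‖}, ‖f z‖ₑ) + L / 2 * volume Ω := by
      rw [← lintegral_inter_add_sdiff _ Ω hms]
      gcongr
      · exact Set.inter_subset_right
      · calc ∫⁻ z in Ω \ {z | a / 2 < ‖f z‖}, ‖f z‖ₑ
            ≤ ∫⁻ _ in Ω \ {z | a / 2 < ‖f z‖}, L / 2 := by
              refine setLIntegral_mono' (hΩm.diff hms) fun z hz => ?_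
              have h2 : ‖f z‖ ≤ a / 2 := not_lt.1 hz.2
              rw [← ofReal_norm, hL, ← ENNReal.ofReal_ofNat 2,
                ← ENNReal.ofReal_div_of_pos (by norm_num)]
              exact ENNReal.ofReal_le_ofReal h2
          _ ≤ _ := by
              rw [setLIntegral_const]
              gcongr
              exact Set.sdiff_subset
    have h3 : L * volume Ω = L / 2 * volume Ω + L / 2 * volume Ω := by
      rw [← add_mul, ENNReal.add_halves]
    have h4 : L / 2 * volume Ω ≤ ∫⁻ z in {z | a / 2 < ‖f z‖}, ‖f z‖ₑ := by
      have h5 := hV1.trans h1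
      rw [h3] at h5
      exact (ENNReal.add_le_add_iff_right (by finiteness)).1 h5
    rw [h3, two_mul]
    gcongr
  -- the good part: averages on the cubes, `f` elsewhere
  have hdec : ∃ g : Pt d → ℂ, Measurable g ∧ (∀ s, ∀ z ∈ Q s, g z = ⨍ w in Q s, f w) ∧
      ∀ z, z ∉ Ω → g z = f z := by
    classical
    have key : ∀ s, ∀ z ∈ Q s, (if h : ∃ s, z ∈ Q s then ⨍ w in Q h.choose, f w else f z)
        = ⨍ w in Q s, f w := fun s z hz => by
      have h : ∃ s, z ∈ Q s := ⟨s, hz⟩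
      rw [dif_pos h]
      have : h.choose = s := by
        by_contra hne
        exact Set.disjoint_left.1 (hQd hne) h.choose_spec hz
      rw [this]
    refine ⟨fun z => if h : ∃ s, z ∈ Q s then ⨍ w in Q h.choose, f w else f z, ?_, ?_, ?_⟩
    · intro U hU
      have : (fun z => if h : ∃ s, z ∈ Q s then ⨍ w in Q h.choose, f w else f z) ⁻¹' U
          = (⋃ s, Q s ∩ {_z | (⨍ w in Q s, f w) ∈ U}) ∪ (Ωᶜ ∩ f ⁻¹' U) := by
        ext z
        by_cases h : ∃ s, z ∈ Q s
        · obtain ⟨s, hs⟩ := h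
          have hzΩ : z ∈ Ω := Set.mem_iUnion.2 ⟨s, hs⟩
          rw [Set.mem_preimage, key s z hs]
          constructor
          · intro hU'
            exact Or.inl (Set.mem_iUnion.2 ⟨s, hs, hU'⟩)
          · rintro (h' | h')
            · obtain ⟨t, ht, htU⟩ := Set.mem_iUnion.1 h'
              rw [← key s z hs, key t z ht]
              exact htU
            · exact absurd hzΩ h'.1
        · have hzΩ : z ∉ Ω := fun hz => h (Set.mem_iUnion.1 hz)
          rw [Set.mem_preimage, dif_neg h]
          constructor
          · exact fun hU' => Or.inr ⟨hzΩ, hU'⟩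
          · rintro (h' | h')
            · obtain ⟨t, ht, _⟩ := Set.mem_iUnion.1 h'
              exact absurd ⟨t, ht⟩ h
            · exact h'.2
      rw [this]
      exact (MeasurableSet.iUnion fun s => (hQm s).inter (MeasurableSet.const _)).union
        (hΩm.compl.inter (hf.measurable hU))
    · exact key
    · intro z hz
      exact dif_neg fun h => hz (Set.mem_iUnion.2 h)
  obtain ⟨g, hgm, hgQ, hgΩ⟩ := hdec
  have hg_pow : ∀ q : ℕ, ∀ s, ∫⁻ z in Q s, ‖g z‖ₑ ^ q
      = ‖⨍ w in Q s, f w‖ₑ ^ q * volume (Q s) := fun q s => by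
    rw [← setLIntegral_const]
    exact setLIntegral_congr_fun (hQm s) fun z hz => by simp only [hgQ s z hz]
  have havg : ∀ s, ‖⨍ w in Q s, f w‖ₑ ≤ 2 ^ (d + 2) * L := fun s => by
    have h1 := (enorm_average_mul_volume_le (hQ0 s) (hQt s) f).trans (hSu s.1 s.2)
    rw [← mul_assoc] at h1
    exact (ENNReal.mul_le_mul_iff_left (hQ0 s) (hQt s)).1 h1
  have hg1 : ∫⁻ z in Ω, ‖g z‖ₑ ≤ ∫⁻ z in Ω, ‖f z‖ₑ := by
    rw [hIsum, hΩ, lintegral_iUnion hQm hQd]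
    refine ENNReal.tsum_le_tsum fun s => ?_
    have := hg_pow 1 s
    simp only [pow_one] at this
    rw [this]
    exact enorm_average_mul_volume_le (hQ0 s) (hQt s) f
  have hgΩc : ∀ q : ℕ, ∫⁻ z in Ωᶜ, ‖g z‖ₑ ^ q = ∫⁻ z in Ωᶜ, ‖f z‖ₑ ^ q := fun q =>
    setLIntegral_congr_fun hΩm.compl fun z hz => by simp only [hgΩ z hz]
  have hgi : Integrable g := by
    refine ⟨hgm.aestronglyMeasurable, lt_of_le_of_lt ?_ hfi.2⟩
    rw [← lintegral_add_compl _ hΩm, ← lintegral_add_compl (fun z => ‖f z‖ₑ) hΩm]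
    have := hgΩc 1
    simp only [pow_one] at this
    rw [this]
    gcongr
  have hg2 : ∫⁻ z, ‖g z‖ₑ ^ 2 ≤ (∫⁻ z in {z | ‖f z‖ ≤ a}, ‖f z‖ₑ ^ 2)
      + (2 ^ (d + 2) * L) ^ 2 * volume Ω := by
    rw [← lintegral_add_compl _ hΩm, add_comm, hgΩc 2]
    gcongr
    · intro z hz
      exact hoff z hz
    · rw [hΩ, lintegral_iUnion hQm hQd, ← hΩ, hVsum, ← ENNReal.tsum_mul_left]
      refine ENNReal.tsum_le_tsum fun s => ?_
      rw [hg_pow 2 s]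
      gcongr
      exact havg s
  have hfa2 : ∫⁻ z in {z | ‖f z‖ ≤ a}, ‖f z‖ₑ ^ 2 ≠ ∞ := by
    have hms : MeasurableSet {z | ‖f z‖ ≤ a} := measurableSet_le hf.norm.measurable measurable_const
    have : ∫⁻ z in {z | ‖f z‖ ≤ a}, ‖f z‖ₑ ^ 2 ≤ L * ∫⁻ z, ‖f z‖ₑ := by
      rw [← lintegral_const_mul' _ _ hLt]
      refine (setLIntegral_mono' hms fun z hz => ?_).trans (setLIntegral_le_lintegral _ _)
      rw [sq]
      gcongr
      rw [← ofReal_norm]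
      exact ENNReal.ofReal_le_ofReal hz
    exact ne_top_of_le_ne_top (ENNReal.mul_ne_top hLt hfi.2.ne) this
  have hgL2 : MemLp g 2 := by
    refine ⟨hgm.aestronglyMeasurable, ?_⟩
    rw [eLpNorm_lt_top_iff_lintegral_rpow_enorm_lt_top (by norm_num) (by norm_num)]
    simp only [ENNReal.toReal_ofNat, ENNReal.rpow_ofNat]
    refine lt_of_le_of_lt hg2 (lt_top_iff_ne_top.2 ?_)
    finiteness
  -- the bad part
  set b : Pt d → ℂ := fun z => f z - g z with hb
  have hbm : Measurable b := hf.measurable.sub hgm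
  have hbi : Integrable b := hfi.sub hgi
  have hb0 : ∀ s, ∫ w in Q s, b w = 0 := fun s => by
    rw [hb, integral_sub hfi.integrableOn hgi.integrableOn]
    rw [setIntegral_congr_fun (hQm s) (fun z hz => hgQ s z hz), setIntegral_const,
      setAverage_eq, smul_smul, measureReal_def,
      mul_inv_cancel₀ (ENNReal.toReal_pos (hQ0 s) (hQt s)).ne', one_smul, sub_self]
  have hbs : ∀ z, z ∉ Ω → b z = 0 := fun z hz => by simp [hb, hgΩ z hz]
  have hbL1 : ∫⁻ z, ‖b z‖ₑ ≤ 2 * (2 ^ (d + 2) * (L * volume Ω)) := by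
    have h1 : ∫⁻ z, ‖b z‖ₑ = ∫⁻ z in Ω, ‖b z‖ₑ := by
      rw [← lintegral_add_compl _ hΩm,
        setLIntegral_eq_zero hΩm.compl fun z hz => by simp [hbs z hz], add_zero]
    calc _ = ∫⁻ z in Ω, ‖b z‖ₑ := h1
      _ ≤ ∫⁻ z in Ω, (‖f z‖ₑ + ‖g z‖ₑ) := lintegral_mono fun z => enorm_sub_le
      _ = (∫⁻ z in Ω, ‖f z‖ₑ) + ∫⁻ z in Ω, ‖g z‖ₑ := lintegral_add_left hf.enorm.measurable _
      _ ≤ 2 ^ (d + 2) * (L * volume Ω) + 2 ^ (d + 2) * (L * volume Ω) := by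
          gcongr
          exact hg1.trans hV2
      _ = _ := (two_mul _).symm
  -- the enlarged cubes, off which the smoothness of the kernel is used
  set E : Set (Pt d) := ⋃ s : S, {z | gauge (z - corner s.1)
    < 2 * ((d + 1) * ((2 : ℝ) ^ s.1.1)⁻¹)} with hE
  have hEm : MeasurableSet E := MeasurableSet.iUnion fun s => measurableSet_lt
    (continuous_gauge.comp (continuous_id.sub continuous_const)).measurable measurable_const
  have hEvol : volume E ≤ dilationConst d * volume Ω := by
    refine (measure_iUnion_le _).trans ?_
    rw [hVsum, ← ENNReal.tsum_mul_left]
    exact ENNReal.tsum_le_tsum fun s => (volume_enlarged_cube s.1).le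
  have hbad := lintegral_bad_part_le hK hKM hB hQm hQd
    (c := fun s => corner s.1) (r := fun s => (d + 1) * ((2 : ℝ) ^ s.1.1)⁻¹)
    (fun s => by positivity) (fun s w hw => gauge_sub_corner_le hw) hbi hbm hb0 hbs
  have hKi : ∀ (h : Pt d → ℂ), Integrable h → ∀ z, Integrable fun w => K (z - w) * h w :=
    fun h hh z => hh.bdd_mul (c := M)
      (hK.comp (continuous_const.sub continuous_id)).aestronglyMeasurable
      (Eventually.of_forall fun w => hKM _)
  have hsplit : ∀ z, ∫ w, K (z - w) * f w = (∫ w, K (z - w) * g w) + ∫ w, K (z - w) * b w :=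
    fun z => by
      rw [← integral_add (hKi g hgi z) (hKi b hbi z)]
      congr 1
      ext w
      simp only [hb]
      ring
  have hTcont : ∀ (h : Pt d → ℂ), Measurable h → Integrable h →
      Measurable fun z => ∫ w, K (z - w) * h w := fun h hm hh => by
    have : StronglyMeasurable (Function.uncurry fun z w : Pt d => K (z - w) * h w) := by
      refine Measurable.stronglyMeasurable ?_
      exact (hK.comp (continuous_fst.sub continuous_snd)).measurable.mul (hm.comp measurable_snd)
    exact this.integral_prod_right'.measurable
  have hsub : {z | a < ‖∫ w, K (z - w) * f w‖} ⊆ {z | L / 2 ≤ ‖∫ w, K (z - w) * g w‖ₑ} ∪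
      (E ∪ ({z | L / 2 ≤ ‖∫ w, K (z - w) * b w‖ₑ} ∩ Eᶜ)) := by
    intro z hz
    by_contra hcon
    simp only [Set.mem_union, Set.mem_inter_iff, Set.mem_ofPred_eq, Set.mem_compl_iff, not_or,
      not_and, not_le, not_not] at hcon
    have h1 := hcon.1
    have h2 : ‖∫ w, K (z - w) * b w‖ₑ < L / 2 := by
      by_contra! h
      exact hcon.2.1 (hcon.2.2 h)
    have h3 : ‖∫ w, K (z - w) * f w‖ₑ < L := by
      rw [hsplit, ← ENNReal.add_halves L]
      exact (enorm_add_le _ _).trans_lt (ENNReal.add_lt_add h1 h2)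
    rw [hL, ← ofReal_norm, ENNReal.ofReal_lt_ofReal_iff ha] at h3
    exact lt_asymm h3 hz
  -- Chebyshev's inequality in `L²` for the good part, and in `L¹` for the bad part
  have hgood : L ^ 2 * volume {z | L / 2 ≤ ‖∫ w, K (z - w) * g w‖ₑ}
      ≤ 4 * (A ^ 2 * ∫⁻ z, ‖g z‖ₑ ^ 2) := by
    have h1 := mul_meas_ge_le_lintegral (μ := volume)
      ((hTcont g hgm hgi).enorm.pow_const 2) ((L / 2) ^ 2)
    have h2 : {z | L / 2 ≤ ‖∫ w, K (z - w) * g w‖ₑ}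
        ⊆ {z | (L / 2) ^ 2 ≤ ‖∫ w, K (z - w) * g w‖ₑ ^ 2} := fun z hz => by
      simp only [Set.mem_ofPred_eq] at hz ⊢
      gcongr
    have h3 : L ^ 2 = 4 * (L / 2) ^ 2 := by
      rw [ENNReal.div_eq_inv_mul, mul_pow, ← mul_assoc, show (4 : ℝ≥0∞) = 2 ^ 2 by norm_num,
        ← mul_pow, ENNReal.mul_inv_cancel (by norm_num) (by norm_num), one_pow, one_mul]
    rw [h3, mul_assoc]
    gcongr 4 * ?_
    exact (mul_le_mul_right (measure_mono h2) _).trans (h1.trans (hA g hgL2))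
  have hbadw : L * volume ({z | L / 2 ≤ ‖∫ w, K (z - w) * b w‖ₑ} ∩ Eᶜ)
      ≤ 2 * (B * ∫⁻ z, ‖b z‖ₑ) := by
    have h1 := mul_meas_ge_le_lintegral (μ := volume.restrict Eᶜ) (hTcont b hbm hbi).enorm (L / 2)
    rw [Measure.restrict_apply' hEm.compl] at h1
    have h3 : L = 2 * (L / 2) := (ENNReal.mul_div_cancel (by norm_num) (by norm_num)).symm
    calc _ = 2 * (L / 2 * volume ({z | L / 2 ≤ ‖∫ w, K (z - w) * b w‖ₑ} ∩ Eᶜ)) := by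
          rw [← mul_assoc, ← h3]
      _ ≤ _ := by
          gcongr 2 * ?_
          exact h1.trans hbad
  set X := ∫⁻ z in {z | ‖f z‖ ≤ a}, ‖f z‖ₑ ^ 2
  set Y := ∫⁻ z in {z | a / 2 < ‖f z‖}, ‖f z‖ₑ
  have hLV : L ^ 2 * volume Ω ≤ 2 * (L * Y) := by
    calc L ^ 2 * volume Ω = L * (L * volume Ω) := by ring
      _ ≤ L * (2 * Y) := by gcongr
      _ = _ := by ring
  calc _ ≤ L ^ 2 * (volume {z | L / 2 ≤ ‖∫ w, K (z - w) * g w‖ₑ} + (volume E +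
        volume ({z | L / 2 ≤ ‖∫ w, K (z - w) * b w‖ₑ} ∩ Eᶜ))) := by
        gcongr
        exact (measure_mono hsub).trans ((measure_union_le _ _).trans (by
          gcongr
          exact measure_union_le _ _))
    _ = L ^ 2 * volume {z | L / 2 ≤ ‖∫ w, K (z - w) * g w‖ₑ} + (L ^ 2 * volume E +
        L * (L * volume ({z | L / 2 ≤ ‖∫ w, K (z - w) * b w‖ₑ} ∩ Eᶜ))) := by ring
    _ ≤ 4 * (A ^ 2 * (X + (2 ^ (d + 2) * L) ^ 2 * volume Ω)) +
        (L ^ 2 * (dilationConst d * volume Ω) +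
          L * (2 * (B * (2 * (2 ^ (d + 2) * (L * volume Ω)))))) := by
        refine add_le_add (hgood.trans (by gcongr)) (add_le_add (by gcongr) ?_)
        gcongr L * ?_
        exact hbadw.trans (by gcongr)
    _ = 4 * A ^ 2 * X + (4 * A ^ 2 * (2 ^ (d + 2)) ^ 2 + dilationConst d
          + 4 * (B * 2 ^ (d + 2))) * (L ^ 2 * volume Ω) := by ring
    _ ≤ 4 * A ^ 2 * X + (4 * A ^ 2 * (2 ^ (d + 2)) ^ 2 + dilationConst d
          + 4 * (B * 2 ^ (d + 2))) * (2 * (L * Y)) := by gcongr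
    _ = 4 * A ^ 2 * X + 2 * (4 * A ^ 2 * (2 ^ (d + 2)) ^ 2 + dilationConst d
          + 4 * (B * 2 ^ (d + 2))) * (L * Y) := by ring
    _ ≤ weakConst d A B * X + weakConst d A B * (L * Y) := by
        unfold weakConst
        gcongr
        · exact le_self_add
        · exact le_add_self
    _ = _ := by rw [mul_add]

end Parabolic

end

/-! ### From the weak type estimate to `Lᵖ` -/

noncomputable section

namespace Parabolic

open Filter Topology

variable {d : ℕ}

theorem lintegral_Ioi_rpow_ge {s p : ℝ} (hs : 0 < s) (hp : p < 2) :
    ∫⁻ t in Set.Ioi 0, ({t | s ≤ t}.indicator (fun t => ENNReal.ofReal (t ^ (p - 3)))) t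
      = ENNReal.ofReal (s ^ (p - 2) / (2 - p)) := by
  have hset : MeasurableSet {t : ℝ | s ≤ t} := measurableSet_Ici
  rw [lintegral_indicator hset, Measure.restrict_restrict hset]
  have : {t : ℝ | s ≤ t} ∩ Set.Ioi 0 = Set.Ici s := by
    ext t
    simp only [Set.mem_inter_iff, Set.mem_ofPred_eq, Set.mem_Ioi, Set.mem_Ici]
    exact ⟨fun h => h.1, fun h => ⟨h, hs.trans_le h⟩⟩
  rw [this, setLIntegral_congr Ioi_ae_eq_Ici.symm, ← ofReal_integral_eq_lintegral_ofReal
    (integrableOn_Ioi_rpow_of_lt (by linarith) hs), integral_Ioi_rpow_of_lt (by linarith) hs]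
  · congr 1
    rw [show p - 3 + 1 = p - 2 by ring, show p - 2 = -(2 - p) by ring, neg_div_neg_eq]
  · refine (ae_restrict_iff' measurableSet_Ioi).2 (Eventually.of_forall fun t ht => ?_)
    exact Real.rpow_nonneg (hs.le.trans (le_of_lt ht)) _

theorem lintegral_Ioi_rpow_lt {s p : ℝ} (hs : 0 ≤ s) (hp : 1 < p) :
    ∫⁻ t in Set.Ioi 0, ({t | t / 2 < s}.indicator (fun t => ENNReal.ofReal (t ^ (p - 2)))) t
      = ENNReal.ofReal ((2 * s) ^ (p - 1) / (p - 1)) := by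
  have hset : MeasurableSet {t : ℝ | t / 2 < s} :=
    measurableSet_lt (by fun_prop) measurable_const
  rw [lintegral_indicator hset, Measure.restrict_restrict hset]
  have : {t : ℝ | t / 2 < s} ∩ Set.Ioi 0 = Set.Ioo 0 (2 * s) := by
    ext t
    simp only [Set.mem_inter_iff, Set.mem_ofPred_eq, Set.mem_Ioi, Set.mem_Ioo]
    constructor <;> rintro ⟨h1, h2⟩ <;> constructor <;> linarith
  have hi : IntervalIntegrable (fun t : ℝ => t ^ (p - 2)) volume 0 (2 * s) :=
    intervalIntegral.intervalIntegrable_rpow' (by linarith)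
  rw [this, setLIntegral_congr Ioo_ae_eq_Ioc, ← ofReal_integral_eq_lintegral_ofReal
    ((intervalIntegrable_iff_integrableOn_Ioc_of_le (by linarith)).1 hi),
    ← intervalIntegral.integral_of_le (by linarith), integral_rpow (Or.inl (by linarith))]
  · congr 1
    rw [show p - 2 + 1 = p - 1 by ring, Real.zero_rpow (by linarith), sub_zero]
  · refine (ae_restrict_iff' measurableSet_Ioc).2 (Eventually.of_forall fun t ht => ?_)
    exact Real.rpow_nonneg ht.1.le _

/-- The constant of the `Lᵖ` estimate for `1 < p < 2`. -/
def strongConst (d : ℕ) (A B : ℝ≥0) (p : ℝ) : ℝ≥0∞ :=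
  ENNReal.ofReal p * (weakConst d A B *
    (ENNReal.ofReal (1 / (2 - p)) + ENNReal.ofReal (2 ^ (p - 1) / (p - 1))))

theorem strongConst_ne_top (d : ℕ) (A B : ℝ≥0) (p : ℝ) : strongConst d A B p ≠ ∞ := by
  have := weakConst_ne_top d A B
  unfold strongConst
  finiteness

/-- The estimate at all heights integrates to an `Lᵖ` bound for `1 < p < 2`, without a separate
interpolation argument. -/
theorem strong_type_estimate {K : Pt d → ℂ} (hK : Continuous K) {M : ℝ} (hKM : ∀ z, ‖K z‖ ≤ M)
    {A B : ℝ≥0} (hA : L2Bound K A) (hB : HormanderBound K B) {f : Pt d → ℂ} (hf : Continuous f)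
    (hfi : Integrable f) {p : ℝ} (hp1 : 1 < p) (hp2 : p < 2) :
    ∫⁻ z, ‖∫ w, K (z - w) * f w‖ₑ ^ p ≤ strongConst d A B p * ∫⁻ z, ‖f z‖ₑ ^ p := by
  have hTm : Measurable fun z => ∫ w, K (z - w) * f w := by
    have : StronglyMeasurable (Function.uncurry fun z w : Pt d => K (z - w) * f w) :=
      ((hK.comp (continuous_fst.sub continuous_snd)).mul
        (hf.comp continuous_snd)).stronglyMeasurable
    exact this.integral_prod_right'.measurable
  -- the layer cake formula
  have h1 := lintegral_rpow_eq_lintegral_meas_lt_mul volume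
    (f := fun z => ‖∫ w, K (z - w) * f w‖) (Eventually.of_forall fun z => norm_nonneg _)
    hTm.norm.aemeasurable (p := p) (by linarith)
  have h2 : ∫⁻ z, ‖∫ w, K (z - w) * f w‖ₑ ^ p
      = ∫⁻ z, ENNReal.ofReal (‖∫ w, K (z - w) * f w‖ ^ p) := lintegral_congr fun z => by
    rw [← ofReal_norm, ENNReal.ofReal_rpow_of_nonneg (norm_nonneg _) (by linarith)]
  -- the two terms of the estimate at height `t`, multiplied by `t ^ (p - 3)`
  set G₁ : ℝ → Pt d → ℝ≥0∞ := fun t z =>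
    {t | ‖f z‖ ≤ t}.indicator (fun t => ENNReal.ofReal (t ^ (p - 3))) t * ‖f z‖ₑ ^ 2 with hG₁
  set G₂ : ℝ → Pt d → ℝ≥0∞ := fun t z =>
    {t | t / 2 < ‖f z‖}.indicator (fun t => ENNReal.ofReal (t ^ (p - 2))) t * ‖f z‖ₑ with hG₂
  have hfm : Measurable fun q : ℝ × Pt d => ‖f q.2‖ := hf.norm.measurable.comp measurable_snd
  have hfe : Measurable fun q : ℝ × Pt d => ‖f q.2‖ₑ := hf.enorm.measurable.comp measurable_snd
  have hm₁ : Measurable (Function.uncurry G₁) := by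
    have : Function.uncurry G₁ = fun q : ℝ × Pt d => ({q : ℝ × Pt d | ‖f q.2‖ ≤ q.1}.indicator
        (fun q => ENNReal.ofReal (q.1 ^ (p - 3))) q) * ‖f q.2‖ₑ ^ 2 := by
      ext q
      rfl
    rw [this]
    refine Measurable.mul (Measurable.indicator ?_ (measurableSet_le hfm measurable_fst))
      (hfe.pow_const 2)
    exact (measurable_fst.pow_const _).ennreal_ofReal
  have hm₂ : Measurable (Function.uncurry G₂) := by
    have : Function.uncurry G₂ = fun q : ℝ × Pt d => ({q : ℝ × Pt d | q.1 / 2 < ‖f q.2‖}.indicator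
        (fun q => ENNReal.ofReal (q.1 ^ (p - 2))) q) * ‖f q.2‖ₑ := by
      ext q
      rfl
    rw [this]
    refine Measurable.mul (Measurable.indicator ?_
      (measurableSet_lt (measurable_fst.div_const 2) hfm)) hfe
    exact (measurable_fst.pow_const _).ennreal_ofReal
  have hpt : ∀ t ∈ Set.Ioi (0 : ℝ), volume {z | t < ‖∫ w, K (z - w) * f w‖}
      * ENNReal.ofReal (t ^ (p - 1)) ≤ weakConst d A B * ((∫⁻ z, G₁ t z) + ∫⁻ z, G₂ t z) := by
    intro t ht
    have ht0 : (0 : ℝ) < t := ht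
    have hw := weak_type_estimate hK hKM hA hB hf hfi ht0
    have e1 : ENNReal.ofReal (t ^ (p - 1))
        = ENNReal.ofReal (t ^ (p - 3)) * ENNReal.ofReal t ^ 2 := by
      rw [← ENNReal.ofReal_pow ht0.le, ← ENNReal.ofReal_mul (by positivity), ← Real.rpow_natCast,
        ← Real.rpow_add ht0]
      congr 2
      push_cast; ring
    have e2 : ENNReal.ofReal (t ^ (p - 2)) = ENNReal.ofReal (t ^ (p - 3)) * ENNReal.ofReal t := by
      rw [← ENNReal.ofReal_mul (by positivity)]
      congr 1
      nth_rewrite 3 [← Real.rpow_one t]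
      rw [← Real.rpow_add ht0]
      congr 1
      ring
    have e3 : ∫⁻ z, G₁ t z
        = ENNReal.ofReal (t ^ (p - 3)) * ∫⁻ z in {z | ‖f z‖ ≤ t}, ‖f z‖ₑ ^ 2 := by
      rw [← lintegral_const_mul' _ _ ENNReal.ofReal_ne_top,
        ← lintegral_indicator (measurableSet_le hf.norm.measurable measurable_const)]
      refine lintegral_congr fun z => ?_
      by_cases h : ‖f z‖ ≤ t <;> simp [hG₁, Set.indicator, h]
    have e4 : ∫⁻ z, G₂ t z
        = ENNReal.ofReal (t ^ (p - 2)) * ∫⁻ z in {z | t / 2 < ‖f z‖}, ‖f z‖ₑ := by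
      rw [← lintegral_const_mul' _ _ ENNReal.ofReal_ne_top,
        ← lintegral_indicator (measurableSet_lt measurable_const hf.norm.measurable)]
      refine lintegral_congr fun z => ?_
      by_cases h : t / 2 < ‖f z‖ <;> simp [hG₂, Set.indicator, h]
    rw [e1, e3, e4, e2]
    calc _ = ENNReal.ofReal (t ^ (p - 3)) * (ENNReal.ofReal t ^ 2 *
          volume {z | t < ‖∫ w, K (z - w) * f w‖}) := by ring
      _ ≤ ENNReal.ofReal (t ^ (p - 3)) * (weakConst d A B * ((∫⁻ z in {z | ‖f z‖ ≤ t}, ‖f z‖ₑ ^ 2)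
          + ENNReal.ofReal t * ∫⁻ z in {z | t / 2 < ‖f z‖}, ‖f z‖ₑ)) := by gcongr
      _ = _ := by ring
  have hs₁ : ∫⁻ t in Set.Ioi (0 : ℝ), ∫⁻ z, G₁ t z
      ≤ ENNReal.ofReal (1 / (2 - p)) * ∫⁻ z, ‖f z‖ₑ ^ p := by
    rw [lintegral_lintegral_swap hm₁.aemeasurable, ← lintegral_const_mul' _ _ ENNReal.ofReal_ne_top]
    refine lintegral_mono fun z => ?_
    simp only [hG₁]
    rw [lintegral_mul_const' _ _ (by finiteness)]
    by_cases hz : f z = 0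
    · simp [hz]
    · have hz0 : 0 < ‖f z‖ := norm_pos_iff.2 hz
      rw [lintegral_Ioi_rpow_ge hz0 hp2, ← ofReal_norm, ← ENNReal.ofReal_pow hz0.le,
        ENNReal.ofReal_rpow_of_nonneg hz0.le (by linarith),
        ← ENNReal.ofReal_mul (div_nonneg (by positivity) (by linarith)),
        ← ENNReal.ofReal_mul (div_nonneg (by positivity) (by linarith))]
      refine ENNReal.ofReal_le_ofReal (le_of_eq ?_)
      rw [← Real.rpow_natCast, div_mul_eq_mul_div, ← Real.rpow_add hz0, one_div_mul_eq_div]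
      congr 2
      push_cast; ring
  have hs₂ : ∫⁻ t in Set.Ioi (0 : ℝ), ∫⁻ z, G₂ t z
      ≤ ENNReal.ofReal (2 ^ (p - 1) / (p - 1)) * ∫⁻ z, ‖f z‖ₑ ^ p := by
    rw [lintegral_lintegral_swap hm₂.aemeasurable, ← lintegral_const_mul' _ _ ENNReal.ofReal_ne_top]
    refine lintegral_mono fun z => ?_
    simp only [hG₂]
    rw [lintegral_mul_const' _ _ (by finiteness), lintegral_Ioi_rpow_lt (norm_nonneg _) hp1,
      ← ofReal_norm, ENNReal.ofReal_rpow_of_nonneg (norm_nonneg _) (by linarith),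
      ← ENNReal.ofReal_mul (div_nonneg (by positivity) (by linarith)),
      ← ENNReal.ofReal_mul (div_nonneg (by positivity) (by linarith))]
    refine ENNReal.ofReal_le_ofReal (le_of_eq ?_)
    by_cases hz : ‖f z‖ = 0
    · rw [hz, mul_zero, Real.zero_rpow (by linarith : p ≠ 0), mul_zero]
    · have hz0 : 0 < ‖f z‖ := lt_of_le_of_ne (norm_nonneg _) (Ne.symm hz)
      have e : ‖f z‖ ^ p = ‖f z‖ ^ (p - 1) * ‖f z‖ := by
        nth_rewrite 3 [← Real.rpow_one ‖f z‖]
        rw [← Real.rpow_add hz0]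
        congr 1
        ring
      rw [Real.mul_rpow (by norm_num) hz0.le, e]
      ring
  have hmeas₁ : Measurable fun t => ∫⁻ z, G₁ t z := hm₁.lintegral_prod_right'
  rw [h2, h1]
  calc _ ≤ ENNReal.ofReal p * ∫⁻ t in Set.Ioi (0 : ℝ),
        weakConst d A B * ((∫⁻ z, G₁ t z) + ∫⁻ z, G₂ t z) := by
        gcongr ENNReal.ofReal p * ?_
        exact setLIntegral_mono' measurableSet_Ioi hpt
    _ = ENNReal.ofReal p * (weakConst d A B * ((∫⁻ t in Set.Ioi (0 : ℝ), ∫⁻ z, G₁ t z)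
          + ∫⁻ t in Set.Ioi (0 : ℝ), ∫⁻ z, G₂ t z)) := by
        rw [lintegral_const_mul' _ _ (weakConst_ne_top _ _ _), lintegral_add_left hmeas₁]
    _ ≤ ENNReal.ofReal p * (weakConst d A B * (ENNReal.ofReal (1 / (2 - p)) * (∫⁻ z, ‖f z‖ₑ ^ p)
          + ENNReal.ofReal (2 ^ (p - 1) / (p - 1)) * ∫⁻ z, ‖f z‖ₑ ^ p)) := by gcongr
    _ = _ := by unfold strongConst; ring

end Parabolic

end

/-! ### Smoothness of dyadic kernels -/

noncomputable section

namespace Parabolic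

open Filter Topology

variable {d : ℕ}

/-- The `L¹` modulus of continuity of a Schwartz kernel is linear. -/
theorem exists_modulus_bound (κ : 𝓢(Pt d, ℂ)) :
    ∃ C : ℝ, 0 ≤ C ∧ ∀ w : Pt d, ‖w‖ ≤ 2 → ∫⁻ z, ‖κ (z - w) - κ z‖ₑ ≤ ENNReal.ofReal (C * ‖w‖) := by
  have h := fun z => κ.one_add_le_sup_seminorm_apply (𝕜 := ℝ) (m := (d + 2, 1)) (k := d + 2)
    (n := 1) le_rfl le_rfl z
  set C₀ := 2 ^ (d + 2) * ((Finset.Iic (d + 2, 1)).sup fun m =>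
    SchwartzMap.seminorm ℝ m.1 m.2) κ with hC₀
  have hC₀0 : 0 ≤ C₀ := by positivity
  have hint : Integrable fun z : Pt d => (1 + ‖z‖) ^ (-((d : ℝ) + 2)) :=
    integrable_one_add_norm (by simp)
  set I := ∫ z : Pt d, (1 + ‖z‖) ^ (-((d : ℝ) + 2)) with hI
  have hI0 : 0 ≤ I := integral_nonneg fun z => by positivity
  refine ⟨3 ^ (d + 2) * C₀ * I, by positivity, fun w hw => ?_⟩
  have hpt : ∀ z, ‖κ (z - w) - κ z‖
      ≤ 3 ^ (d + 2) * C₀ * ‖w‖ * (1 + ‖z‖) ^ (-((d : ℝ) + 2)) := fun z => by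
    have hpow : (1 + ‖z‖) ^ (-((d : ℝ) + 2)) = ((1 + ‖z‖) ^ (d + 2))⁻¹ := by
      rw [Real.rpow_neg (by positivity)]
      norm_cast
    have hd : ∀ u ∈ segment ℝ z (z - w), ‖fderiv ℝ κ u‖
        ≤ 3 ^ (d + 2) * C₀ * (1 + ‖z‖) ^ (-((d : ℝ) + 2)) := fun u hu => by
      have h1 : ‖z‖ ≤ ‖u‖ + 2 := by
        have h2 : ‖u - z‖ ≤ ‖z - w - z‖ := norm_sub_le_of_mem_segment hu
        rw [sub_sub_cancel_left, norm_neg] at h2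
        have h3 : ‖z‖ ≤ ‖u‖ + ‖u - z‖ := norm_le_norm_add_norm_sub u z
        linarith
      have h4 := h u
      rw [norm_iteratedFDeriv_one] at h4
      rw [hpow, ← div_eq_mul_inv, le_div_iff₀ (by positivity)]
      calc ‖fderiv ℝ κ u‖ * (1 + ‖z‖) ^ (d + 2)
          ≤ ‖fderiv ℝ κ u‖ * (3 * (1 + ‖u‖)) ^ (d + 2) := by
            gcongr; linarith [norm_nonneg u]
        _ = 3 ^ (d + 2) * ((1 + ‖u‖) ^ (d + 2) * ‖fderiv ℝ κ u‖) := by rw [mul_pow]; ring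
        _ ≤ 3 ^ (d + 2) * C₀ := by gcongr
    have h5 := (convex_segment z (z - w)).norm_image_sub_le_of_norm_fderiv_le (𝕜 := ℝ)
      (fun u _ => κ.differentiableAt) hd (left_mem_segment ℝ z (z - w))
      (right_mem_segment ℝ z (z - w))
    rw [sub_sub_cancel_left, norm_neg] at h5
    linarith
  calc ∫⁻ z, ‖κ (z - w) - κ z‖ₑ
      ≤ ∫⁻ z, ENNReal.ofReal (3 ^ (d + 2) * C₀ * ‖w‖ * (1 + ‖z‖) ^ (-((d : ℝ) + 2))) := by
        refine lintegral_mono fun z => ?_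
        rw [← ofReal_norm]
        exact ENNReal.ofReal_le_ofReal (hpt z)
    _ = ENNReal.ofReal (3 ^ (d + 2) * C₀ * ‖w‖ * I) := by
        rw [← ofReal_integral_eq_lintegral_ofReal (hint.const_mul _)
          (Eventually.of_forall fun z => by positivity), integral_const_mul]
    _ = _ := by congr 1; ring

theorem exists_tail_bound (κ : 𝓢(Pt d, ℂ)) :
    ∃ C : ℝ, 0 ≤ C ∧ ∀ ρ : ℝ, 0 < ρ →
      ∫⁻ z in {z | ρ ≤ gauge z}, ‖κ z‖ₑ ≤ ENNReal.ofReal (C / ρ) := by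
  obtain ⟨C₀, hC₀0, hC₀⟩ := exists_gauge_decay κ (d + 4)
  have hint : Integrable fun z : Pt d => (1 + gauge z) ^ (-((d : ℝ) + 3)) :=
    integrable_gauge (by linarith)
  set I := ∫ z : Pt d, (1 + gauge z) ^ (-((d : ℝ) + 3)) with hI
  have hpos : ∀ z : Pt d, 0 ≤ (1 + gauge z) ^ (-((d : ℝ) + 3)) := fun z => by
    have := gauge_nonneg z
    positivity
  have hI0 : 0 ≤ I := integral_nonneg hpos
  refine ⟨C₀ * I, by positivity, fun ρ hρ => ?_⟩
  have hm : MeasurableSet {z : Pt d | ρ ≤ gauge z} :=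
    measurableSet_le measurable_const continuous_gauge.measurable
  calc ∫⁻ z in {z | ρ ≤ gauge z}, ‖κ z‖ₑ
      ≤ ∫⁻ z in {z | ρ ≤ gauge z}, ENNReal.ofReal (C₀ / ρ * (1 + gauge z) ^ (-((d : ℝ) + 3))) := by
        refine setLIntegral_mono' hm fun z hz => ?_
        rw [← ofReal_norm]
        refine ENNReal.ofReal_le_ofReal ?_
        have h0 := gauge_nonneg z
        have h1 := hC₀ z
        have hz' : ρ ≤ gauge z := hz
        have hpow : (1 + gauge z) ^ (-((d : ℝ) + 3)) = ((1 + gauge z) ^ (d + 3))⁻¹ := by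
          rw [Real.rpow_neg (by positivity)]
          norm_cast
        rw [hpow, ← div_eq_mul_inv, div_div, le_div_iff₀ (by positivity)]
        calc ‖κ z‖ * (ρ * (1 + gauge z) ^ (d + 3))
            ≤ ‖κ z‖ * ((1 + gauge z) * (1 + gauge z) ^ (d + 3)) := by gcongr; linarith
          _ = (1 + gauge z) ^ (d + 4) * ‖κ z‖ := by ring
          _ ≤ C₀ := h1
    _ ≤ ∫⁻ z, ENNReal.ofReal (C₀ / ρ * (1 + gauge z) ^ (-((d : ℝ) + 3))) :=
        setLIntegral_le_lintegral _ _
    _ = ENNReal.ofReal (C₀ / ρ * I) := by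
        rw [← ofReal_integral_eq_lintegral_ofReal (hint.const_mul _)
          (Eventually.of_forall fun z => mul_nonneg (by positivity) (hpos z)), integral_const_mul]
    _ = _ := by congr 1; ring

/-- A Schwartz kernel at unit scale, tested at scale `ρ`. The bound is comparable to
`min ρ ρ⁻¹`, in a form that telescopes over dyadic scales. -/
theorem exists_unit_scale_bound (κ : 𝓢(Pt d, ℂ)) :
    ∃ C : ℝ, 0 ≤ C ∧ ∀ (ρ : ℝ) (w : Pt d), 0 < ρ → gauge w ≤ ρ →
      ∫⁻ z in {z | 2 * ρ ≤ gauge z}, ‖κ (z - w) - κ z‖ₑ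
        ≤ ENNReal.ofReal (C * (ρ / ((1 + ρ) * (1 + 2 * ρ)))) := by
  obtain ⟨C₁, hC₁0, hC₁⟩ := exists_modulus_bound κ
  obtain ⟨C₂, hC₂0, hC₂⟩ := exists_tail_bound κ
  refine ⟨12 * C₁ + 12 * C₂, by positivity, fun ρ w hρ hw => ?_⟩
  -- small scales use the smoothness of the kernel, large scales its decay
  rcases le_or_gt ρ 1 with h1 | h1
  · have h0 := gauge_nonneg w
    have hw2 : ‖w‖ ≤ 2 * ρ := by
      have := norm_le_gauge w
      nlinarith
    refine (setLIntegral_le_lintegral _ _).trans ((hC₁ w (by linarith)).trans ?_)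
    refine ENNReal.ofReal_le_ofReal ?_
    have h2 : ρ / 6 ≤ ρ / ((1 + ρ) * (1 + 2 * ρ)) := by
      gcongr
      nlinarith
    calc C₁ * ‖w‖ ≤ C₁ * (2 * ρ) := by gcongr
      _ = 12 * C₁ * (ρ / 6) := by ring
      _ ≤ (12 * C₁ + 12 * C₂) * (ρ / 6) := by gcongr; linarith
      _ ≤ _ := by gcongr
  · have hm : MeasurableSet {z : Pt d | 2 * ρ ≤ gauge z} :=
      measurableSet_le measurable_const continuous_gauge.measurable
    have hA : ∫⁻ z in {z | 2 * ρ ≤ gauge z}, ‖κ (z - w)‖ₑ ≤ ENNReal.ofReal (C₂ / ρ) := by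
      have h3 := (measurePreserving_sub_right (volume : Measure (Pt d))
        w).setLIntegral_comp_preimage_emb (measurableEmbedding_subRight w)
          (fun z => ‖κ z‖ₑ) {z | ρ ≤ gauge z}
      refine le_trans ?_ (hC₂ ρ hρ)
      rw [← h3]
      refine lintegral_mono_set fun z hz => ?_
      have := gauge_le_sub_add z w
      have hz' : 2 * ρ ≤ gauge z := hz
      change ρ ≤ gauge (z - w)
      linarith
    have hB : ∫⁻ z in {z | 2 * ρ ≤ gauge z}, ‖κ z‖ₑ ≤ ENNReal.ofReal (C₂ / ρ) := by
      refine le_trans (lintegral_mono_set fun z hz => ?_) (hC₂ ρ hρ)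
      have hz' : 2 * ρ ≤ gauge z := hz
      change ρ ≤ gauge z
      linarith
    calc _ ≤ ∫⁻ z in {z | 2 * ρ ≤ gauge z}, (‖κ (z - w)‖ₑ + ‖κ z‖ₑ) :=
          lintegral_mono fun z => enorm_sub_le
      _ = (∫⁻ z in {z | 2 * ρ ≤ gauge z}, ‖κ (z - w)‖ₑ)
          + ∫⁻ z in {z | 2 * ρ ≤ gauge z}, ‖κ z‖ₑ :=
          lintegral_add_right _ κ.continuous.enorm.measurable
      _ ≤ ENNReal.ofReal (C₂ / ρ) + ENNReal.ofReal (C₂ / ρ) := add_le_add hA hB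
      _ = ENNReal.ofReal (2 * C₂ / ρ) := by
          rw [← ENNReal.ofReal_add (by positivity) (by positivity)]
          congr 1; ring
      _ ≤ _ := by
          refine ENNReal.ofReal_le_ofReal ?_
          have h2 : 1 / (6 * ρ) ≤ ρ / ((1 + ρ) * (1 + 2 * ρ)) := by
            rw [div_le_div_iff₀ (by positivity) (by positivity)]
            nlinarith
          calc 2 * C₂ / ρ = 12 * C₂ * (1 / (6 * ρ)) := by field_simp; ring
            _ ≤ (12 * C₁ + 12 * C₂) * (1 / (6 * ρ)) := by gcongr; linarith
            _ ≤ _ := by gcongr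

/-- The kernel `κ` rescaled to scale `s`, normalized in `L¹`. -/
def scaleKernel (κ : 𝓢(Pt d, ℂ)) (s : ℝ) (z : Pt d) : ℂ :=
  ((s ^ (d + 2))⁻¹ : ℝ) • κ (dil s⁻¹ z)

/-- The sum of the kernels at the scales `r, 2r, …, 2ⁿ⁻¹r`. -/
def dyadicKernel (κ : 𝓢(Pt d, ℂ)) (r : ℝ) (n : ℕ) (z : Pt d) : ℂ :=
  ∑ i ∈ Finset.range n, scaleKernel κ (2 ^ i * r) z

theorem continuous_scaleKernel (κ : 𝓢(Pt d, ℂ)) (s : ℝ) : Continuous (scaleKernel κ s) :=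
  (κ.continuous.comp (dil s⁻¹).continuous).const_smul ((s ^ (d + 2))⁻¹ : ℝ)

theorem integrable_scaleKernel (κ : 𝓢(Pt d, ℂ)) {s : ℝ} (hs : 0 < s) :
    Integrable (scaleKernel κ s) :=
  (integrable_comp_dil (inv_pos.2 hs) κ.integrable).smul ((s ^ (d + 2))⁻¹ : ℝ)

theorem exists_bound_scaleKernel (κ : 𝓢(Pt d, ℂ)) (s : ℝ) :
    ∃ M : ℝ, ∀ z, ‖scaleKernel κ s z‖ ≤ M := by
  refine ⟨‖(s ^ (d + 2))⁻¹‖ * SchwartzMap.seminorm ℝ 0 0 κ, fun z => ?_⟩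
  rw [scaleKernel, norm_smul]
  gcongr
  exact κ.norm_le_seminorm ℝ _

theorem continuous_dyadicKernel (κ : 𝓢(Pt d, ℂ)) (r : ℝ) (n : ℕ) :
    Continuous (dyadicKernel κ r n) :=
  continuous_finsetSum _ fun _ _ => continuous_scaleKernel κ _

theorem integrable_dyadicKernel (κ : 𝓢(Pt d, ℂ)) {r : ℝ} (hr : 0 < r) (n : ℕ) :
    Integrable (dyadicKernel κ r n) :=
  integrable_finsetSum _ fun _ _ => integrable_scaleKernel κ (by positivity)

theorem exists_bound_dyadicKernel (κ : 𝓢(Pt d, ℂ)) (r : ℝ) (n : ℕ) :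
    ∃ M : ℝ, ∀ z, ‖dyadicKernel κ r n z‖ ≤ M := by
  choose M hM using exists_bound_scaleKernel κ
  exact ⟨∑ i ∈ Finset.range n, M (2 ^ i * r), fun z =>
    (norm_sum_le _ _).trans (Finset.sum_le_sum fun i _ => hM _ z)⟩

/-- The kernel at scale `s` tested at scale `r` is the unit kernel tested at scale `r / s`. -/
theorem scaleKernel_hormander {κ : 𝓢(Pt d, ℂ)} {C : ℝ}
    (hC : ∀ (ρ : ℝ) (w : Pt d), 0 < ρ → gauge w ≤ ρ →
      ∫⁻ z in {z | 2 * ρ ≤ gauge z}, ‖κ (z - w) - κ z‖ₑ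
        ≤ ENNReal.ofReal (C * (ρ / ((1 + ρ) * (1 + 2 * ρ))))) {s : ℝ} (hs : 0 < s) {r : ℝ}
    (hr : 0 < r) {w : Pt d} (hw : gauge w ≤ r) :
    ∫⁻ z in {z | 2 * r ≤ gauge z}, ‖scaleKernel κ s (z - w) - scaleKernel κ s z‖ₑ
      ≤ ENNReal.ofReal (C * (r / s / ((1 + r / s) * (1 + 2 * (r / s))))) := by
  have hm : ∀ a : ℝ, MeasurableSet {z : Pt d | a ≤ gauge z} := fun a =>
    measurableSet_le measurable_const continuous_gauge.measurable
  have h1 := hC (r / s) (dil s⁻¹ w) (by positivity) (by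
    rw [gauge_dil (by positivity), div_eq_inv_mul]; gcongr)
  refine le_trans (le_of_eq ?_) h1
  rw [← lintegral_indicator (hm _), ← lintegral_indicator (hm _)]
  have h2 := lintegral_comp_dil (d := d) (inv_pos.2 hs) ({z | 2 * (r / s) ≤ gauge z}.indicator
    fun z => ‖κ (z - dil s⁻¹ w) - κ z‖ₑ)
  have h3 : ENNReal.ofReal ((s⁻¹ ^ (d + 2))⁻¹) ≠ 0 := (ENNReal.ofReal_pos.2 (by positivity)).ne'
  rw [← ENNReal.mul_right_inj h3 ENNReal.ofReal_ne_top, ← h2,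
    ← lintegral_const_mul' _ _ ENNReal.ofReal_ne_top]
  refine lintegral_congr fun z => ?_
  have h4 : 2 * (r / s) ≤ gauge (dil s⁻¹ z) ↔ 2 * r ≤ gauge z := by
    rw [gauge_dil (by positivity), ← div_eq_inv_mul, ← mul_div_assoc,
      div_le_div_iff_of_pos_right hs]
  by_cases h5 : 2 * r ≤ gauge z
  · rw [Set.indicator_of_mem (by exact h5), Set.indicator_of_mem (by exact h4.2 h5)]
    rw [scaleKernel, scaleKernel, map_sub, ← smul_sub, enorm_smul,
      ← ofReal_norm ((s ^ (d + 2))⁻¹ : ℝ), Real.norm_of_nonneg (by positivity), ← mul_assoc,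
      ← ENNReal.ofReal_mul (by positivity), inv_pow, inv_inv, mul_inv_cancel₀ (by positivity),
      ENNReal.ofReal_one, one_mul]
  · rw [Set.indicator_of_notMem (by exact h5), mul_zero,
      Set.indicator_of_notMem (show dil s⁻¹ z ∉ {z | 2 * (r / s) ≤ gauge z} from
        fun h => h5 (h4.1 h))]

/-- The sum telescopes, because `a / ((1 + a) (1 + 2a)) = 2a / (1 + 2a) - a / (1 + a)`. -/
theorem sum_scale_le {x : ℝ} (hx : 0 < x) (n : ℕ) :
    ∑ i ∈ Finset.range n, x / 2 ^ i / ((1 + x / 2 ^ i) * (1 + 2 * (x / 2 ^ i))) ≤ 1 := by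
  have key : ∀ a : ℝ, 0 < a → a / ((1 + a) * (1 + 2 * a)) = 2 * a / (1 + 2 * a) - a / (1 + a) :=
    fun a ha => by field_simp; ring
  have h : ∀ n : ℕ, ∑ i ∈ Finset.range n, x / 2 ^ i / ((1 + x / 2 ^ i) * (1 + 2 * (x / 2 ^ i)))
      = 2 * x / (1 + 2 * x) - 2 * (x / 2 ^ n) / (1 + 2 * (x / 2 ^ n)) := fun n => by
    induction n with
    | zero => simp
    | succ n ih =>
      rw [Finset.sum_range_succ, ih, key _ (by positivity)]
      have : 2 * (x / 2 ^ (n + 1)) = x / 2 ^ n := by rw [pow_succ]; field_simp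
      rw [this]
      ring
  have h1 : 0 ≤ 2 * (x / 2 ^ n) / (1 + 2 * (x / 2 ^ n)) := by positivity
  have h2 : 2 * x / (1 + 2 * x) ≤ 1 := by
    rw [div_le_one (by positivity)]; linarith
  linarith [h n]

/-- Hörmander's condition holds uniformly in the range of scales. -/
theorem exists_hormander_dyadicKernel (κ : 𝓢(Pt d, ℂ)) :
    ∃ B : ℝ≥0, ∀ (r : ℝ) (n : ℕ), 0 < r → HormanderBound (dyadicKernel κ r n) B := by
  obtain ⟨C, hC0, hC⟩ := exists_unit_scale_bound κ
  refine ⟨C.toNNReal, fun r n hr ρ w hρ hw => ?_⟩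
  calc _ ≤ ∫⁻ z in {z | 2 * ρ ≤ gauge z}, ∑ i ∈ Finset.range n,
        ‖scaleKernel κ (2 ^ i * r) (z - w) - scaleKernel κ (2 ^ i * r) z‖ₑ := by
        refine lintegral_mono fun z => ?_
        rw [dyadicKernel, dyadicKernel, ← Finset.sum_sub_distrib]
        exact enorm_sum_le _ _
    _ = ∑ i ∈ Finset.range n, ∫⁻ z in {z | 2 * ρ ≤ gauge z},
        ‖scaleKernel κ (2 ^ i * r) (z - w) - scaleKernel κ (2 ^ i * r) z‖ₑ := by
        refine lintegral_finsetSum _ fun i _ => ?_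
        exact (((continuous_scaleKernel κ _).comp (continuous_id.sub continuous_const)).sub
          (continuous_scaleKernel κ _)).enorm.measurable
    _ ≤ ∑ i ∈ Finset.range n, ENNReal.ofReal (C * (ρ / r / 2 ^ i /
          ((1 + ρ / r / 2 ^ i) * (1 + 2 * (ρ / r / 2 ^ i))))) := by
        refine Finset.sum_le_sum fun i _ => ?_
        have := scaleKernel_hormander hC (s := 2 ^ i * r) (by positivity) hρ hw
        rwa [show ρ / (2 ^ i * r) = ρ / r / 2 ^ i by field_simp] at this
    _ = ENNReal.ofReal (C * ∑ i ∈ Finset.range n, ρ / r / 2 ^ i /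
          ((1 + ρ / r / 2 ^ i) * (1 + 2 * (ρ / r / 2 ^ i)))) := by
        rw [Finset.mul_sum, ENNReal.ofReal_sum_of_nonneg fun i _ => by positivity]
    _ ≤ ENNReal.ofReal C := by
        refine ENNReal.ofReal_le_ofReal ?_
        have := sum_scale_le (x := ρ / r) (by positivity) n
        nlinarith
    _ = _ := rfl

theorem integral_scaleKernel_mul (κ : 𝓢(Pt d, ℂ)) {s : ℝ} (hs : 0 < s) (φ : Pt d → ℂ) (z : Pt d) :
    ∫ w, scaleKernel κ s (z - w) * φ w = ∫ v, κ v * φ (z - dil s v) := by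
  rw [← integral_sub_left_eq_self (fun w => scaleKernel κ s (z - w) * φ w) volume z]
  have h := integral_comp_dil (d := d) (inv_pos.2 hs) fun v => κ v * φ (z - dil s v)
  simp only [dil_dil, mul_inv_cancel₀ hs.ne', dil_one, inv_pow, inv_inv] at h
  simp only [sub_sub_cancel, scaleKernel, smul_mul_assoc]
  rw [integral_smul, h, smul_smul, inv_mul_cancel₀ (by positivity), one_smul]

/-- Approximation of an `Lᵖ` function by Schwartz functions. -/
theorem exists_schwartz_seq {p : ℝ≥0∞} (hp1 : 1 ≤ p) (hp : p ≠ ∞) {g : Pt d → ℂ}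
    (hg : MemLp g p) :
    ∃ φ : ℕ → 𝓢(Pt d, ℂ), Tendsto (fun k => eLpNorm (fun z => φ k z - g z) p) atTop (𝓝 0) := by
  have : Fact (1 ≤ p) := ⟨hp1⟩
  have hd := SchwartzMap.denseRange_toLpCLM (E := Pt d) (F := ℂ) (μ := volume) hp
  obtain ⟨u, hu, hlim⟩ := mem_closure_iff_seq_limit.1 (hd (hg.toLp g))
  choose φ hφ using hu
  refine ⟨φ, ?_⟩
  have h1 := (tendsto_iff_edist_tendsto_0.1 hlim)
  refine h1.congr fun k => ?_
  rw [← hφ k, Lp.edist_def]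
  refine eLpNorm_congr_ae ?_
  filter_upwards [(φ k).coeFn_toLp p volume, hg.coeFn_toLp] with z h2 h3
  simp only [SchwartzMap.toLpCLM_apply, Pi.sub_apply]
  rw [h2, h3]

theorem lintegral_enorm_sq_eq (f : Pt d → ℂ) : ∫⁻ z, ‖f z‖ₑ ^ 2 = eLpNorm f 2 ^ 2 := by
  rw [eLpNorm_eq_lintegral_rpow_enorm_toReal (by norm_num) (by norm_num)]
  simp only [ENNReal.toReal_ofNat, ENNReal.rpow_ofNat, one_div]
  rw [← ENNReal.rpow_natCast, ← ENNReal.rpow_mul]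
  simp

theorem memLp_two_of_bound {K : Pt d → ℂ} (hK : Continuous K) (hKi : Integrable K) {M : ℝ}
    (hKM : ∀ z, ‖K z‖ ≤ M) : MemLp K 2 := by
  rw [memLp_two_iff_integrable_sq_norm hK.aestronglyMeasurable]
  refine (hKi.norm.const_mul M).mono' (hK.norm.pow 2).aestronglyMeasurable
    (Eventually.of_forall fun z => ?_)
  rw [Real.norm_of_nonneg (by positivity), sq]
  gcongr
  exact hKM z

theorem tendsto_convolution {K : Pt d → ℂ} (hK : MemLp K 2) {g : Pt d → ℂ} (hg : MemLp g 2)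
    {φ : ℕ → 𝓢(Pt d, ℂ)}
    (hφ : Tendsto (fun k => eLpNorm (fun z => φ k z - g z) 2) atTop (𝓝 0)) (z : Pt d) :
    Tendsto (fun k => ∫ w, K (z - w) * φ k w) atTop (𝓝 (∫ w, K (z - w) * g w)) := by
  have hKz : MemLp (fun w => K (z - w)) 2 :=
    hK.comp_measurePreserving (Measure.measurePreserving_sub_left volume z)
  have hprod : ∀ h : Pt d → ℂ, MemLp h 2 → Integrable fun w => K (z - w) * h w :=
    fun h hh => hKz.integrable_mul hh
  have hsub : ∀ k, MemLp (fun w => φ k w - g w) 2 := fun k => ((φ k).memLp 2 volume).sub hg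
  have hb : ∀ k, edist (∫ w, K (z - w) * φ k w) (∫ w, K (z - w) * g w)
      ≤ eLpNorm (fun w => K (z - w)) 2 * eLpNorm (fun w => φ k w - g w) 2 := fun k => by
    rw [edist_eq_enorm_sub, ← integral_sub (hprod _ ((φ k).memLp 2)) (hprod _ hg)]
    refine (enorm_integral_le_lintegral_enorm _).trans ?_
    have h1 : ∫⁻ w, ‖K (z - w) * φ k w - K (z - w) * g w‖ₑ
        = eLpNorm ((fun w => K (z - w)) • fun w => φ k w - g w) 1 := by
      rw [eLpNorm_one_eq_lintegral_enorm]
      refine lintegral_congr fun w => ?_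
      rw [← mul_sub]
      rfl
    rw [h1]
    exact eLpNorm_smul_le_mul_eLpNorm (p := 2) (q := 2) (r := 1) (hsub k).1 hKz.1
  rw [tendsto_iff_edist_tendsto_0]
  have h2 : Tendsto (fun k => eLpNorm (fun w => K (z - w)) 2 * eLpNorm (fun w => φ k w - g w) 2)
      atTop (𝓝 (eLpNorm (fun w => K (z - w)) 2 * 0)) :=
    ENNReal.Tendsto.const_mul hφ (Or.inr hKz.eLpNorm_ne_top)
  rw [mul_zero] at h2
  exact tendsto_of_tendsto_of_tendsto_of_le_of_le tendsto_const_nhds h2 (fun k => zero_le) hb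

theorem tendsto_eLpNorm {p : ℝ≥0∞} (hp : 1 ≤ p) {g : Pt d → ℂ} (hg : MemLp g p)
    {φ : ℕ → Pt d → ℂ} (hm : ∀ k, MemLp (φ k) p)
    (hφ : Tendsto (fun k => eLpNorm (fun z => φ k z - g z) p) atTop (𝓝 0)) :
    Tendsto (fun k => eLpNorm (φ k) p) atTop (𝓝 (eLpNorm g p)) := by
  have hsub : ∀ k, MemLp (fun z => φ k z - g z) p := fun k => (hm k).sub hg
  have hu : ∀ k, eLpNorm (φ k) p ≤ eLpNorm g p + eLpNorm (fun z => φ k z - g z) p := fun k => by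
    refine le_trans (le_of_eq (congrArg (eLpNorm · p volume) ?_))
      (eLpNorm_add_le hg.1 (hsub k).1 hp)
    ext z
    exact (add_sub_cancel (g z) (φ k z)).symm
  have hl : ∀ k, eLpNorm g p - eLpNorm (fun z => φ k z - g z) p ≤ eLpNorm (φ k) p := fun k => by
    rw [tsub_le_iff_right]
    refine le_trans (le_of_eq (congrArg (eLpNorm · p volume) ?_))
      (eLpNorm_sub_le (hm k).1 (hsub k).1 hp)
    ext z
    exact (sub_sub_cancel (φ k z) (g z)).symm
  have h1 : Tendsto (fun k => eLpNorm g p - eLpNorm (fun z => φ k z - g z) p) atTop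
      (𝓝 (eLpNorm g p - 0)) :=
    ENNReal.Tendsto.sub tendsto_const_nhds hφ (Or.inl hg.eLpNorm_ne_top)
  have h2 : Tendsto (fun k => eLpNorm g p + eLpNorm (fun z => φ k z - g z) p) atTop
      (𝓝 (eLpNorm g p + 0)) := tendsto_const_nhds.add hφ
  rw [tsub_zero] at h1
  rw [add_zero] at h2
  exact tendsto_of_tendsto_of_tendsto_of_le_of_le h1 h2 hl hu

theorem measurable_convolution {K φ : Pt d → ℂ} (hK : Continuous K) (hφ : Continuous φ) :
    Measurable fun z => ∫ w, K (z - w) * φ w := by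
  have : StronglyMeasurable (Function.uncurry fun z w : Pt d => K (z - w) * φ w) :=
    ((hK.comp (continuous_fst.sub continuous_snd)).mul
      (hφ.comp continuous_snd)).stronglyMeasurable
  exact this.integral_prod_right'.measurable

/-- An `L²` bound on Schwartz functions extends to all of `L²`. -/
theorem l2Bound_of_schwartz {K : Pt d → ℂ} (hK : Continuous K) (hKi : Integrable K) {M : ℝ}
    (hKM : ∀ z, ‖K z‖ ≤ M) {A : ℝ≥0}
    (hA : ∀ φ : 𝓢(Pt d, ℂ), ∫⁻ z, ‖∫ w, K (z - w) * φ w‖ₑ ^ 2 ≤ A ^ 2 * ∫⁻ z, ‖φ z‖ₑ ^ 2) :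
    L2Bound K A := by
  intro g hg
  obtain ⟨φ, hφ⟩ := exists_schwartz_seq (by norm_num) (by norm_num) hg
  have hpt := tendsto_convolution (memLp_two_of_bound hK hKi hKM) hg hφ
  have hlim2 := tendsto_eLpNorm (by norm_num) hg (fun k => (φ k).memLp 2) hφ
  calc ∫⁻ z, ‖∫ w, K (z - w) * g w‖ₑ ^ 2
      = ∫⁻ z, liminf (fun k => ‖∫ w, K (z - w) * φ k w‖ₑ ^ 2) atTop := by
        refine lintegral_congr fun z => (Tendsto.liminf_eq ?_).symm
        exact (ENNReal.continuous_pow 2).continuousAt.tendsto.comp (hpt z).enorm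
    _ ≤ liminf (fun k => ∫⁻ z, ‖∫ w, K (z - w) * φ k w‖ₑ ^ 2) atTop :=
        lintegral_liminf_le fun k =>
          (measurable_convolution hK (φ k).continuous).enorm.pow_const 2
    _ ≤ liminf (fun k => (A : ℝ≥0∞) ^ 2 * eLpNorm (φ k) 2 ^ 2) atTop := by
        refine liminf_le_liminf (Eventually.of_forall fun k => ?_)
        rw [← lintegral_enorm_sq_eq]
        exact hA (φ k)
    _ = (A : ℝ≥0∞) ^ 2 * eLpNorm g 2 ^ 2 := by
        refine Tendsto.liminf_eq (ENNReal.Tendsto.const_mul ?_ (Or.inr (by finiteness)))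
        exact (ENNReal.continuous_pow 2).continuousAt.tendsto.comp hlim2
    _ = _ := by rw [lintegral_enorm_sq_eq]

theorem HormanderBound.comp_neg {K : Pt d → ℂ} {B : ℝ≥0} (h : HormanderBound K B) :
    HormanderBound (fun z => K (-z)) B := by
  intro r w hr hw
  refine le_trans (le_of_eq ?_) (h r (-w) hr (by rwa [gauge_neg]))
  have h3 := (Measure.measurePreserving_neg
    (volume : Measure (Pt d))).setLIntegral_comp_preimage_emb
    (MeasurableEquiv.neg (Pt d)).measurableEmbedding (fun z => ‖K (z - -w) - K z‖ₑ)
    {z | 2 * r ≤ gauge z}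
  rw [← h3]
  have : (fun z : Pt d => -z) ⁻¹' {z | 2 * r ≤ gauge z} = {z | 2 * r ≤ gauge z} := by
    ext z; simp [gauge_neg]
  rw [show (Neg.neg : Pt d → Pt d) ⁻¹' {z | 2 * r ≤ gauge z} = {z | 2 * r ≤ gauge z} from this]
  refine lintegral_congr fun z => ?_
  change ‖K (-(z - w)) - K (-z)‖ₑ = _
  rw [show -(z - w) = -z - -w by abel]

theorem L2Bound.comp_neg {K : Pt d → ℂ} {A : ℝ≥0} (h : L2Bound K A) :
    L2Bound (fun z => K (-z)) A := by
  intro g hg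
  have hneg := Measure.measurePreserving_neg (volume : Measure (Pt d))
  have h1 := h (fun z => g (-z)) (hg.comp_measurePreserving hneg)
  have h2 : ∀ z, ∫ w, K (-(z - w)) * g w = ∫ w, K (-z - w) * g (-w) := fun z => by
    rw [← integral_neg_eq_self]
    congr 1
    ext w
    congr 2
    abel
  simp_rw [h2]
  have h3 := hneg.lintegral_comp_emb (MeasurableEquiv.neg (Pt d)).measurableEmbedding
    fun z => ‖∫ w, K (z - w) * g (-w)‖ₑ ^ 2
  have h4 := hneg.lintegral_comp_emb (MeasurableEquiv.neg (Pt d)).measurableEmbedding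
    fun z => ‖g z‖ₑ ^ 2
  rw [h3, ← h4]
  exact h1

end Parabolic

end

/-! ### Multipliers homogeneous of degree zero -/

noncomputable section

namespace Parabolic

open Filter Topology

variable {d : ℕ}

/-- The part of the symbol `m` at frequencies between the scales `(2ⁿr)⁻¹` and `r⁻¹`. -/
def dyadicSymbol (m : Pt d → ℝ) (r : ℝ) (n : ℕ) (ζ : Pt d) : ℝ :=
  m ζ * (chi (dil r ζ) - chi (dil (2 ^ n * r) ζ))

theorem abs_dyadicSymbol_le (m : Pt d → ℝ) (r : ℝ) (n : ℕ) (ζ : Pt d) :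
    |dyadicSymbol m r n ζ| ≤ |m ζ| := by
  rw [dyadicSymbol, abs_mul]
  exact mul_le_of_le_one_right (abs_nonneg _) (abs_chi_sub_chi_le _ _)

theorem HomSymbol.measurable_dyadicSymbol {m : Pt d → ℝ} (h : HomSymbol 0 m) (r : ℝ) (n : ℕ) :
    Measurable (dyadicSymbol m r n) :=
  h.measurable.mul ((chi_contDiff.continuous.comp (dil r).continuous).sub
    (chi_contDiff.continuous.comp (dil _).continuous)).measurable

theorem HomSymbol.hasTemperateGrowth_dyadicSymbol {m : Pt d → ℝ} (h : HomSymbol 0 m) {r : ℝ}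
    (hr : 0 < r) (n : ℕ) : Function.HasTemperateGrowth (dyadicSymbol m r n) := by
  have h1 := (h.hasTemperateGrowth_cut (r := 2 ^ n * r) (by positivity)).sub
    (h.hasTemperateGrowth_cut hr)
  convert h1 using 1
  ext ζ
  simp only [dyadicSymbol, Pi.sub_apply]
  ring

/-- Convolution with the dyadic kernel is the multiplier operator of the dyadic symbol. -/
theorem integral_dyadicKernel_mul {m : Pt d → ℝ} (h : HomSymbol 0 m) {θ : 𝓢(Pt d, ℂ)}
    (hθ : ∀ z, θ z = ((m z * psi z : ℝ) : ℂ)) {r : ℝ} (hr : 0 < r) (n : ℕ) (φ : 𝓢(Pt d, ℂ))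
    (z : Pt d) :
    ∫ w, dyadicKernel (𝓕⁻ θ) r n (z - w) * φ w = fourierMul (dyadicSymbol m r n) φ z := by
  have hpos : ∀ i : ℕ, 0 < 2 ^ i * r := fun i => by positivity
  have hint : ∀ i : ℕ, Integrable fun w => scaleKernel (𝓕⁻ θ) (2 ^ i * r) (z - w) * φ w :=
    fun i => by
      obtain ⟨M, hM⟩ := exists_bound_scaleKernel (𝓕⁻ θ : 𝓢(Pt d, ℂ)) (2 ^ i * r)
      exact φ.integrable.bdd_mul ((continuous_scaleKernel _ _).comp
        (continuous_const.sub continuous_id)).aestronglyMeasurable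
        (Eventually.of_forall fun w => hM (z - w))
  have h1 : ∀ i : ℕ, ∫ w, scaleKernel (𝓕⁻ θ) (2 ^ i * r) (z - w) * φ w
      = ∫ ζ, 𝐞 (inner ℝ ζ z) • (((m ζ * psi (dil (2 ^ i * r) ζ) : ℝ) : ℂ) *
        (𝓕 φ : 𝓢(Pt d, ℂ)) ζ) := fun i => by
    rw [integral_scaleKernel_mul _ (hpos i), ← fourierMul_eq_integral_kernel θ (dil (2 ^ i * r))
      (dil (2 ^ i * r)) (fun ζ v => inner_dil _ _ _)
      (m := fun ζ => m ζ * psi (dil (2 ^ i * r) ζ)) (fun ζ => ?_), fourierMul_apply]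
    rw [hθ, h.hom _ (hpos i), zpow_zero, one_mul]
  obtain ⟨B, hB0, hB⟩ := h.exists_bound_zero
  have hint2 : ∀ i : ℕ, Integrable fun ζ => 𝐞 (inner ℝ ζ z) •
      (((m ζ * psi (dil (2 ^ i * r) ζ) : ℝ) : ℂ) * (𝓕 φ : 𝓢(Pt d, ℂ)) ζ) := fun i => by
    refine integrable_char_smul z (integrable_mul_fourier (B := B) (k := 0) ?_ (fun ζ => ?_) φ)
    · exact h.measurable.mul (psi_contDiff.continuous.comp (dil _).continuous).measurable
    · rw [abs_mul, pow_zero]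
      gcongr
      · exact hB ζ
      · exact abs_chi_sub_chi_le _ _
  calc ∫ w, dyadicKernel (𝓕⁻ θ) r n (z - w) * φ w
      = ∑ i ∈ Finset.range n, ∫ w, scaleKernel (𝓕⁻ θ) (2 ^ i * r) (z - w) * φ w := by
        simp only [dyadicKernel, Finset.sum_mul]
        exact integral_finsetSum _ fun i _ => hint i
    _ = ∫ ζ, ∑ i ∈ Finset.range n, 𝐞 (inner ℝ ζ z) •
        (((m ζ * psi (dil (2 ^ i * r) ζ) : ℝ) : ℂ) * (𝓕 φ : 𝓢(Pt d, ℂ)) ζ) := by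
        rw [integral_finsetSum _ fun i _ => hint2 i]
        exact Finset.sum_congr rfl fun i _ => h1 i
    _ = fourierMul (dyadicSymbol m r n) φ z := by
        rw [fourierMul_apply]
        refine integral_congr_ae (Eventually.of_forall fun ζ => ?_)
        simp only [dyadicSymbol]
        rw [← sum_psi, Finset.mul_sum, ← Finset.smul_sum, Complex.ofReal_sum, Finset.sum_mul]

theorem lintegral_enorm_sq_fourier (φ : 𝓢(Pt d, ℂ)) :
    ∫⁻ z, ‖(𝓕 φ : 𝓢(Pt d, ℂ)) z‖ₑ ^ 2 = ∫⁻ z, ‖φ z‖ₑ ^ 2 := by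
  have h : ∀ ψ : 𝓢(Pt d, ℂ), ∫⁻ z, ‖ψ z‖ₑ ^ 2 = ENNReal.ofReal (∫ z, ‖ψ z‖ ^ 2) := fun ψ => by
    rw [ofReal_integral_eq_lintegral_ofReal (μ := volume) (f := fun z => ‖ψ z‖ ^ 2)
      ((memLp_two_iff_integrable_sq_norm ψ.continuous.aestronglyMeasurable).1 (ψ.memLp 2))
      (Eventually.of_forall fun z => by positivity)]
    refine lintegral_congr fun z => ?_
    rw [ENNReal.ofReal_pow (norm_nonneg _), ofReal_norm]
  rw [h, h]
  congr 1
  exact SchwartzMap.integral_norm_sq_fourier φ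

/-- By Plancherel's theorem the truncated kernels are bounded on `L²` uniformly. -/
theorem l2Bound_dyadicKernel {m : Pt d → ℝ} (h : HomSymbol 0 m) {θ : 𝓢(Pt d, ℂ)}
    (hθ : ∀ z, θ z = ((m z * psi z : ℝ) : ℂ)) {A : ℝ≥0} (hA : ∀ ζ, |m ζ| ≤ A) {r : ℝ}
    (hr : 0 < r) (n : ℕ) : L2Bound (dyadicKernel (𝓕⁻ θ) r n) A := by
  obtain ⟨M, hM⟩ := exists_bound_dyadicKernel (𝓕⁻ θ : 𝓢(Pt d, ℂ)) r n
  refine l2Bound_of_schwartz (continuous_dyadicKernel _ r n) (integrable_dyadicKernel _ hr n) hM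
    fun φ => ?_
  obtain ⟨Φ, hΦ⟩ := exists_fourier_eq_mul (h.hasTemperateGrowth_dyadicSymbol hr n) φ
  simp_rw [integral_dyadicKernel_mul h hθ hr n φ, ← coe_eq_fourierMul hΦ]
  rw [← lintegral_enorm_sq_fourier Φ, ← lintegral_enorm_sq_fourier φ,
    ← lintegral_const_mul' _ _ (by finiteness)]
  refine lintegral_mono fun ζ => ?_
  rw [hΦ, enorm_mul, mul_pow]
  gcongr
  rw [← ofReal_norm, Complex.norm_real, Real.norm_eq_abs, ← ENNReal.ofReal_coe_nnreal]
  exact ENNReal.ofReal_le_ofReal ((abs_dyadicSymbol_le m r n ζ).trans (hA ζ))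

end Parabolic

end

/-! ### The multiplier theorem -/

noncomputable section

namespace Parabolic

open Filter Topology

variable {d : ℕ}

theorem one_lt_toReal {q : ℝ≥0∞} (hq1 : 1 < q) (hq : q < ∞) : 1 < q.toReal := by
  rw [← ENNReal.toReal_one]
  exact (ENNReal.toReal_lt_toReal ENNReal.one_ne_top hq.ne).2 hq1

/-- The function `|F|^{p-2} F̄`, which is dual to `F` in `Lᵖ`; it is continuous for `p > 2`. -/
def dualFun (p : ℝ) (F : Pt d → ℂ) (z : Pt d) : ℂ := ((‖F z‖ ^ (p - 2) : ℝ) : ℂ) * star (F z)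

theorem mul_dualFun {p : ℝ} (hp : 2 < p) (F : Pt d → ℂ) (z : Pt d) :
    F z * dualFun p F z = ((‖F z‖ ^ p : ℝ) : ℂ) := by
  rw [dualFun, mul_left_comm, Complex.star_def, Complex.mul_conj, Complex.normSq_eq_norm_sq,
    ← Complex.ofReal_mul]
  congr 1
  rw [← Real.rpow_natCast, ← Real.rpow_add_of_nonneg (norm_nonneg _) (by linarith) (by norm_num)]
  norm_num

theorem norm_dualFun {p : ℝ} (hp : 2 < p) (F : Pt d → ℂ) (z : Pt d) :
    ‖dualFun p F z‖ = ‖F z‖ ^ (p - 1) := by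
  rw [dualFun, norm_mul, Complex.norm_real, norm_star, Real.norm_of_nonneg (by positivity)]
  nth_rw 2 [← Real.rpow_one ‖F z‖]
  rw [← Real.rpow_add_of_nonneg (norm_nonneg _) (by linarith) (by norm_num)]
  congr 1
  ring

theorem continuous_dualFun {p : ℝ} (hp : 2 < p) {F : Pt d → ℂ} (hF : Continuous F) :
    Continuous (dualFun p F) :=
  (Complex.continuous_ofReal.comp (hF.norm.rpow_const fun _ => Or.inr (by linarith))).mul hF.star

theorem integrable_dualFun {p : ℝ} (hp : 2 < p) (F : 𝓢(Pt d, ℂ)) : Integrable (dualFun p F) := by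
  refine (F.integrable.norm.const_mul ((SchwartzMap.seminorm ℝ 0 0 F) ^ (p - 2))).mono'
    (continuous_dualFun hp F.continuous).aestronglyMeasurable (Eventually.of_forall fun z => ?_)
  rw [dualFun, norm_mul, Complex.norm_real, norm_star, Real.norm_of_nonneg (by positivity)]
  gcongr
  exact F.norm_le_seminorm ℝ z

/-- Duality: a bound for the transposed convolution on `L^q`, `q = p / (p - 1) < 2`, gives a bound
on `Lᵖ`. -/
theorem lintegral_rpow_le_of_dual {K : Pt d → ℂ} (hK : Continuous K) {M : ℝ}
    (hKM : ∀ z, ‖K z‖ ≤ M) {p q : ℝ} (hpq : p.HolderConjugate q) (hp : 2 < p) {D : ℝ≥0∞}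
    (hD : ∀ h : Pt d → ℂ, Continuous h → Integrable h →
      ∫⁻ z, ‖∫ w, K (-(z - w)) * h w‖ₑ ^ q ≤ D * ∫⁻ z, ‖h z‖ₑ ^ q)
    {φ F : 𝓢(Pt d, ℂ)} (hF : ∀ z, ∫ w, K (z - w) * φ w = F z) :
    ∫⁻ z, ‖F z‖ₑ ^ p ≤ D ^ (p / q) * ∫⁻ z, ‖φ z‖ₑ ^ p := by
  set h := dualFun p F with hh
  have hp0 : 0 < p := by linarith
  have hq0 : 0 < q := hpq.symm.pos
  have hhc : Continuous h := continuous_dualFun hp F.continuous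
  have hhi : Integrable h := integrable_dualFun hp F
  set X := ∫⁻ z, ‖F z‖ₑ ^ p with hX
  have hpow : ∀ z, ‖F z‖ₑ ^ p = ENNReal.ofReal (‖F z‖ ^ p) := fun z => by
    rw [← ofReal_norm, ENNReal.ofReal_rpow_of_nonneg (norm_nonneg _) hp0.le]
  have hFint : Integrable fun z => ‖F z‖ ^ p := by
    have h0 : MemLp F (ENNReal.ofReal p) volume := F.memLp _ _
    have h1 := h0.integrable_norm_rpow (by simpa using hp0) ENNReal.ofReal_ne_top
    rwa [ENNReal.toReal_ofReal hp0.le] at h1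
  have hXeq : X = ENNReal.ofReal (∫ z, ‖F z‖ ^ p) := by
    rw [ofReal_integral_eq_lintegral_ofReal hFint (Eventually.of_forall fun z => by positivity)]
    exact lintegral_congr hpow
  have hXtop : X ≠ ∞ := by rw [hXeq]; exact ENNReal.ofReal_ne_top
  have hhX : ∫⁻ z, ‖h z‖ₑ ^ q = X := by
    refine lintegral_congr fun z => ?_
    rw [← ofReal_norm, norm_dualFun hp, hpow, ENNReal.ofReal_rpow_of_nonneg (by positivity) hq0.le,
      ← Real.rpow_mul (norm_nonneg _), hpq.sub_one_mul_conj]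
  have hprod : Integrable (fun x : Pt d × Pt d => K (x.1 - x.2) * φ x.2 * h x.1)
      (volume.prod volume) := by
    have hφi : Integrable φ := φ.integrable
    have h1 := (hhi.mul_prod hφi).norm.const_mul M
    refine h1.mono' ?_ (Eventually.of_forall fun x => ?_)
    · exact (((hK.comp (continuous_fst.sub continuous_snd)).mul
        (φ.continuous.comp continuous_snd)).mul (hhc.comp continuous_fst)).aestronglyMeasurable
    · rw [mul_assoc, norm_mul, mul_comm (φ x.2)]
      gcongr
      exact hKM _
  have hswap : ∫ z, F z * h z = ∫ w, φ w * ∫ z, K (-(w - z)) * h z := by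
    calc ∫ z, F z * h z = ∫ z, ∫ w, K (z - w) * φ w * h z := by
          refine integral_congr_ae (Eventually.of_forall fun z => ?_)
          simp only [← hF, integral_mul_const]
      _ = ∫ w, ∫ z, K (z - w) * φ w * h z := integral_integral_swap hprod
      _ = _ := by
          refine integral_congr_ae (Eventually.of_forall fun w => ?_)
          simp only [← integral_const_mul, neg_sub]
          refine integral_congr_ae (Eventually.of_forall fun z => ?_)
          simp only
          ring
  have hXle : X ≤ (∫⁻ z, ‖φ z‖ₑ ^ p) ^ (1 / p) * (D * X) ^ (1 / q) := by
    calc X = ‖∫ z, F z * h z‖ₑ := by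
          simp only [hh, mul_dualFun hp]
          rw [integral_complex_ofReal, ← ofReal_norm, Complex.norm_real, hXeq,
            Real.norm_of_nonneg (integral_nonneg fun z => by positivity)]
      _ ≤ ∫⁻ w, ‖φ w * ∫ z, K (-(w - z)) * h z‖ₑ := by
          rw [hswap]; exact enorm_integral_le_lintegral_enorm _
      _ = ∫⁻ w, ((fun w => ‖φ w‖ₑ) * fun w => ‖∫ z, K (-(w - z)) * h z‖ₑ) w :=
          lintegral_congr fun w => by rw [enorm_mul, Pi.mul_apply]
      _ ≤ _ := ENNReal.lintegral_mul_le_Lp_mul_Lq volume hpq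
          φ.continuous.enorm.measurable.aemeasurable
          (measurable_convolution (K := fun z => K (-z)) (hK.comp continuous_neg)
            hhc).enorm.aemeasurable
      _ ≤ _ := by
          gcongr
          refine (hD h hhc hhi).trans_eq ?_
          rw [hhX]
  -- a factor `X ^ (1 / q)` is cancelled, for which `X` has to be finite and nonzero
  rcases eq_or_ne X 0 with h0 | h0
  · rw [h0]; exact zero_le
  have h1 : X ^ (1 / p) * X ^ (1 / q)
      ≤ (∫⁻ z, ‖φ z‖ₑ ^ p) ^ (1 / p) * D ^ (1 / q) * X ^ (1 / q) := by
    rw [← ENNReal.rpow_add _ _ h0 hXtop, one_div, one_div, hpq.inv_add_inv_eq_one,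
      ENNReal.rpow_one, mul_assoc, ← ENNReal.mul_rpow_of_nonneg _ _ (by positivity)]
    simpa only [one_div] using hXle
  have h2 : X ^ (1 / q) ≠ 0 := by
    simp [h0, hXtop]
  have h3 : X ^ (1 / q) ≠ ∞ := ENNReal.rpow_ne_top_of_nonneg (by positivity) hXtop
  have h4 := (ENNReal.mul_le_mul_iff_left h2 h3).1 h1
  calc X = (X ^ (1 / p)) ^ p := by
        rw [← ENNReal.rpow_mul, one_div, inv_mul_cancel₀ hp0.ne', ENNReal.rpow_one]
    _ ≤ ((∫⁻ z, ‖φ z‖ₑ ^ p) ^ (1 / p) * D ^ (1 / q)) ^ p := by gcongr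
    _ = _ := by
        rw [ENNReal.mul_rpow_of_nonneg _ _ hp0.le, ← ENNReal.rpow_mul, ← ENNReal.rpow_mul, one_div,
          inv_mul_cancel₀ hp0.ne', ENNReal.rpow_one, mul_comm]
        congr 2
        field_simp

/-- The multiplier operator of `m` is bounded on `Lᵖ` by `C`. -/
def LpMul (m : Pt d → ℝ) (p : ℝ≥0∞) (C : ℝ≥0) : Prop :=
  ∀ φ : 𝓢(Pt d, ℂ), eLpNorm (fourierMul m φ) p ≤ C * eLpNorm φ p

/-- The truncations of a symbol are bounded on `Lᵖ` uniformly: by Calderón–Zygmund theory for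
`p < 2`, by Plancherel's theorem for `p = 2`, by duality for `p > 2`. -/
theorem exists_uniform_bound {m : Pt d → ℝ} (h : HomSymbol 0 m) {p : ℝ} (hp : 1 < p) :
    ∃ D : ℝ≥0∞, D ≠ ∞ ∧ ∀ (r : ℝ) (n : ℕ) (φ : 𝓢(Pt d, ℂ)), 0 < r →
      ∫⁻ z, ‖fourierMul (dyadicSymbol m r n) φ z‖ₑ ^ p ≤ D * ∫⁻ z, ‖φ z‖ₑ ^ p := by
  obtain ⟨θ, hθ⟩ := h.exists_piece
  obtain ⟨A', hA0, hA'⟩ := h.exists_bound_zero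
  lift A' to ℝ≥0 using hA0 with A
  obtain ⟨B, hB⟩ := exists_hormander_dyadicKernel (𝓕⁻ θ : 𝓢(Pt d, ℂ))
  have hL := fun {r : ℝ} (hr : 0 < r) n => l2Bound_dyadicKernel h hθ hA' hr n
  rcases lt_trichotomy p 2 with hp2 | rfl | hp2
  · refine ⟨strongConst d A B p, strongConst_ne_top d A B p, fun r n φ hr => ?_⟩
    simp_rw [← integral_dyadicKernel_mul h hθ hr n φ]
    obtain ⟨M, hM⟩ := exists_bound_dyadicKernel (𝓕⁻ θ : 𝓢(Pt d, ℂ)) r n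
    exact strong_type_estimate (continuous_dyadicKernel _ r n) hM (hL hr n) (hB r n hr)
      φ.continuous φ.integrable hp hp2
  · refine ⟨A ^ 2, by finiteness, fun r n φ hr => ?_⟩
    simp_rw [← integral_dyadicKernel_mul h hθ hr n φ]
    have := hL hr n φ (φ.memLp 2)
    exact_mod_cast this
  · set q := p.conjExponent with hq
    have hpq : p.HolderConjugate q := Real.HolderConjugate.conjExponent hp
    have hq1 : 1 < q := hpq.symm.lt
    have hq2 : q < 2 := by
      rw [hq, Real.conjExponent, div_lt_iff₀ (by linarith)]; linarith
    refine ⟨strongConst d A B q ^ (p / q), ?_, fun r n φ hr => ?_⟩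
    · exact ENNReal.rpow_ne_top_of_nonneg (by positivity) (strongConst_ne_top d A B q)
    obtain ⟨Φ, hΦ⟩ := exists_fourier_eq_mul (h.hasTemperateGrowth_dyadicSymbol hr n) φ
    obtain ⟨M, hM⟩ := exists_bound_dyadicKernel (𝓕⁻ θ : 𝓢(Pt d, ℂ)) r n
    have hc := continuous_dyadicKernel (𝓕⁻ θ : 𝓢(Pt d, ℂ)) r n
    rw [← coe_eq_fourierMul hΦ]
    refine lintegral_rpow_le_of_dual hc hM hpq hp2 (fun g hg hgi => ?_) fun z => ?_
    · exact strong_type_estimate (K := fun z => dyadicKernel (𝓕⁻ θ) r n (-z))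
        (hc.comp continuous_neg) (fun z => hM (-z)) (hL hr n).comp_neg (hB r n hr).comp_neg
        hg hgi hq1 hq2
    · rw [integral_dyadicKernel_mul h hθ hr n φ, coe_eq_fourierMul hΦ]

theorem tendsto_dyadicSymbol (m : Pt d → ℝ) {ζ : Pt d} (hζ : ζ ≠ 0) :
    Tendsto (fun N : ℕ => dyadicSymbol m (2 ^ N)⁻¹ (2 * N) ζ) atTop (𝓝 (m ζ)) := by
  have h1 := tendsto_chi_dil hζ one_pos
  have h2 : Tendsto (fun N : ℕ => ((2 : ℝ) ^ N)⁻¹ * ‖ζ‖) atTop (𝓝 (0 * ‖ζ‖)) :=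
    ((tendsto_pow_atTop_atTop_of_one_lt one_lt_two).inv_tendsto_atTop).mul_const _
  rw [zero_mul] at h2
  refine tendsto_const_nhds.congr' ?_
  filter_upwards [h1, h2.eventually_le_const one_pos] with N h3 h4
  have h5 : chi (dil ((2 : ℝ) ^ N)⁻¹ ζ) = 1 := chi_eq_one
    ((norm_dil_le_of_le_one (by positivity) (inv_le_one_of_one_le₀ (one_le_pow₀ one_le_two))
      ζ).trans h4)
  have h6 : (2 : ℝ) ^ (2 * N) * (2 ^ N)⁻¹ = 2 ^ N * 1 := by
    rw [two_mul, pow_add]; field_simp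
  rw [dyadicSymbol, h5, h6, h3, sub_zero, mul_one]

/-- Smooth symbols homogeneous of degree zero for the parabolic dilations are `Lᵖ` multipliers. -/
theorem HomSymbol.exists_lpMul {m : Pt d → ℝ} (h : HomSymbol 0 m) {p : ℝ≥0∞} (hp1 : 1 < p)
    (hp : p < ∞) : ∃ C : ℝ≥0, LpMul m p C := by
  have hpr := one_lt_toReal hp1 hp
  have hp0 : 0 < p.toReal := by linarith
  obtain ⟨D, hD, hDb⟩ := exists_uniform_bound h hpr
  obtain ⟨B, hB0, hB⟩ := h.exists_bound_zero
  have hDtop : D ^ (1 / p.toReal) ≠ ∞ := ENNReal.rpow_ne_top_of_nonneg (by positivity) hD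
  refine ⟨(D ^ (1 / p.toReal)).toNNReal, fun φ => ?_⟩
  rw [ENNReal.coe_toNNReal hDtop,
    eLpNorm_eq_lintegral_rpow_enorm_toReal (by positivity) hp.ne,
    eLpNorm_eq_lintegral_rpow_enorm_toReal (by positivity) hp.ne,
    ← ENNReal.mul_rpow_of_nonneg _ _ (by positivity)]
  gcongr
  have hint : Integrable fun ζ => (m ζ : ℂ) * (𝓕 φ : 𝓢(Pt d, ℂ)) ζ :=
    integrable_mul_fourier h.measurable (B := B) (k := 0) (by simpa using hB) φ
  have hpt : ∀ z, Tendsto (fun N : ℕ => fourierMul (dyadicSymbol m (2 ^ N)⁻¹ (2 * N)) φ z) atTop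
      (𝓝 (fourierMul m φ z)) := fun z => by
    simp only [fourierMul_apply]
    refine tendsto_integral_of_dominated_convergence
      (fun ζ => ‖(m ζ : ℂ) * (𝓕 φ : 𝓢(Pt d, ℂ)) ζ‖) (fun N => ?_) hint.norm
      (fun N => Eventually.of_forall fun ζ => ?_) ?_
    · refine (integrable_char_smul z (integrable_mul_fourier (B := B) (k := 0)
        (h.measurable_dyadicSymbol _ _) (fun ζ => ?_) φ)).aestronglyMeasurable
      rw [pow_zero, mul_one]
      exact (abs_dyadicSymbol_le _ _ _ _).trans (hB ζ)
    · rw [Circle.norm_smul, norm_mul, norm_mul, Complex.norm_real, Complex.norm_real]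
      gcongr
      exact abs_dyadicSymbol_le _ _ _ _
    · filter_upwards [Measure.ae_ne volume (0 : Pt d)] with ζ hζ
      have h1 := tendsto_dyadicSymbol m hζ
      exact (((Complex.continuous_ofReal.tendsto _).comp h1).mul_const _).const_smul _
  -- Fatou's lemma
  calc ∫⁻ z, ‖fourierMul m φ z‖ₑ ^ p.toReal
      = ∫⁻ z, liminf (fun N : ℕ =>
          ‖fourierMul (dyadicSymbol m (2 ^ N)⁻¹ (2 * N)) φ z‖ₑ ^ p.toReal) atTop := by
        refine lintegral_congr fun z => (Tendsto.liminf_eq ?_).symm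
        exact ENNReal.continuous_rpow_const.continuousAt.tendsto.comp (hpt z).enorm
    _ ≤ liminf (fun N : ℕ => ∫⁻ z,
          ‖fourierMul (dyadicSymbol m (2 ^ N)⁻¹ (2 * N)) φ z‖ₑ ^ p.toReal) atTop := by
        refine lintegral_liminf_le fun N => ?_
        obtain ⟨Φ, hΦ⟩ := exists_fourier_eq_mul
          (h.hasTemperateGrowth_dyadicSymbol (r := ((2 : ℝ) ^ N)⁻¹) (by positivity) (2 * N)) φ
        rw [← coe_eq_fourierMul hΦ]
        exact Φ.continuous.enorm.measurable.pow_const _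
    _ ≤ liminf (fun _ : ℕ => D * ∫⁻ z, ‖φ z‖ₑ ^ p.toReal) atTop :=
        liminf_le_liminf (Eventually.of_forall fun N => hDb _ _ φ (by positivity))
    _ = _ := liminf_const _

end Parabolic

end

/-! ### Averages of multipliers -/

noncomputable section

namespace Parabolic

open Filter Topology

variable {d : ℕ}

/-- The function `φ(c · )`. -/
def rescale (c : ℝ) (hc : c ≠ 0) (φ : 𝓢(Pt d, ℂ)) : 𝓢(Pt d, ℂ) :=
  SchwartzMap.compCLMOfContinuousLinearEquiv ℂ
    (ContinuousLinearEquiv.smulLeft (R₁ := ℝ) (M₁ := Pt d) (Units.mk0 c hc)) φ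

theorem rescale_apply {c : ℝ} (hc : c ≠ 0) (φ : 𝓢(Pt d, ℂ)) (z : Pt d) :
    rescale c hc φ z = φ (c • z) := rfl

theorem fourier_rescale {c : ℝ} (hc : 0 < c) (φ : 𝓢(Pt d, ℂ)) (ζ : Pt d) :
    (𝓕 (rescale c hc.ne' φ) : 𝓢(Pt d, ℂ)) (c • ζ)
      = (((c ^ (d + 1))⁻¹ : ℝ) : ℂ) * (𝓕 φ : 𝓢(Pt d, ℂ)) ζ := by
  rw [SchwartzMap.fourier_coe, SchwartzMap.fourier_coe, Real.fourier_eq, Real.fourier_eq]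
  have h := Measure.integral_comp_smul (μ := (volume : Measure (Pt d)))
    (fun v => 𝐞 (-inner ℝ v ζ) • φ v) c
  rw [finrank_euclideanSpace_fin, abs_of_pos (by positivity), Complex.real_smul] at h
  rw [← h]
  refine integral_congr_ae (Eventually.of_forall fun v => ?_)
  simp only [rescale_apply, inner_smul_left, inner_smul_right]
  rfl

theorem fourierMul_rescale {c : ℝ} (hc : 0 < c) (m : Pt d → ℝ) (φ : 𝓢(Pt d, ℂ)) (z : Pt d) :
    fourierMul m (rescale c hc.ne' φ) z = fourierMul (fun ζ => m (c • ζ)) φ (c • z) := by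
  rw [fourierMul_apply, fourierMul_apply]
  have h := Measure.integral_comp_smul (μ := (volume : Measure (Pt d)))
    (fun ζ => 𝐞 (inner ℝ ζ z) • ((m ζ : ℂ) * (𝓕 (rescale c hc.ne' φ) : 𝓢(Pt d, ℂ)) ζ)) c
  rw [finrank_euclideanSpace_fin, abs_of_pos (by positivity),
    eq_inv_smul_iff₀ (pow_pos hc _).ne'] at h
  rw [← h, ← integral_smul]
  refine integral_congr_ae (Eventually.of_forall fun ζ => ?_)
  simp only [inner_smul_left, inner_smul_right]
  rw [smul_comm]
  congr 1
  rw [Complex.real_smul, mul_left_comm, fourier_rescale hc, ← mul_assoc ((c ^ (d + 1) : ℝ) : ℂ),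
    ← Complex.ofReal_mul, mul_inv_cancel₀ (by positivity), Complex.ofReal_one, one_mul]

theorem eLpNorm_comp_smul {c : ℝ} (hc : 0 < c) (f : Pt d → ℂ) {p : ℝ≥0∞} (hp : p ≠ ∞) :
    eLpNorm (fun z => f (c • z)) p
      = ENNReal.ofReal ((c ^ (d + 1))⁻¹) ^ (1 / p).toReal * eLpNorm f p := by
  have he : MeasurableEmbedding fun z : Pt d => c • z :=
    (Homeomorph.smulOfNeZero c hc.ne').measurableEmbedding
  have h1 := he.eLpNorm_map_measure (g := f) (p := p) (μ := volume)
  rw [Measure.map_addHaar_smul _ hc.ne', eLpNorm_smul_measure_of_ne_top hp,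
    finrank_euclideanSpace_fin, abs_of_pos (by positivity)] at h1
  exact h1.symm

/-- Bounds for multipliers are invariant under isotropic dilations of the symbol. -/
theorem LpMul.comp_smul {m : Pt d → ℝ} {p : ℝ≥0∞} {C : ℝ≥0} (hp : p ≠ ∞) (h : LpMul m p C)
    {c : ℝ} (hc : 0 < c) : LpMul (fun ζ => m (c • ζ)) p C := by
  intro φ
  have h1 := h (rescale c hc.ne' φ)
  have h2 := eLpNorm_comp_smul hc (fourierMul (fun ζ => m (c • ζ)) φ) hp
  have h3 := eLpNorm_comp_smul hc φ hp
  simp only [← fourierMul_rescale hc] at h2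
  have h4 : eLpNorm (fourierMul m (rescale c hc.ne' φ)) p
      ≤ C * eLpNorm (fun z => φ (c • z)) p := h1
  rw [h2, h3, mul_left_comm] at h4
  refine (ENNReal.mul_le_mul_iff_right ?_ ?_).1 h4
  · exact (ENNReal.rpow_pos (ENNReal.ofReal_pos.2 (by positivity)) ENNReal.ofReal_ne_top).ne'
  · exact ENNReal.rpow_ne_top_of_nonneg (by positivity) ENNReal.ofReal_ne_top

theorem stronglyMeasurable_fourierMul {m : ℝ → Pt d → ℝ}
    (hm : Measurable (Function.uncurry m)) (φ : 𝓢(Pt d, ℂ)) :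
    StronglyMeasurable (Function.uncurry fun s => fourierMul (m s) φ) := by
  have h1 : StronglyMeasurable (Function.uncurry fun (x : ℝ × Pt d) (ζ : Pt d) =>
      (𝐞 (inner ℝ ζ x.2) : ℂ) * ((m x.1 ζ : ℂ) * (𝓕 φ : 𝓢(Pt d, ℂ)) ζ)) := by
    have h2 : Continuous fun y : (ℝ × Pt d) × Pt d => (𝐞 (inner ℝ y.2 y.1.2) : ℂ) :=
      continuous_subtype_val.comp (Real.continuous_fourierChar.comp (by fun_prop))
    have h3 : Measurable fun y : (ℝ × Pt d) × Pt d => m y.1.1 y.2 :=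
      hm.comp ((measurable_fst.comp measurable_fst).prodMk measurable_snd)
    exact h2.stronglyMeasurable.mul
      (Measurable.stronglyMeasurable (Complex.measurable_ofReal.comp h3) |>.mul
      ((𝓕 φ : 𝓢(Pt d, ℂ)).continuous.comp continuous_snd).stronglyMeasurable)
  have h4 : (Function.uncurry fun s => fourierMul (m s) φ) = fun x => ∫ ζ,
      (𝐞 (inner ℝ ζ x.2) : ℂ) * ((m x.1 ζ : ℂ) * (𝓕 φ : 𝓢(Pt d, ℂ)) ζ) := by
    ext x
    simp only [Function.uncurry, fourierMul_apply, Circle.smul_def, smul_eq_mul]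
  rw [h4]
  exact h1.integral_prod_right'

theorem fourierMul_average {ν : Measure ℝ} [IsProbabilityMeasure ν] {m : ℝ → Pt d → ℝ}
    (hm : Measurable (Function.uncurry m)) {B : ℝ} (hB : ∀ s ζ, |m s ζ| ≤ B) (φ : 𝓢(Pt d, ℂ))
    (z : Pt d) :
    fourierMul (fun ζ => ∫ s, m s ζ ∂ν) φ z = ∫ s, fourierMul (m s) φ z ∂ν := by
  have hφi : Integrable (𝓕 φ : 𝓢(Pt d, ℂ)) := (𝓕 φ : 𝓢(Pt d, ℂ)).integrable
  simp only [fourierMul_apply, Circle.smul_def, smul_eq_mul]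
  rw [integral_integral_swap]
  · refine integral_congr_ae (Eventually.of_forall fun ζ => ?_)
    simp only
    rw [integral_const_mul, integral_mul_const, integral_complex_ofReal]
  · refine ((hφi.norm.const_mul B).comp_snd ν).mono' ?_ (Eventually.of_forall fun x => ?_)
    · have h2 : Continuous fun y : ℝ × Pt d => (𝐞 (inner ℝ y.2 z) : ℂ) :=
        continuous_subtype_val.comp (Real.continuous_fourierChar.comp (by fun_prop))
      exact (h2.stronglyMeasurable.mul
        ((Complex.measurable_ofReal.comp hm).stronglyMeasurable.mul
        ((𝓕 φ : 𝓢(Pt d, ℂ)).continuous.comp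
          continuous_snd).stronglyMeasurable)).aestronglyMeasurable
    · simp only [Function.uncurry]
      rw [norm_mul, norm_mul, Circle.norm_coe, one_mul, Complex.norm_real]
      gcongr
      exact hB _ _

/-- Jensen's inequality for a probability measure. -/
theorem enorm_integral_rpow_le {ν : Measure ℝ} [IsProbabilityMeasure ν] {p : ℝ≥0∞}
    (hp1 : 1 ≤ p) (hp : p ≠ ∞) {f : ℝ → ℂ} (hf : AEStronglyMeasurable f ν) :
    ‖∫ s, f s ∂ν‖ₑ ^ p.toReal ≤ ∫⁻ s, ‖f s‖ₑ ^ p.toReal ∂ν := by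
  have hp0 : p ≠ 0 := (lt_of_lt_of_le one_pos hp1).ne'
  have hpr : 0 < p.toReal := ENNReal.toReal_pos hp0 hp
  have h1 : ‖∫ s, f s ∂ν‖ₑ ≤ (∫⁻ s, ‖f s‖ₑ ^ p.toReal ∂ν) ^ (1 / p.toReal) := by
    rw [← eLpNorm_eq_lintegral_rpow_enorm_toReal hp0 hp]
    refine (enorm_integral_le_lintegral_enorm _).trans ?_
    rw [← eLpNorm_one_eq_lintegral_enorm]
    exact eLpNorm_le_eLpNorm_of_exponent_le hp1 hf
  refine (ENNReal.rpow_le_rpow h1 hpr.le).trans_eq ?_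
  rw [← ENNReal.rpow_mul, one_div, inv_mul_cancel₀ hpr.ne', ENNReal.rpow_one]

/-- Averages of uniformly bounded multipliers are multipliers. -/
theorem LpMul.average {ν : Measure ℝ} [IsProbabilityMeasure ν] {m : ℝ → Pt d → ℝ}
    (hm : Measurable (Function.uncurry m)) {B : ℝ} (hB : ∀ s ζ, |m s ζ| ≤ B) {p : ℝ≥0∞}
    (hp1 : 1 ≤ p) (hp : p ≠ ∞) {C : ℝ≥0} (h : ∀ᵐ s ∂ν, LpMul (m s) p C) :
    LpMul (fun ζ => ∫ s, m s ζ ∂ν) p C := by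
  intro φ
  have hp0 : p ≠ 0 := (lt_of_lt_of_le one_pos hp1).ne'
  have hpr : 0 < p.toReal := ENNReal.toReal_pos hp0 hp
  have hFm := stronglyMeasurable_fourierMul hm φ
  have hfin : ∫⁻ z, ‖fourierMul (fun ζ => ∫ s, m s ζ ∂ν) φ z‖ₑ ^ p.toReal
      ≤ (C * eLpNorm φ p) ^ p.toReal := by
    calc ∫⁻ z, ‖fourierMul (fun ζ => ∫ s, m s ζ ∂ν) φ z‖ₑ ^ p.toReal
        ≤ ∫⁻ z, ∫⁻ s, ‖fourierMul (m s) φ z‖ₑ ^ p.toReal ∂ν := by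
          refine lintegral_mono fun z => ?_
          rw [fourierMul_average hm hB]
          exact enorm_integral_rpow_le hp1 hp (hFm.comp_measurable
            (measurable_id.prodMk measurable_const)).aestronglyMeasurable
      _ = ∫⁻ s, (∫⁻ z, ‖fourierMul (m s) φ z‖ₑ ^ p.toReal) ∂ν :=
          lintegral_lintegral_swap
            ((hFm.measurable.comp measurable_swap).enorm.pow_const _).aemeasurable
      _ ≤ ∫⁻ _, (C * eLpNorm φ p) ^ p.toReal ∂ν := by
          refine lintegral_mono_ae (h.mono fun s hs => ?_)
          have h1 := ENNReal.rpow_le_rpow (hs φ) hpr.le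
          rwa [eLpNorm_eq_lintegral_rpow_enorm_toReal hp0 hp, ← ENNReal.rpow_mul, one_div,
            inv_mul_cancel₀ hpr.ne', ENNReal.rpow_one] at h1
      _ = _ := by rw [lintegral_const, measure_univ, mul_one]
  rw [eLpNorm_eq_lintegral_rpow_enorm_toReal hp0 hp]
  refine (ENNReal.rpow_le_rpow hfin (by positivity : 0 ≤ 1 / p.toReal)).trans_eq ?_
  rw [← ENNReal.rpow_mul, one_div, mul_inv_cancel₀ hpr.ne', ENNReal.rpow_one]

/-- The symbol `τ² / (τ² + |ξ|⁴)`. -/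
def timeFraction (ζ : Pt d) : ℝ := timeVar ζ ^ 2 / (timeVar ζ ^ 2 + ‖spaceVar ζ‖ ^ 4)

/-- The symbol `(τ² + |ξ|⁴)^{1/4}`. -/
def quarticNorm (ζ : Pt d) : ℝ := √√(timeVar ζ ^ 2 + ‖spaceVar ζ‖ ^ 4)

theorem quartic_pos {ζ : Pt d} (hζ : ζ ≠ 0) : 0 < timeVar ζ ^ 2 + ‖spaceVar ζ‖ ^ 4 := by
  rcases spaceVar_ne_or_timeVar_ne hζ with h | h
  · have := norm_pos_iff.2 h
    positivity
  · positivity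

theorem contDiff_timeVar : ContDiff ℝ ⊤ (timeVar : Pt d → ℝ) := (timeL (d := d)).contDiff

theorem contDiff_norm_sq_spaceVar : ContDiff ℝ ⊤ fun z : Pt d => ‖spaceVar z‖ ^ 2 :=
  (contDiff_norm_sq ℝ).comp (spaceL (d := d)).contDiff

theorem contDiff_quartic : ContDiff ℝ ⊤ fun ζ : Pt d => timeVar ζ ^ 2 + ‖spaceVar ζ‖ ^ 4 := by
  have : (fun ζ : Pt d => timeVar ζ ^ 2 + ‖spaceVar ζ‖ ^ 4)
      = fun ζ => timeVar ζ ^ 2 + (‖spaceVar ζ‖ ^ 2) ^ 2 := by ext; ring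
  rw [this]
  exact (contDiff_timeVar.pow 2).add (contDiff_norm_sq_spaceVar.pow 2)

theorem quartic_dil (r : ℝ) (ζ : Pt d) :
    timeVar (dil r ζ) ^ 2 + ‖spaceVar (dil r ζ)‖ ^ 4
      = r ^ 4 * (timeVar ζ ^ 2 + ‖spaceVar ζ‖ ^ 4) := by
  rw [timeVar_dil, spaceVar_dil, norm_smul, mul_pow, Real.norm_eq_abs, mul_pow,
    show |r| ^ 4 = r ^ 4 from Even.pow_abs (by decide) r]
  ring

theorem homSymbol_timeFraction : HomSymbol 0 (timeFraction : Pt d → ℝ) where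
  smooth z hz := ((contDiff_timeVar.pow 2).contDiffAt.div contDiff_quartic.contDiffAt
    (quartic_pos hz).ne').of_le le_top
  hom r hr z := by
    rw [timeFraction, quartic_dil, timeVar_dil, timeFraction]
    field_simp

/-- The weight whose dilates average `timeFraction` to `|τ|^{1/2} / (τ² + |ξ|⁴)^{1/4}`. -/
def averageWeight (u : ℝ) : ℝ := u ^ (-(1 / 4) : ℝ) / (1 + u)

theorem averageWeight_pos {u : ℝ} (hu : 0 < u) : 0 < averageWeight u := by
  unfold averageWeight; positivity

theorem measurable_averageWeight : Measurable averageWeight := by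
  unfold averageWeight; fun_prop

theorem integrableOn_averageWeight : IntegrableOn averageWeight (Set.Ioi 0) := by
  rw [← Set.Ioc_union_Ioi_eq_Ioi zero_le_one]
  refine IntegrableOn.union ?_ ?_
  · have h := (intervalIntegral.intervalIntegrable_rpow' (a := 0) (b := 1)
      (r := -(1 / 4)) (by norm_num)).1
    refine h.mono' measurable_averageWeight.aestronglyMeasurable ?_
    filter_upwards [ae_restrict_mem measurableSet_Ioc] with u hu
    rw [Real.norm_of_nonneg (averageWeight_pos hu.1).le, averageWeight]
    have := hu.1
    exact div_le_self (by positivity) (by linarith)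
  · have h := integrableOn_Ioi_rpow_of_lt (a := -(1 / 4) - 1) (by norm_num) one_pos
    refine h.mono' measurable_averageWeight.aestronglyMeasurable ?_
    filter_upwards [ae_restrict_mem measurableSet_Ioi] with u hu
    have hu0 : (0 : ℝ) < u := one_pos.trans hu
    rw [Real.norm_of_nonneg (averageWeight_pos hu0).le, averageWeight, Real.rpow_sub_one hu0.ne']
    gcongr
    linarith

theorem integral_averageWeight_pos : 0 < ∫ u in Set.Ioi 0, averageWeight u := by
  rw [setIntegral_pos_iff_support_of_nonneg_ae _ integrableOn_averageWeight]
  · have : Function.support averageWeight ∩ Set.Ioi 0 = Set.Ioi 0 :=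
      Set.inter_eq_right.2 fun u hu => (averageWeight_pos hu).ne'
    rw [this]
    simp
  · filter_upwards [ae_restrict_mem measurableSet_Ioi] with u hu
    exact (averageWeight_pos hu).le

/-- The substitution `u ↦ (τ² / N) u` in the integral of the weight. -/
theorem integral_averageWeight_mul {τ N : ℝ} (hN : 0 < N) :
    ∫ u in Set.Ioi 0, averageWeight u * ((1 + u) * τ ^ 2 / (u * τ ^ 2 + N))
      = (√|τ| / √√N) * ∫ u in Set.Ioi 0, averageWeight u := by
  rcases eq_or_ne τ 0 with rfl | hτ
  · simp
  have hb : 0 < τ ^ 2 / N := by positivity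
  have h := integral_comp_mul_left_Ioi averageWeight 0 hb
  rw [mul_zero, smul_eq_mul, eq_inv_mul_iff_mul_eq₀ hb.ne', ← integral_const_mul] at h
  rw [← h, ← integral_const_mul]
  refine setIntegral_congr_fun measurableSet_Ioi fun u hu => ?_
  have hu0 : 0 < u := hu
  have hroot : √|τ| / √√N = (τ ^ 2 / N) ^ (1 / 4 : ℝ) := by
    rw [← sq_abs τ, Real.div_rpow (by positivity) hN.le, ← Real.rpow_natCast, ← Real.rpow_mul
      (abs_nonneg _), Real.sqrt_eq_rpow, Real.sqrt_eq_rpow, Real.sqrt_eq_rpow,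
      ← Real.rpow_mul hN.le]
    norm_num
  have hinv : (τ ^ 2 / N) ^ (1 / 4 : ℝ) * (τ ^ 2 / N) ^ (-(1 / 4) : ℝ) = 1 := by
    rw [← Real.rpow_add hb]; norm_num
  simp only [averageWeight]
  rw [hroot, Real.mul_rpow hb.le hu0.le]
  calc u ^ (-(1 / 4) : ℝ) / (1 + u) * ((1 + u) * τ ^ 2 / (u * τ ^ 2 + N))
      = u ^ (-(1 / 4) : ℝ) * (τ ^ 2 / N / (1 + τ ^ 2 / N * u)) := by field_simp; ring
    _ = ((τ ^ 2 / N) ^ (1 / 4 : ℝ) * (τ ^ 2 / N) ^ (-(1 / 4) : ℝ)) *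
        (u ^ (-(1 / 4) : ℝ) * (τ ^ 2 / N / (1 + τ ^ 2 / N * u))) := by rw [hinv, one_mul]
    _ = _ := by ring

/-- The symbol `|τ|^{1/2} / (τ² + |ξ|⁴)^{1/4}`, which is not smooth on the hyperplane `τ = 0`. -/
def halfTimeFraction (ζ : Pt d) : ℝ := √|timeVar ζ| / quarticNorm ζ

/-- The symbol `|τ|^{1/2} / (τ² + |ξ|⁴)^{1/4}` is an average of isotropic dilates of
`τ² / (τ² + |ξ|⁴)`. -/
theorem exists_lpMul_halfTimeFraction {p : ℝ≥0∞} (hp1 : 1 < p) (hp : p < ∞) :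
    ∃ C : ℝ≥0, LpMul (halfTimeFraction : Pt d → ℝ) p C := by
  obtain ⟨C, hC⟩ := (homSymbol_timeFraction (d := d)).exists_lpMul hp1 hp
  set c := ∫ u in Set.Ioi 0, averageWeight u with hc
  have hc0 : 0 < c := integral_averageWeight_pos
  set w : ℝ → ℝ≥0 := fun u => (c⁻¹ * averageWeight u).toNNReal with hw
  have hwm : Measurable w := (measurable_averageWeight.const_mul _).real_toNNReal
  set ν : Measure ℝ := (volume.restrict (Set.Ioi 0)).withDensity fun u => w u with hν
  have hprob : IsProbabilityMeasure ν := by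
    refine ⟨?_⟩
    rw [hν, withDensity_apply _ MeasurableSet.univ, Measure.restrict_univ]
    change ∫⁻ u in Set.Ioi 0, ENNReal.ofReal (c⁻¹ * averageWeight u) = 1
    rw [← ofReal_integral_eq_lintegral_ofReal (integrableOn_averageWeight.const_mul _),
      integral_const_mul, inv_mul_cancel₀ hc0.ne', ENNReal.ofReal_one]
    filter_upwards [ae_restrict_mem measurableSet_Ioi] with u hu
    have := averageWeight_pos hu
    change 0 ≤ c⁻¹ * averageWeight u
    positivity
  -- the isotropic dilation by `(1 + u)^{-1/2}` changes the ratio of `τ²` and `|ξ|⁴` by `1 + u`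
  set m : ℝ → Pt d → ℝ := fun u ζ => timeFraction ((√(1 + u))⁻¹ • ζ) with hm
  have hmm : Measurable (Function.uncurry m) := by
    refine homSymbol_timeFraction.measurable.comp ?_
    have h1 : Measurable fun x : ℝ × Pt d => (√(1 + x.1))⁻¹ := by fun_prop
    exact h1.smul measurable_snd
  have hmB : ∀ u (ζ : Pt d), |m u ζ| ≤ 1 := fun u ζ => by
    simp only [hm, timeFraction]
    rw [abs_of_nonneg (by positivity)]
    exact div_le_one_of_le₀ (by linarith [pow_nonneg (norm_nonneg (spaceVar ((√(1 + u))⁻¹ • ζ))) 4])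
      (by positivity)
  have hmC : ∀ᵐ u ∂ν, LpMul (m u) p C := by
    have hac : ν ≪ volume.restrict (Set.Ioi 0) := withDensity_absolutelyContinuous _ _
    refine hac.ae_le ?_
    filter_upwards [ae_restrict_mem measurableSet_Ioi] with u hu
    have hu0 : (0 : ℝ) < u := hu
    exact hC.comp_smul hp.ne (by positivity)
  have hfin := LpMul.average hmm hmB hp1.le hp.ne hmC
  refine ⟨C, ?_⟩
  convert hfin using 1
  ext ζ
  rw [hν, integral_withDensity_eq_integral_smul hwm]
  rcases eq_or_ne ζ 0 with rfl | hζ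
  · have h0 : timeVar (0 : Pt d) = 0 := rfl
    simp [hm, halfTimeFraction, timeFraction, h0]
  have hN := quartic_pos hζ
  have h1 := integral_averageWeight_mul (τ := timeVar ζ) hN
  have h2 : halfTimeFraction ζ = c⁻¹ * ((√|timeVar ζ| /
      √√(timeVar ζ ^ 2 + ‖spaceVar ζ‖ ^ 4)) * c) := by
    rw [halfTimeFraction, quarticNorm]; field_simp
  rw [h2, ← h1, ← integral_const_mul]
  refine setIntegral_congr_fun measurableSet_Ioi fun u hu => ?_
  have hu0 : (0 : ℝ) < u := hu
  have hw0 := averageWeight_pos hu0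
  have hsq : ((√(1 + u))⁻¹) ^ 2 = (1 + u)⁻¹ := by
    rw [inv_pow, Real.sq_sqrt (by positivity)]
  have hfr : m u ζ = (1 + u) * timeVar ζ ^ 2 / (u * timeVar ζ ^ 2 +
      (timeVar ζ ^ 2 + ‖spaceVar ζ‖ ^ 4)) := by
    have h3 : timeVar ((√(1 + u))⁻¹ • ζ) ^ 2 = (1 + u)⁻¹ * timeVar ζ ^ 2 := by
      rw [show timeVar ((√(1 + u))⁻¹ • ζ) = (√(1 + u))⁻¹ * timeVar ζ from rfl, mul_pow, hsq]
    have h4 : ‖spaceVar ((√(1 + u))⁻¹ • ζ)‖ ^ 4 = ((1 + u)⁻¹) ^ 2 * ‖spaceVar ζ‖ ^ 4 := by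
      rw [show spaceVar ((√(1 + u))⁻¹ • ζ) = (√(1 + u))⁻¹ • spaceVar ζ from rfl, norm_smul,
        Real.norm_of_nonneg (by positivity), mul_pow, ← hsq]
      ring
    simp only [hm, timeFraction, h3, h4]
    have h5 : u * timeVar ζ ^ 2 + (timeVar ζ ^ 2 + ‖spaceVar ζ‖ ^ 4) ≠ 0 := by positivity
    have h6 : (1 + u)⁻¹ * timeVar ζ ^ 2 + ((1 + u)⁻¹) ^ 2 * ‖spaceVar ζ‖ ^ 4
        = ((1 + u)⁻¹) ^ 2 * (u * timeVar ζ ^ 2 + (timeVar ζ ^ 2 + ‖spaceVar ζ‖ ^ 4)) := by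
      field_simp
      ring
    rw [h6]
    field_simp
  rw [hfr, hw, NNReal.smul_def, Real.coe_toNNReal _ (by positivity), smul_eq_mul, mul_assoc]

end Parabolic

end

/-! ### Transposition and extension to `Lᵖ` -/

noncomputable section

namespace Parabolic

open Filter Topology

variable {d : ℕ}

theorem exists_holderConjugate {p : ℝ≥0∞} (hp1 : 1 < p) (hp : p < ∞) :
    ∃ q : ℝ≥0∞, p.HolderConjugate q ∧ 1 < q ∧ q < ∞ := by
  have hpr := one_lt_toReal hp1 hp
  have h := (Real.HolderConjugate.conjExponent hpr).ennrealOfReal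
  rw [ENNReal.ofReal_toReal hp.ne] at h
  exact ⟨_, h, (ENNReal.HolderConjugate.lt_top_iff_one_lt p _).1 hp, ENNReal.ofReal_lt_top⟩

theorem integrable_mul_of_holderConjugate {p q : ℝ≥0∞} [p.HolderConjugate q] {f g : Pt d → ℂ}
    (hf : MemLp f p) (hg : MemLp g q) : Integrable fun z => f z * g z :=
  hf.integrable_mul hg

theorem enorm_integral_mul_le {p q : ℝ≥0∞} [p.HolderConjugate q] {f g : Pt d → ℂ}
    (hf : MemLp f p) (hg : MemLp g q) :
    ‖∫ z, f z * g z‖ₑ ≤ eLpNorm f p * eLpNorm g q := by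
  refine (enorm_integral_le_lintegral_enorm _).trans ?_
  have h := eLpNorm_smul_le_mul_eLpNorm (p := p) (q := q) (r := 1) hg.1 hf.1
  rw [eLpNorm_one_eq_lintegral_enorm] at h
  exact h

theorem tendsto_integral_mul {p q : ℝ≥0∞} [p.HolderConjugate q] {f : ℕ → Pt d → ℂ}
    {g h : Pt d → ℂ} (hf : ∀ k, MemLp (f k) p) (hg : MemLp g p) (hh : MemLp h q)
    (hlim : Tendsto (fun k => eLpNorm (fun z => f k z - g z) p) atTop (𝓝 0)) :
    Tendsto (fun k => ∫ z, f k z * h z) atTop (𝓝 (∫ z, g z * h z)) := by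
  rw [tendsto_iff_edist_tendsto_0]
  have h2 : Tendsto (fun k => eLpNorm (fun z => f k z - g z) p * eLpNorm h q) atTop
      (𝓝 (0 * eLpNorm h q)) := ENNReal.Tendsto.mul_const hlim (Or.inr hh.eLpNorm_ne_top)
  rw [zero_mul] at h2
  refine tendsto_of_tendsto_of_tendsto_of_le_of_le tendsto_const_nhds h2 (fun k => zero_le)
    fun k => ?_
  have h3 : MemLp (fun z => f k z - g z) p := (hf k).sub hg
  have h4 := enorm_integral_mul_le (q := q) h3 hh
  refine le_trans (le_of_eq ?_) h4
  rw [edist_eq_enorm_sub, ← integral_sub (integrable_mul_of_holderConjugate (q := q) (hf k) hh)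
    (integrable_mul_of_holderConjugate (q := q) hg hh)]
  simp only [sub_mul]

theorem continuous_fourierMul {m : Pt d → ℝ} {φ : 𝓢(Pt d, ℂ)}
    (h : Integrable fun ζ => (m ζ : ℂ) * (𝓕 φ : 𝓢(Pt d, ℂ)) ζ) : Continuous (fourierMul m φ) := by
  have h1 : fourierMul m φ
      = fun z => 𝓕 (fun ζ => (m ζ : ℂ) * (𝓕 φ : 𝓢(Pt d, ℂ)) ζ) (-z) := by
    ext z
    rw [fourierMul, Real.fourierInv_eq_fourier_neg]
  rw [h1]
  exact (VectorFourier.fourierIntegral_continuous Real.continuous_fourierChar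
    (innerSL ℝ).continuous₂ h).comp continuous_neg

theorem integral_fourierMul_mul_aux {m : Pt d → ℝ} (φ ψ : 𝓢(Pt d, ℂ))
    (h : Integrable fun ζ => (m ζ : ℂ) * (𝓕 φ : 𝓢(Pt d, ℂ)) ζ) :
    ∫ z, fourierMul m φ z * ψ z
      = ∫ ζ, (m ζ : ℂ) * (𝓕 φ : 𝓢(Pt d, ℂ)) ζ * (𝓕 ψ : 𝓢(Pt d, ℂ)) (-ζ) := by
  have hψi : Integrable ψ := ψ.integrable
  simp only [fourierMul_apply, Circle.smul_def, smul_eq_mul, ← integral_mul_const]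
  rw [integral_integral_swap]
  · refine integral_congr_ae (Eventually.of_forall fun ζ => ?_)
    simp only [SchwartzMap.fourier_coe ψ, Real.fourier_eq, Circle.smul_def, smul_eq_mul,
      ← integral_const_mul, inner_neg_right, neg_neg]
    refine integral_congr_ae (Eventually.of_forall fun z => ?_)
    simp only [real_inner_comm]
    ring
  · refine (hψi.mul_prod h).norm.mono' ?_ (Eventually.of_forall fun x => ?_)
    · have h2 : Continuous fun y : Pt d × Pt d => (𝐞 (inner ℝ y.2 y.1) : ℂ) :=
        continuous_subtype_val.comp (Real.continuous_fourierChar.comp (by fun_prop))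
      exact (h2.aestronglyMeasurable.mul h.aestronglyMeasurable.comp_snd).mul
        hψi.aestronglyMeasurable.comp_fst
    · simp only [Function.uncurry]
      rw [norm_mul, norm_mul, Circle.norm_coe, one_mul, ← norm_mul, mul_comm]

/-- The transpose of the multiplier operator of `m` is that of `m(-·)`. -/
theorem integral_fourierMul_mul {m : Pt d → ℝ} (hm : Measurable m) {B : ℝ} {k : ℕ}
    (hB : ∀ ζ, |m ζ| ≤ B * (1 + ‖ζ‖) ^ k) (φ ψ : 𝓢(Pt d, ℂ)) :
    ∫ z, fourierMul m φ z * ψ z = ∫ z, φ z * fourierMul (fun ζ => m (-ζ)) ψ z := by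
  rw [integral_fourierMul_mul_aux φ ψ (integrable_mul_fourier hm hB φ)]
  simp only [mul_comm (φ _)]
  rw [integral_fourierMul_mul_aux (m := fun ζ => m (-ζ)) ψ φ
    (integrable_mul_fourier (hm.comp measurable_neg) (fun ζ => by simpa using hB (-ζ)) ψ), ← integral_neg_eq_self]
  refine integral_congr_ae (Eventually.of_forall fun ζ => ?_)
  simp only [neg_neg]
  ring

theorem fourierMul_add {m : Pt d → ℝ} {φ ψ : 𝓢(Pt d, ℂ)}
    (h1 : Integrable fun ζ => (m ζ : ℂ) * (𝓕 φ : 𝓢(Pt d, ℂ)) ζ)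
    (h2 : Integrable fun ζ => (m ζ : ℂ) * (𝓕 ψ : 𝓢(Pt d, ℂ)) ζ) :
    fourierMul m (φ + ψ) = fourierMul m φ + fourierMul m ψ := by
  ext z
  rw [Pi.add_apply, fourierMul_apply, fourierMul_apply, fourierMul_apply,
    ← integral_add (integrable_char_smul z h1) (integrable_char_smul z h2)]
  refine integral_congr_ae (Eventually.of_forall fun ζ => ?_)
  simp only [FourierTransform.fourier_add, add_apply, mul_add, smul_add]

theorem fourierMul_smul (m : Pt d → ℝ) (c : ℝ) (φ : 𝓢(Pt d, ℂ)) :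
    fourierMul m (c • φ) = c • fourierMul m φ := by
  ext z
  rw [Pi.smul_apply, fourierMul_apply, fourierMul_apply, ← integral_smul]
  refine integral_congr_ae (Eventually.of_forall fun ζ => ?_)
  simp only [FourierTransform.fourier_smul, smul_apply]
  rw [smul_comm c, mul_smul_comm]

/-- Multiplication of the Fourier transform by `m` is bounded on `Lᵖ` by `C`, in the sense of
distributions. -/
def TransferBound (m : Pt d → ℝ) (p : ℝ≥0∞) (C : ℝ≥0) : Prop :=
  ∀ g : Pt d → ℂ, MemLp g p → ∃ h : Pt d → ℂ, MemLp h p ∧ eLpNorm h p ≤ C * eLpNorm g p ∧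
    ∀ φ : 𝓢(Pt d, ℂ), ∫ z, h z * φ z = ∫ z, g z * fourierMul (fun ζ => m (-ζ)) φ z

theorem LpMul.memLp {m : Pt d → ℝ} {p : ℝ≥0∞} {C : ℝ≥0} (h : LpMul m p C) {φ : 𝓢(Pt d, ℂ)}
    (hint : Integrable fun ζ => (m ζ : ℂ) * (𝓕 φ : 𝓢(Pt d, ℂ)) ζ) : MemLp (fourierMul m φ) p :=
  ⟨(continuous_fourierMul hint).aestronglyMeasurable,
    (h φ).trans_lt (ENNReal.mul_lt_top ENNReal.coe_lt_top (φ.memLp p volume).eLpNorm_lt_top)⟩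

/-- A bounded multiplier as a linear map from Schwartz functions to `Lᵖ`. -/
def LpMul.toLp {m : Pt d → ℝ} {p : ℝ≥0∞} {C : ℝ≥0} (h : LpMul m p C)
    (hint : ∀ φ : 𝓢(Pt d, ℂ), Integrable fun ζ => (m ζ : ℂ) * (𝓕 φ : 𝓢(Pt d, ℂ)) ζ) :
    𝓢(Pt d, ℂ) →ₗ[ℝ] Lp ℂ p (volume : Measure (Pt d)) where
  toFun φ := (h.memLp (hint φ)).toLp _
  map_add' φ ψ := by
    rw [← MemLp.toLp_add]
    exact MemLp.toLp_congr _ _ (by rw [fourierMul_add (hint φ) (hint ψ)])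
  map_smul' c φ := by
    rw [RingHom.id_apply, ← MemLp.toLp_const_smul]
    exact MemLp.toLp_congr _ _ (by rw [fourierMul_smul])

/-- The extension of a multiplier operator to `Lᵖ` by density. -/
theorem LpMul.exists_extension {m : Pt d → ℝ} {p : ℝ≥0∞} (hp1 : 1 ≤ p) (hp : p ≠ ∞) {C : ℝ≥0}
    (h : LpMul m p C)
    (hint : ∀ φ : 𝓢(Pt d, ℂ), Integrable fun ζ => (m ζ : ℂ) * (𝓕 φ : 𝓢(Pt d, ℂ)) ζ)
    {g : Pt d → ℂ} (hg : MemLp g p) :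
    ∃ H : Pt d → ℂ, MemLp H p ∧ eLpNorm H p ≤ C * eLpNorm g p ∧ ∃ φ : ℕ → 𝓢(Pt d, ℂ),
      Tendsto (fun k => eLpNorm (fun z => φ k z - g z) p) atTop (𝓝 0) ∧
      Tendsto (fun k => eLpNorm (fun z => fourierMul m (φ k) z - H z) p) atTop (𝓝 0) := by
  have : Fact (1 ≤ p) := ⟨hp1⟩
  let e : 𝓢(Pt d, ℂ) →ₗ[ℝ] Lp ℂ p (volume : Measure (Pt d)) :=
    (SchwartzMap.toLpCLM ℝ ℂ p volume).toLinearMap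
  have hdense : DenseRange e := SchwartzMap.denseRange_toLpCLM hp
  have hTe : ∀ φ, ‖h.toLp hint φ‖ ≤ C * ‖e φ‖ := fun φ => by
    have h1 : ‖h.toLp hint φ‖ = (eLpNorm (fourierMul m φ) p).toReal :=
      Lp.norm_toLp _ (h.memLp (hint φ))
    have h2 : ‖e φ‖ = (eLpNorm φ p).toReal := SchwartzMap.norm_toLp
    rw [h1, h2, ← ENNReal.coe_toReal, ← ENNReal.toReal_mul]
    exact ENNReal.toReal_mono
      (ENNReal.mul_ne_top ENNReal.coe_ne_top (φ.memLp p volume).eLpNorm_ne_top) (h φ)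
  set S := (h.toLp hint).extendOfNorm e with hS
  have hnorm : ‖S (hg.toLp g)‖ ≤ C * ‖hg.toLp g‖ :=
    LinearMap.norm_extendOfNorm_apply_le hdense C hTe _
  obtain ⟨φ, hφ⟩ := exists_schwartz_seq hp1 hp hg
  have hconv : Tendsto (fun k => e (φ k)) atTop (𝓝 (hg.toLp g)) := by
    rw [tendsto_iff_edist_tendsto_0]
    refine hφ.congr fun k => ?_
    rw [Lp.edist_def]
    refine eLpNorm_congr_ae ?_
    filter_upwards [(φ k).coeFn_toLp p volume, hg.coeFn_toLp] with z h2 h3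
    rw [Pi.sub_apply, h3, ← h2]
    rfl
  have hconv2 : Tendsto (fun k => S (e (φ k))) atTop (𝓝 (S (hg.toLp g))) :=
    (S.continuous.tendsto _).comp hconv
  refine ⟨S (hg.toLp g), Lp.memLp _, ?_, φ, hφ, ?_⟩
  · rw [Lp.norm_def, Lp.norm_toLp, ← ENNReal.coe_toReal, ← ENNReal.toReal_mul] at hnorm
    exact (ENNReal.toReal_le_toReal (Lp.memLp _).eLpNorm_ne_top
      (ENNReal.mul_ne_top ENNReal.coe_ne_top hg.eLpNorm_ne_top)).1 hnorm
  · refine (tendsto_iff_edist_tendsto_0.1 hconv2).congr fun k => ?_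
    rw [Lp.edist_def, hS, LinearMap.extendOfNorm_eq hdense ⟨C, hTe⟩]
    refine eLpNorm_congr_ae ?_
    filter_upwards [(h.memLp (hint (φ k))).coeFn_toLp] with z h2
    rw [Pi.sub_apply, ← h2]
    rfl

/-- A multiplier on `Lᵖ` extends from Schwartz functions to `Lᵖ`; the bound of its transpose on the
dual space makes the pairing with a Schwartz function continuous. -/
theorem LpMul.transferBound {m : Pt d → ℝ} (hm : Measurable m) {B : ℝ} (hB : ∀ ζ, |m ζ| ≤ B)
    {p q : ℝ≥0∞} [hpq : p.HolderConjugate q] (hp1 : 1 ≤ p) (hp : p ≠ ∞) {C D : ℝ≥0}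
    (h : LpMul m p C) (h' : LpMul (fun ζ => m (-ζ)) q D) : TransferBound m p C := by
  have hB' : ∀ ζ, |m ζ| ≤ B * (1 + ‖ζ‖) ^ 0 := by simpa using hB
  have hint := fun φ => integrable_mul_fourier hm hB' φ
  have hint' := fun φ => integrable_mul_fourier (m := fun ζ => m (-ζ)) (B := B) (k := 0)
    (hm.comp measurable_neg) (fun ζ => by simpa using hB (-ζ)) φ
  intro g hg
  obtain ⟨H, hH, hHC, φs, h1, h2⟩ := h.exists_extension hp1 hp hint hg
  refine ⟨H, hH, hHC, fun φ => ?_⟩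
  have h3 := tendsto_integral_mul (q := q) (fun k => h.memLp (hint (φs k))) hH (φ.memLp q volume) h2
  have h4 := tendsto_integral_mul (q := q) (fun k => (φs k).memLp p volume) hg
    (h'.memLp (hint' φ)) h1
  refine tendsto_nhds_unique h3 (h4.congr fun k => ?_)
  rw [integral_fourierMul_mul hm hB']

theorem HomSymbol.exists_transferBound {m : Pt d → ℝ} (h : HomSymbol 0 m) {p : ℝ≥0∞}
    (hp1 : 1 < p) (hp : p < ∞) : ∃ C : ℝ≥0, TransferBound m p C := by
  obtain ⟨q, hpq, hq1, hq⟩ := exists_holderConjugate hp1 hp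
  obtain ⟨C, hC⟩ := h.exists_lpMul hp1 hp
  obtain ⟨D, hD⟩ := h.comp_neg.exists_lpMul hq1 hq
  obtain ⟨B, -, hB⟩ := h.exists_bound_zero
  exact ⟨C, hC.transferBound (q := q) h.measurable hB hp1.le hp.ne hD⟩

theorem halfTimeFraction_neg (ζ : Pt d) : halfTimeFraction (-ζ) = halfTimeFraction ζ := by
  simp [halfTimeFraction, quarticNorm]

theorem abs_halfTimeFraction_le (ζ : Pt d) : |halfTimeFraction ζ| ≤ 1 := by
  rw [halfTimeFraction, quarticNorm, abs_of_nonneg (by positivity)]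
  refine div_le_one_of_le₀ ?_ (by positivity)
  refine Real.sqrt_le_sqrt ?_
  rw [← Real.sqrt_sq_eq_abs]
  exact Real.sqrt_le_sqrt (by linarith [pow_nonneg (norm_nonneg (spaceVar ζ)) 4])

theorem measurable_halfTimeFraction : Measurable (halfTimeFraction : Pt d → ℝ) := by
  have h1 : Measurable (timeVar : Pt d → ℝ) := continuous_timeVar.measurable
  have h2 : Measurable (spaceVar : Pt d → _) := continuous_spaceVar.measurable
  unfold halfTimeFraction quarticNorm
  fun_prop

theorem exists_transferBound_halfTimeFraction {p : ℝ≥0∞} (hp1 : 1 < p) (hp : p < ∞) :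
    ∃ C : ℝ≥0, TransferBound (halfTimeFraction : Pt d → ℝ) p C := by
  obtain ⟨q, hpq, hq1, hq⟩ := exists_holderConjugate hp1 hp
  obtain ⟨C, hC⟩ := exists_lpMul_halfTimeFraction (d := d) hp1 hp
  obtain ⟨D, hD⟩ := exists_lpMul_halfTimeFraction (d := d) hq1 hq
  refine ⟨C, hC.transferBound (q := q) measurable_halfTimeFraction abs_halfTimeFraction_le
    hp1.le hp.ne (D := D) ?_⟩
  simpa only [halfTimeFraction_neg] using hD

end Parabolic

end

/-! ### The half derivative in time as a multiplier -/

noncomputable section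

namespace Parabolic

open Filter Topology

variable {d : ℕ}

theorem continuous_joinPt :
    Continuous fun p : EuclideanSpace ℝ (Fin d) × ℝ => joinPt p.1 p.2 := by
  have h : (fun p : EuclideanSpace ℝ (Fin d) × ℝ => joinPt p.1 p.2)
      = fun p => WithLp.toLp 2 (Fin.snoc (α := fun _ => ℝ) p.1.ofLp p.2) := by
    ext1 p
    apply pt_ext
    · rw [spaceVar_joinPt]
      ext i
      simp [spaceVar_apply]
    · rw [timeVar_joinPt]
      simp [timeVar]
  rw [h]
  refine (PiLp.continuous_toLp 2 _).comp (continuous_pi fun i => ?_)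
  refine Fin.lastCases ?_ (fun j => ?_) i
  · simpa using continuous_snd
  · simp only [Fin.snoc_castSucc]
    fun_prop

theorem exists_joinPt_decay (ψ : 𝓢(Pt d, ℂ)) :
    ∃ C : ℝ, 0 ≤ C ∧ ∀ (x : EuclideanSpace ℝ (Fin d)) (t : ℝ),
      ‖ψ (joinPt x t)‖ ≤ C * ((1 + ‖x‖) ^ (-((d : ℝ) + 1)) * (1 + ‖t‖) ^ (-2 : ℝ)) := by
  obtain ⟨C, hC0, hC⟩ := exists_gauge_decay ψ (d + 1 + 4)
  refine ⟨C, hC0, fun x t => ?_⟩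
  have h := hC (joinPt x t)
  rw [gauge, spaceVar_joinPt, timeVar_joinPt] at h
  have h1 : (1 + ‖x‖) ^ (-((d : ℝ) + 1)) = ((1 + ‖x‖) ^ (d + 1))⁻¹ := by
    rw [Real.rpow_neg (by positivity)]; norm_cast
  have h2 : (1 + ‖t‖) ^ (-2 : ℝ) = ((1 + ‖t‖) ^ 2)⁻¹ := by
    rw [Real.rpow_neg (by positivity)]; norm_cast
  have h3 : 1 + ‖t‖ ≤ (1 + (‖x‖ + √|t|)) ^ 2 := by
    have h4 := Real.sq_sqrt (abs_nonneg t)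
    have h5 := Real.sqrt_nonneg |t|
    have h6 := norm_nonneg x
    rw [Real.norm_eq_abs]
    nlinarith [mul_nonneg h5 h6]
  rw [h1, h2, ← mul_inv, ← div_eq_mul_inv, le_div_iff₀ (by positivity)]
  have h7 : (1 + ‖x‖) ^ (d + 1) * (1 + ‖t‖) ^ 2 ≤ (1 + (‖x‖ + √|t|)) ^ (d + 1 + 4) := by
    rw [pow_add _ (d + 1) 4]
    gcongr
    · linarith [Real.sqrt_nonneg |t|]
    · calc (1 + ‖t‖) ^ 2 ≤ ((1 + (‖x‖ + √|t|)) ^ 2) ^ 2 := by gcongr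
        _ = _ := by ring
  calc _ ≤ ‖ψ (joinPt x t)‖ * (1 + (‖x‖ + √|t|)) ^ (d + 1 + 4) := by gcongr
    _ ≤ C := by rwa [mul_comm]

theorem integrable_space_weight :
    Integrable fun x : EuclideanSpace ℝ (Fin d) => (1 + ‖x‖) ^ (-((d : ℝ) + 1)) :=
  integrable_one_add_norm (by simp)

theorem integrable_time_weight : Integrable fun t : ℝ => (1 + ‖t‖) ^ (-2 : ℝ) :=
  integrable_one_add_norm (by simp)

theorem integral_eq_integral_joinPt {f : Pt d → ℂ} (hf : Integrable f) :
    ∫ z, f z = ∫ t, ∫ x, f (joinPt x t) := by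
  have h1 := (measurePreserving_joinPt (d := d)).integral_comp' (f := (splitEquiv d).symm) f
  have h2 : Integrable (fun p : EuclideanSpace ℝ (Fin d) × ℝ => f (joinPt p.1 p.2))
      (volume.prod volume) := (measurePreserving_joinPt (d := d)).integrable_comp_of_integrable hf
  rw [← h1]
  exact integral_prod_symm _ h2

/-- The Fourier transform is inverted in the spatial variables only. -/
theorem fourier_time_slice (φ : 𝓢(Pt d, ℂ)) (x : EuclideanSpace ℝ (Fin d)) (τ : ℝ) :
    𝓕 (fun s : ℝ => φ (joinPt x s)) τ
      = ∫ ξ, (𝐞 (inner ℝ ξ x) : ℂ) * (𝓕 φ : 𝓢(Pt d, ℂ)) (joinPt ξ τ) := by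
  obtain ⟨C, hC0, hC⟩ := exists_joinPt_decay (𝓕 φ : 𝓢(Pt d, ℂ))
  obtain ⟨D, hD0, hD⟩ := exists_joinPt_decay φ
  set F : ℝ → EuclideanSpace ℝ (Fin d) → ℂ := fun τ ξ =>
    (𝐞 (inner ℝ ξ x) : ℂ) * (𝓕 φ : 𝓢(Pt d, ℂ)) (joinPt ξ τ) with hF
  have hFc : Continuous (Function.uncurry F) := by
    refine Continuous.mul ?_ ?_
    · exact continuous_subtype_val.comp (Real.continuous_fourierChar.comp (by fun_prop))
    · exact (𝓕 φ : 𝓢(Pt d, ℂ)).continuous.comp (continuous_joinPt.comp continuous_swap)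
  have hFb : ∀ τ ξ, ‖F τ ξ‖ ≤ C * ((1 + ‖ξ‖) ^ (-((d : ℝ) + 1)) * (1 + ‖τ‖) ^ (-2 : ℝ)) :=
    fun τ ξ => by
      rw [hF, norm_mul, Circle.norm_coe, one_mul]
      exact hC ξ τ
  have hFi : Integrable (Function.uncurry F) (volume.prod volume) := by
    refine ((integrable_time_weight.mul_prod (integrable_space_weight (d := d))).const_mul
      C).mono' hFc.aestronglyMeasurable (Eventually.of_forall fun p => ?_)
    rw [mul_comm ((1 + ‖p.1‖) ^ (-2 : ℝ))]
    exact hFb p.1 p.2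
  set G : ℝ → ℂ := fun τ => ∫ ξ, F τ ξ with hG
  have hGi : Integrable G := hFi.integral_prod_left
  have hGc : Continuous G := by
    refine continuous_of_dominated (fun τ => ?_)
      (fun τ => Eventually.of_forall fun ξ => (hFb τ ξ).trans ?_)
      ((integrable_space_weight (d := d)).const_mul C)
      (Eventually.of_forall fun ξ => ?_)
    · exact (hFc.uncurry_left τ).aestronglyMeasurable
    · have h1 : (1 + ‖τ‖) ^ (-2 : ℝ) ≤ 1 :=
        Real.rpow_le_one_of_one_le_of_nonpos (by linarith [norm_nonneg τ]) (by norm_num)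
      gcongr
      exact mul_le_of_le_one_right (by positivity) h1
    · exact hFc.uncurry_right ξ
  have hinv : 𝓕⁻ G = fun s : ℝ => φ (joinPt x s) := by
    ext s
    have hφi : Integrable (𝓕 φ : 𝓢(Pt d, ℂ)) := SchwartzMap.integrable _
    rw [fourier_inversion φ, integral_eq_integral_joinPt (integrable_char_smul _ hφi),
      Real.fourierInv_eq]
    refine integral_congr_ae (Eventually.of_forall fun τ => ?_)
    simp only [hG, hF, Circle.smul_def, smul_eq_mul, ← integral_const_mul]
    refine integral_congr_ae (Eventually.of_forall fun ξ => ?_)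
    simp only [inner_eq_split, spaceVar_joinPt, timeVar_joinPt, AddChar.map_add_eq_mul,
      Circle.coe_mul]
    rw [show inner ℝ τ s = τ * s by simp [mul_comm]]
    ring
  have hsi : Integrable fun s : ℝ => φ (joinPt x s) := by
    refine (integrable_time_weight.const_mul (D * (1 + ‖x‖) ^ (-((d : ℝ) + 1)))).mono'
      (φ.continuous.comp (continuous_joinPt.comp
        (continuous_const.prodMk continuous_id))).aestronglyMeasurable
      (Eventually.of_forall fun s => ?_)
    rw [mul_assoc]
    exact hD x s
  have hGF : Integrable (𝓕 G) := by
    have h2 : 𝓕 G = fun s => φ (joinPt x (-s)) := by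
      ext s
      rw [← congrFun hinv (-s), Real.fourierInv_eq_fourier_neg, neg_neg]
    rw [h2]
    exact hsi.comp_neg
  rw [← hinv, hGc.fourier_fourierInv_eq hGi hGF]

/-- The symbol `|τ|^{1/2}`. -/
def halfTimeSymbol (ζ : Pt d) : ℝ := √|timeVar ζ|

theorem halfTimeSymbol_neg (ζ : Pt d) : halfTimeSymbol (-ζ) = halfTimeSymbol ζ := by
  simp [halfTimeSymbol]

theorem measurable_halfTimeSymbol : Measurable (halfTimeSymbol : Pt d → ℝ) := by
  have h1 : Measurable (timeVar : Pt d → ℝ) := continuous_timeVar.measurable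
  unfold halfTimeSymbol
  fun_prop

theorem abs_halfTimeSymbol_le (ζ : Pt d) : |halfTimeSymbol ζ| ≤ 2 * (1 + ‖ζ‖) ^ 1 := by
  rw [halfTimeSymbol, abs_of_nonneg (by positivity), pow_one]
  refine le_trans ?_ (one_add_gauge_le ζ)
  rw [gauge]
  linarith [norm_nonneg (spaceVar ζ)]

/-- The half derivative, defined on time slices, is a multiplier operator on `ℝᵈ × ℝ`. -/
theorem halfTime_eq_fourierMul (φ : 𝓢(Pt d, ℂ)) : halfTime φ = fourierMul halfTimeSymbol φ := by
  ext z
  have hint := integrable_char_smul z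
    (integrable_mul_fourier measurable_halfTimeSymbol abs_halfTimeSymbol_le φ)
  have h2 : ∀ τ : ℝ, 𝓕 (fun s : ℝ => φ (withTime z s)) τ
      = ∫ ξ, (𝐞 (inner ℝ ξ (spaceVar z)) : ℂ) * (𝓕 φ : 𝓢(Pt d, ℂ)) (joinPt ξ τ) := fun τ => by
    simp only [withTime_eq]
    exact fourier_time_slice φ (spaceVar z) τ
  rw [halfTime, fourierMul_apply, integral_eq_integral_joinPt hint, Real.fourierInv_eq]
  refine integral_congr_ae (Eventually.of_forall fun τ => ?_)
  simp only [h2, Circle.smul_def, smul_eq_mul, ← integral_const_mul]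
  refine integral_congr_ae (Eventually.of_forall fun ξ => ?_)
  simp only [inner_eq_split, spaceVar_joinPt, timeVar_joinPt, AddChar.map_add_eq_mul,
    Circle.coe_mul, halfTimeSymbol]
  rw [show inner ℝ τ (timeVar z) = τ * timeVar z by simp [mul_comm]]
  ring

end Parabolic

end

/-! ### The symbols -/

noncomputable section

namespace Parabolic

open Filter Topology
open scoped ContDiff

variable {d : ℕ}

theorem HomSymbol.div {a b : ℤ} {m k : Pt d → ℝ} (hm : HomSymbol a m) (hk : HomSymbol b k)
    (h0 : ∀ z ≠ 0, k z ≠ 0) : HomSymbol (a - b) fun z => m z / k z where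
  smooth z hz := (hm.smooth z hz).div (hk.smooth z hz) (h0 z hz)
  hom r hr z := by
    rw [hm.hom r hr, hk.hom r hr, zpow_sub₀ hr.ne', mul_div_mul_comm]

theorem homSymbol_timeVar : HomSymbol 2 (timeVar : Pt d → ℝ) where
  smooth _ _ := contDiff_timeVar.contDiffAt.of_le le_top
  hom r _ z := timeVar_dil r z

theorem homSymbol_spaceVar (i : Fin d) : HomSymbol 1 fun z : Pt d => z i.castSucc where
  smooth _ _ := by fun_prop
  hom r _ z := by
    rw [zpow_one, dil_apply, if_neg (Fin.castSucc_lt_last i).ne]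

theorem homSymbol_parNorm : HomSymbol 1 (parNorm : Pt d → ℝ) where
  smooth z hz := by
    have h1 : 0 < timeVar z ^ 2 + ‖spaceVar z‖ ^ 4 := quartic_pos hz
    have h2 : ‖spaceVar z‖ ^ 4 + 4 * timeVar z ^ 2 ≠ 0 := by
      have := sq_nonneg (timeVar z)
      have := pow_nonneg (norm_nonneg (spaceVar z)) 4
      intro h
      linarith
    have h3 : (‖spaceVar z‖ ^ 2 + √(‖spaceVar z‖ ^ 4 + 4 * timeVar z ^ 2)) / 2 ≠ 0 := by
      intro h
      have h4 := parNorm_pos hz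
      rw [parNorm, h, Real.sqrt_zero] at h4
      exact lt_irrefl _ h4
    have h5 : ContDiff ℝ ∞ fun z : Pt d => ‖spaceVar z‖ ^ 2 :=
      contDiff_norm_sq_spaceVar.of_le le_top
    have h6 : ContDiff ℝ ∞ fun z : Pt d => ‖spaceVar z‖ ^ 4 + 4 * timeVar z ^ 2 := by
      have : (fun z : Pt d => ‖spaceVar z‖ ^ 4 + 4 * timeVar z ^ 2)
          = fun z => (‖spaceVar z‖ ^ 2) ^ 2 + 4 * timeVar z ^ 2 := by ext; ring
      rw [this]
      exact (h5.pow 2).add (contDiff_const.mul ((contDiff_timeVar.of_le le_top).pow 2))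
    exact ((h5.contDiffAt.add (h6.contDiffAt.sqrt h2)).div_const 2).sqrt h3
  hom r hr z := by
    have h1 : (‖spaceVar (dil r z)‖ ^ 2
          + √(‖spaceVar (dil r z)‖ ^ 4 + 4 * timeVar (dil r z) ^ 2)) / 2
        = r ^ 2 * ((‖spaceVar z‖ ^ 2 + √(‖spaceVar z‖ ^ 4 + 4 * timeVar z ^ 2)) / 2) := by
      rw [spaceVar_dil, timeVar_dil, norm_smul, Real.norm_of_nonneg hr.le,
        show (r * ‖spaceVar z‖) ^ 4 + 4 * (r ^ 2 * timeVar z) ^ 2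
          = (r ^ 2) ^ 2 * (‖spaceVar z‖ ^ 4 + 4 * timeVar z ^ 2) by ring,
        Real.sqrt_mul (by positivity), Real.sqrt_sq (by positivity)]
      ring
    rw [parNorm, h1, Real.sqrt_mul (by positivity), Real.sqrt_sq hr.le, zpow_one, parNorm]

theorem parNorm_neg (z : Pt d) : parNorm (-z) = parNorm z := by
  simp [parNorm]

theorem homSymbol_symbolD : HomSymbol 1 (symbolD : Pt d → ℝ) := homSymbol_parNorm

theorem homSymbol_symbolDn : HomSymbol 1 (symbolDn : Pt d → ℝ) :=
  homSymbol_timeVar.div homSymbol_parNorm fun _ hz => (parNorm_pos hz).ne'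

theorem homSymbol_quarticNorm : HomSymbol 1 (quarticNorm : Pt d → ℝ) where
  smooth z hz := by
    have h1 : 0 < timeVar z ^ 2 + ‖spaceVar z‖ ^ 4 := quartic_pos hz
    have h2 : ContDiffAt ℝ ∞ (fun ζ : Pt d => timeVar ζ ^ 2 + ‖spaceVar ζ‖ ^ 4) z :=
      contDiff_quartic.contDiffAt.of_le le_top
    exact (h2.sqrt h1.ne').sqrt (Real.sqrt_pos.2 h1).ne'
  hom r hr z := by
    rw [quarticNorm, quartic_dil, show r ^ 4 = (r ^ 2) ^ 2 by ring, Real.sqrt_mul (by positivity),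
      Real.sqrt_sq (by positivity), Real.sqrt_mul (by positivity), Real.sqrt_sq hr.le, zpow_one,
      quarticNorm]

theorem quarticNorm_pos {z : Pt d} (hz : z ≠ 0) : 0 < quarticNorm z :=
  Real.sqrt_pos.2 (Real.sqrt_pos.2 (quartic_pos hz))

/-- An increasing function of `(τ / ρ²)²`, where `ρ` is the parabolic norm; it is `-1` on the
hyperplane `τ = 0` and `3` on the `τ`-axis, where `ρ² = |τ|`. -/
def timeRatio (ζ : Pt d) : ℝ := 4 * (timeVar ζ / parNorm ζ ^ 2) ^ 2 - 1

/-- A cutoff which vanishes near `τ = 0` and is `1` near the `τ`-axis. -/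
def timeCut (ζ : Pt d) : ℝ := Real.smoothTransition (timeRatio ζ)

theorem contDiffAt_timeRatio {z : Pt d} (hz : z ≠ 0) : ContDiffAt ℝ ∞ timeRatio z := by
  have h1 := homSymbol_timeVar.smooth z hz
  have h2 := homSymbol_parNorm.smooth z hz
  have h3 : parNorm z ^ 2 ≠ 0 := pow_ne_zero 2 (parNorm_pos hz).ne'
  exact (contDiffAt_const.mul ((h1.div (h2.pow 2) h3).pow 2)).sub contDiffAt_const

theorem homSymbol_timeCut : HomSymbol 0 (timeCut : Pt d → ℝ) where
  smooth z hz := Real.smoothTransition.contDiffAt.comp z (contDiffAt_timeRatio hz)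
  hom r hr z := by
    rw [timeCut, timeRatio, homSymbol_timeVar.hom r hr, homSymbol_parNorm.hom r hr, zpow_one,
      mul_pow, show (r : ℝ) ^ (2 : ℤ) = r ^ 2 by norm_cast, mul_div_mul_left _ _ (by positivity),
      zpow_zero, one_mul]
    rfl

theorem timeCut_eventually_eq_zero {z : Pt d} (hz : z ≠ 0) (ht : timeVar z = 0) :
    ∀ᶠ w in 𝓝 z, timeCut w = 0 := by
  have h1 : timeRatio z < 0 := by rw [timeRatio, ht]; norm_num
  filter_upwards [(contDiffAt_timeRatio hz).continuousAt.eventually_lt_const h1] with w hw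
  exact Real.smoothTransition.zero_of_nonpos hw.le

theorem timeCut_eventually_eq_one {z : Pt d} (hz : z ≠ 0) (hx : spaceVar z = 0) :
    ∀ᶠ w in 𝓝 z, timeCut w = 1 := by
  have ht : timeVar z ≠ 0 := (spaceVar_ne_or_timeVar_ne hz).resolve_left (not_not.2 hx)
  have h0 : parNorm z ^ 2 = |timeVar z| := by
    rw [parNorm, hx, norm_zero, Real.sq_sqrt (by positivity),
      show (0 : ℝ) ^ 4 + 4 * timeVar z ^ 2 = (2 * |timeVar z|) ^ 2 by rw [mul_pow, sq_abs]; ring,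
      Real.sqrt_sq (by positivity)]
    ring
  have h1 : 1 < timeRatio z := by
    rw [timeRatio, h0, div_pow, sq_abs, div_self (pow_ne_zero 2 ht)]
    norm_num
  filter_upwards [(contDiffAt_timeRatio hz).continuousAt.eventually_const_lt h1] with w hw
  exact Real.smoothTransition.one_of_one_le hw.le

/-- The part of `σ` away from `τ = 0`, divided by `|τ|^{1/2}`. -/
def timePart (σ : Pt d → ℝ) (ζ : Pt d) : ℝ := σ ζ * timeCut ζ / halfTimeSymbol ζ

/-- The coefficient of `ξᵢ` in the part of `σ` away from the `τ`-axis. -/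
def spacePart (σ : Pt d → ℝ) (i : Fin d) (ζ : Pt d) : ℝ :=
  σ ζ * (1 - timeCut ζ) * ζ i.castSucc / ‖spaceVar ζ‖ ^ 2

theorem halfTimeSymbol_dil {r : ℝ} (hr : 0 ≤ r) (z : Pt d) :
    halfTimeSymbol (dil r z) = r * halfTimeSymbol z := by
  rw [halfTimeSymbol, timeVar_dil, abs_mul, abs_of_nonneg (by positivity),
    Real.sqrt_mul (by positivity), Real.sqrt_sq hr, halfTimeSymbol]

theorem contDiffAt_halfTimeSymbol {z : Pt d} (ht : timeVar z ≠ 0) :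
    ContDiffAt ℝ ∞ halfTimeSymbol z :=
  ((contDiffAt_abs ht).comp z (contDiff_timeVar.contDiffAt.of_le le_top)).sqrt (abs_pos.2 ht).ne'

/-- The quotient is smooth because the cutoff vanishes near the zeros of the denominator. -/
theorem homSymbol_timePart {σ : Pt d → ℝ} (hσ : HomSymbol 1 σ) : HomSymbol 0 (timePart σ) where
  smooth z hz := by
    by_cases ht : timeVar z = 0
    · refine (contDiffAt_const (c := (0 : ℝ))).congr_of_eventuallyEq ?_
      filter_upwards [timeCut_eventually_eq_zero hz ht] with w hw
      rw [timePart, hw, mul_zero, zero_div]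
    · exact ((hσ.smooth z hz).mul (homSymbol_timeCut.smooth z hz)).div
        (contDiffAt_halfTimeSymbol ht) (Real.sqrt_pos.2 (abs_pos.2 ht)).ne'
  hom r hr z := by
    rw [timePart, hσ.hom r hr, homSymbol_timeCut.hom r hr, halfTimeSymbol_dil hr.le, zpow_zero,
      zpow_one, one_mul, one_mul, mul_assoc, mul_div_mul_left _ _ hr.ne', timePart]

/-- The quotient is smooth because `1 - timeCut` vanishes near the zeros of the denominator. -/
theorem homSymbol_spacePart {σ : Pt d → ℝ} (hσ : HomSymbol 1 σ) (i : Fin d) :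
    HomSymbol 0 (spacePart σ i) where
  smooth z hz := by
    by_cases hx : spaceVar z = 0
    · refine (contDiffAt_const (c := (0 : ℝ))).congr_of_eventuallyEq ?_
      filter_upwards [timeCut_eventually_eq_one hz hx] with w hw
      rw [spacePart, hw, sub_self, mul_zero, zero_mul, zero_div]
    · exact (((hσ.smooth z hz).mul (contDiffAt_const.sub (homSymbol_timeCut.smooth z hz))).mul
        ((homSymbol_spaceVar i).smooth z hz)).div
        (contDiff_norm_sq_spaceVar.contDiffAt.of_le le_top)
        (pow_ne_zero 2 (norm_ne_zero_iff.2 hx))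
  hom r hr z := by
    rw [spacePart, hσ.hom r hr, homSymbol_timeCut.hom r hr, (homSymbol_spaceVar i).hom r hr,
      spaceVar_dil, norm_smul, Real.norm_of_nonneg hr.le, zpow_zero, zpow_one, one_mul, one_mul,
      mul_pow, show r * σ z * (1 - timeCut z) * (r * z i.castSucc)
        = r ^ 2 * (σ z * (1 - timeCut z) * z i.castSucc) by ring,
      mul_div_mul_left _ _ (by positivity), spacePart]

/-- A symbol of degree one is controlled by the symbols of `D^t_{1/2}` and of the spatial
gradient. -/
theorem eq_timePart_add_spacePart {σ : Pt d → ℝ} (hσ : HomSymbol 1 σ) (ζ : Pt d) :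
    σ ζ = timePart σ ζ * halfTimeSymbol ζ + ∑ i : Fin d, spacePart σ i ζ * ζ i.castSucc := by
  rcases eq_or_ne ζ 0 with rfl | hζ
  · simp [timePart, spacePart, hσ.apply_zero]
  have h1 : timePart σ ζ * halfTimeSymbol ζ = σ ζ * timeCut ζ := by
    by_cases ht : timeVar ζ = 0
    · rw [timePart, (timeCut_eventually_eq_zero hζ ht).self_of_nhds]; simp
    · have : halfTimeSymbol ζ ≠ 0 := (Real.sqrt_pos.2 (abs_pos.2 ht)).ne'
      rw [timePart, div_mul_cancel₀ _ this]
  have h2 : ∑ i : Fin d, spacePart σ i ζ * ζ i.castSucc = σ ζ * (1 - timeCut ζ) := by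
    by_cases hx : spaceVar ζ = 0
    · simp only [spacePart, (timeCut_eventually_eq_one hζ hx).self_of_nhds]; simp
    · have h3 : ‖spaceVar ζ‖ ^ 2 = ∑ i : Fin d, ζ i.castSucc ^ 2 := by
        rw [EuclideanSpace.norm_sq_eq]
        simp [spaceVar_apply]
      have h4 : ‖spaceVar ζ‖ ^ 2 ≠ 0 := pow_ne_zero 2 (norm_ne_zero_iff.2 hx)
      have h5 : ∀ i : Fin d, spacePart σ i ζ * ζ i.castSucc
          = σ ζ * (1 - timeCut ζ) / ‖spaceVar ζ‖ ^ 2 * ζ i.castSucc ^ 2 := fun i => by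
        rw [spacePart]; ring
      simp only [h5]
      rw [← Finset.mul_sum, ← h3, div_mul_cancel₀ _ h4]
  rw [h1, h2]
  ring

end Parabolic

end

/-! ### Removing low frequencies -/

noncomputable section

namespace Parabolic

open Filter Topology

variable {d e : ℕ}

theorem continuous_pairingWeight : Continuous (pairingWeight : Pt d → ℝ) := by
  have h1 : Continuous fun z : Pt d => ‖spaceVar z‖ := continuous_spaceVar.norm
  have h2 : Continuous fun z : Pt d => √|timeVar z| := continuous_timeVar.abs.sqrt
  unfold pairingWeight
  refine (Continuous.div (by fun_prop) (by fun_prop) fun z => ?_).add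
    (Continuous.div (by fun_prop) (by fun_prop) fun z => ?_) <;> positivity

theorem pairingWeight_pos (z : Pt d) : 0 < pairingWeight z := by
  unfold pairingWeight
  positivity

theorem Admissible.aestronglyMeasurable {f : Pt d → ℂ} (hf : Admissible f) :
    AEStronglyMeasurable f := by
  have h1 : f = fun z => ((pairingWeight z)⁻¹ : ℂ) * ((pairingWeight z : ℂ) * f z) := by
    ext z
    have : (pairingWeight z : ℂ) ≠ 0 := by exact_mod_cast (pairingWeight_pos z).ne'
    rw [inv_mul_cancel_left₀ this]
  rw [h1]
  refine AEStronglyMeasurable.mul ?_ (Integrable.aestronglyMeasurable hf)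
  refine (Continuous.inv₀ (Complex.continuous_ofReal.comp continuous_pairingWeight)
    fun z => ?_).aestronglyMeasurable
  exact Complex.ofReal_ne_zero.2 (pairingWeight_pos z).ne'

theorem Admissible.integrable_norm {f : Pt d → ℂ} (hf : Admissible f) :
    Integrable fun z => ‖f z‖ * pairingWeight z := by
  refine (Integrable.norm hf).congr (Eventually.of_forall fun z => ?_)
  simp only
  rw [norm_mul, Complex.norm_real, Real.norm_of_nonneg (pairingWeight_pos z).le, mul_comm]

theorem Admissible.integrable_mul {f g : Pt d → ℂ} (hf : Admissible f)
    (hg : AEStronglyMeasurable g) {C : ℝ} (hC : ∀ z, ‖g z‖ ≤ C * pairingWeight z) :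
    Integrable fun z => f z * g z := by
  refine (hf.integrable_norm.const_mul C).mono' (hf.aestronglyMeasurable.mul hg)
    (Eventually.of_forall fun z => ?_)
  rw [norm_mul]
  calc ‖f z‖ * ‖g z‖ ≤ ‖f z‖ * (C * pairingWeight z) := by gcongr; exact hC z
    _ = _ := by ring

theorem inv_gauge_pow_le_pairingWeight (z : Pt d) :
    1 / (1 + gauge z) ^ (d + 3) ≤ pairingWeight z := by
  rw [pairingWeight, gauge, ← add_assoc]
  exact le_add_of_nonneg_right (by positivity)

theorem Admissible.integrable_mul_schwartz {f : Pt d → ℂ} (hf : Admissible f) (φ : 𝓢(Pt d, ℂ)) :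
    Integrable fun z => f z * φ z := by
  obtain ⟨C, hC0, hC⟩ := exists_gauge_decay φ (d + 3)
  refine hf.integrable_mul φ.continuous.aestronglyMeasurable (C := C) fun z => ?_
  have hg := gauge_nonneg z
  calc ‖φ z‖ ≤ C * (1 / (1 + gauge z) ^ (d + 3)) := by
        rw [mul_one_div, le_div_iff₀ (by positivity), mul_comm]
        exact hC z
    _ ≤ _ := by gcongr; exact inv_gauge_pow_le_pairingWeight z

theorem fourierMul_add_symbol {a b : Pt d → ℝ} {φ : 𝓢(Pt d, ℂ)}
    (ha : Integrable fun ζ => (a ζ : ℂ) * (𝓕 φ : 𝓢(Pt d, ℂ)) ζ)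
    (hb : Integrable fun ζ => (b ζ : ℂ) * (𝓕 φ : 𝓢(Pt d, ℂ)) ζ) (z : Pt d) :
    fourierMul (fun ζ => a ζ + b ζ) φ z = fourierMul a φ z + fourierMul b φ z := by
  rw [fourierMul_apply, fourierMul_apply, fourierMul_apply,
    ← integral_add (integrable_char_smul z ha) (integrable_char_smul z hb)]
  refine integral_congr_ae (Eventually.of_forall fun ζ => ?_)
  simp only [Complex.ofReal_add, add_mul, smul_add]

/-- The setting in which low frequencies are removed: frequencies are measured by their projection
`π` to `ℝᵉ × ℝ`, which has the adjoint `ι`, and `V` is the decay of Schwartz functions in the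
directions which `ι` does not reach. The condition `le_pairingWeight` matches the decay of low
frequency parts with the integrability of functions in the class `Admissible`, and `memLp` does the
same for functions in `Lᵖ`. -/
structure LowFrequency (π : Pt d →L[ℝ] Pt e) (ι : Pt e →L[ℝ] Pt d) (V : Pt d → ℝ) : Prop where
  adjoint : ∀ ζ v, inner ℝ (π ζ) v = inner ℝ ζ (ι v)
  nonneg : ∀ z, 0 ≤ V z
  decay : ∀ (φ : 𝓢(Pt d, ℂ)) (N : ℕ), ∃ W : ℝ, 0 ≤ W ∧ ∀ z w,
    ‖φ (z - ι w)‖ ≤ W * V z * (1 + gauge (π z - w)) ^ (-(N : ℝ))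
  le_pairingWeight : ∀ z, V z / (1 + gauge (π z)) ^ (e + 3) ≤ pairingWeight z
  memLp : ∀ q : ℝ≥0∞, 1 < q → q < ∞ → MemLp (fun z => V z / (1 + gauge (π z)) ^ (e + 2)) q

variable {π : Pt d →L[ℝ] Pt e} {ι : Pt e →L[ℝ] Pt d} {V : Pt d → ℝ} {σ : Pt e → ℝ}

/-- The symbol `σ` on the low frequencies. -/
def lowSymbol (σ : Pt e → ℝ) (π : Pt d →L[ℝ] Pt e) (r : ℝ) (ζ : Pt d) : ℝ :=
  σ (π ζ) * chi (dil r (π ζ))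

theorem HomSymbol.integrable_comp (hσ : HomSymbol 1 σ) (π : Pt d →L[ℝ] Pt e) (φ : 𝓢(Pt d, ℂ)) :
    Integrable fun ζ => (σ (π ζ) : ℂ) * (𝓕 φ : 𝓢(Pt d, ℂ)) ζ := by
  obtain ⟨B, hB0, hB⟩ := hσ.exists_linear_bound
  refine integrable_mul_fourier (m := fun ζ => σ (π ζ)) (B := B * (1 + ‖π‖)) (k := 1)
    (hσ.measurable.comp π.continuous.measurable) (fun ζ => (hB _).trans ?_) φ
  rw [pow_one, mul_assoc]
  gcongr
  have := π.le_opNorm ζ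
  nlinarith [norm_nonneg ζ, norm_nonneg π]

theorem HomSymbol.integrable_lowSymbol (hσ : HomSymbol 1 σ) (π : Pt d →L[ℝ] Pt e) (r : ℝ)
    (φ : 𝓢(Pt d, ℂ)) :
    Integrable fun ζ => (lowSymbol σ π r ζ : ℂ) * (𝓕 φ : 𝓢(Pt d, ℂ)) ζ := by
  refine (hσ.integrable_comp π φ).norm.mono' ?_ (Eventually.of_forall fun ζ => ?_)
  · refine Measurable.aestronglyMeasurable ?_
    refine (Complex.measurable_ofReal.comp ?_).mul (𝓕 φ : 𝓢(Pt d, ℂ)).continuous.measurable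
    exact (hσ.measurable.comp π.continuous.measurable).mul
      (chi_contDiff.continuous.comp ((dil r).continuous.comp π.continuous)).measurable
  · rw [norm_mul, norm_mul, Complex.norm_real, Complex.norm_real, lowSymbol, norm_mul]
    gcongr
    refine mul_le_of_le_one_right (norm_nonneg _) ?_
    rw [Real.norm_of_nonneg (chi_nonneg _)]
    exact chi_le_one _

theorem integrable_chi_mul (π : Pt d →L[ℝ] Pt e) (r : ℝ) (φ : 𝓢(Pt d, ℂ)) :
    Integrable fun ζ => (chi (dil r (π ζ)) : ℂ) * (𝓕 φ : 𝓢(Pt d, ℂ)) ζ := by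
  refine integrable_mul_fourier (m := fun ζ => chi (dil r (π ζ))) (B := 1) (k := 0)
    (chi_contDiff.continuous.comp ((dil r).continuous.comp π.continuous)).measurable
    (fun ζ => ?_) φ
  rw [abs_of_nonneg (chi_nonneg _), pow_zero, mul_one]
  exact chi_le_one _

theorem fourierMul_eq_cut_add_low (hσ : HomSymbol 1 σ) {r : ℝ} {φ Φ : 𝓢(Pt d, ℂ)}
    (hΦ : ∀ ζ, (𝓕 Φ : 𝓢(Pt d, ℂ)) ζ
      = ((1 - chi (dil r (π ζ)) : ℝ) : ℂ) * (𝓕 φ : 𝓢(Pt d, ℂ)) ζ) (z : Pt d) :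
    fourierMul (fun ζ => σ (π ζ)) φ z
      = fourierMul (fun ζ => σ (π ζ)) Φ z + fourierMul (lowSymbol σ π r) φ z := by
  have h1 : fourierMul (fun ζ => σ (π ζ)) Φ
      = fourierMul (fun ζ => σ (π ζ) - lowSymbol σ π r ζ) φ :=
    fourierMul_eq_of_fourier_eq hΦ fun ζ => Or.inr (by rw [lowSymbol]; ring)
  have h2 : Integrable fun ζ => ((σ (π ζ) - lowSymbol σ π r ζ : ℝ) : ℂ) *
      (𝓕 φ : 𝓢(Pt d, ℂ)) ζ := by
    refine ((hσ.integrable_comp π φ).sub (hσ.integrable_lowSymbol π r φ)).congr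
      (Eventually.of_forall fun ζ => ?_)
    simp only [Pi.sub_apply, Complex.ofReal_sub, sub_mul]
  rw [h1, ← fourierMul_add_symbol h2 (hσ.integrable_lowSymbol π r φ)]
  simp only [sub_add_cancel]

theorem eq_cut_add_low {r : ℝ} {φ Φ : 𝓢(Pt d, ℂ)}
    (hΦ : ∀ ζ, (𝓕 Φ : 𝓢(Pt d, ℂ)) ζ
      = ((1 - chi (dil r (π ζ)) : ℝ) : ℂ) * (𝓕 φ : 𝓢(Pt d, ℂ)) ζ) (z : Pt d) :
    φ z = Φ z + fourierMul (fun ζ => chi (dil r (π ζ))) φ z := by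
  have hφi : Integrable (𝓕 φ : 𝓢(Pt d, ℂ)) := SchwartzMap.integrable _
  have h2 : Integrable fun ζ => ((1 - chi (dil r (π ζ)) : ℝ) : ℂ) * (𝓕 φ : 𝓢(Pt d, ℂ)) ζ := by
    refine (hφi.sub (integrable_chi_mul π r φ)).congr (Eventually.of_forall fun ζ => ?_)
    simp only [Pi.sub_apply, Complex.ofReal_sub, sub_mul, Complex.ofReal_one, one_mul]
  rw [coe_eq_fourierMul hΦ, ← fourierMul_add_symbol h2 (integrable_chi_mul π r φ)]
  simp only [sub_add_cancel, fourierMul_one]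

theorem exists_cut (π : Pt d →L[ℝ] Pt e) {r : ℝ} (hr : 0 < r) (φ : 𝓢(Pt d, ℂ)) :
    ∃ Φ : 𝓢(Pt d, ℂ), ∀ ζ, (𝓕 Φ : 𝓢(Pt d, ℂ)) ζ
      = ((1 - chi (dil r (π ζ)) : ℝ) : ℂ) * (𝓕 φ : 𝓢(Pt d, ℂ)) ζ := by
  refine exists_fourier_eq_mul (a := fun ζ => 1 - chi (dil r (π ζ))) ?_ φ
  have h1 : HomSymbol 0 fun _ : Pt e => (1 : ℝ) := ⟨fun _ _ => contDiffAt_const, by simp⟩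
  have h2 := (h1.hasTemperateGrowth_cut hr).comp π.hasTemperateGrowth
  simpa only [Function.comp_def, mul_one] using h2

namespace LowFrequency

/-- The low frequency part of `σ φ` decays at the rate that functions in the class `Admissible`
are integrated against. -/
theorem exists_low_bound (hL : LowFrequency π ι V) (hσ : HomSymbol 1 σ) (φ : 𝓢(Pt d, ℂ)) :
    ∃ C : ℝ, 0 ≤ C ∧ ∀ z, ∀ r : ℝ, 1 ≤ r →
      ‖fourierMul (lowSymbol σ π r) φ z‖ ≤ C * V z / (r + gauge (π z)) ^ (e + 3) := by
  obtain ⟨C, hC0, hC⟩ := exists_low_frequency_bound hσ π ι hL.adjoint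
  obtain ⟨W, hW0, hW⟩ := hL.decay φ (2 * e + 2 + 5)
  refine ⟨C * W, by positivity, fun z r hr => ?_⟩
  rw [mul_assoc]
  exact hC φ (W * V z) z (mul_nonneg hW0 (hL.nonneg z)) (hW z) r hr

/-- The low frequency part of `φ` itself. It decays more slowly in `r` than that of `σ φ`, which is
enough to pair it with a function in `Lᵖ`. -/
theorem exists_low_bound_one (hL : LowFrequency π ι V) (φ : 𝓢(Pt d, ℂ)) :
    ∃ C : ℝ, 0 ≤ C ∧ ∀ z, ∀ r : ℝ, 1 ≤ r →
      ‖fourierMul (fun ζ => chi (dil r (π ζ))) φ z‖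
        ≤ C * V z * (r / (r + gauge (π z)) ^ (e + 3)) := by
  obtain ⟨θ, hθ⟩ := exists_chi_schwartz (d := e)
  obtain ⟨C, hC0, hC⟩ := norm_kernel_integral_le θ 1
  obtain ⟨W, hW0, hW⟩ := hL.decay φ (2 * e + 1 + 5)
  refine ⟨C * W, by positivity, fun z r hr => ?_⟩
  rw [fourierMul_eq_integral_kernel θ ((dil r).comp π) (ι.comp (dil r))
    (fun ζ v => by
      rw [ContinuousLinearMap.comp_apply, ContinuousLinearMap.comp_apply, inner_dil, hL.adjoint])
    (fun ζ => by rw [hθ]; rfl)]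
  have h := hC (fun w => φ (z - ι w)) (W * V z) (π z) (mul_nonneg hW0 (hL.nonneg z)) (hW z) r hr
  rw [pow_one, show e + 2 + 1 = e + 3 from rfl, ← mul_assoc] at h
  exact h

theorem low_le_pairingWeight (hL : LowFrequency π ι V) {C r : ℝ} (hC0 : 0 ≤ C) (hr : 1 ≤ r)
    (z : Pt d) : C * V z / (r + gauge (π z)) ^ (e + 3) ≤ C * pairingWeight z := by
  have hg := gauge_nonneg (π z)
  have hV := hL.nonneg z
  calc C * V z / (r + gauge (π z)) ^ (e + 3) ≤ C * V z / (1 + gauge (π z)) ^ (e + 3) := by gcongr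
    _ = C * (V z / (1 + gauge (π z)) ^ (e + 3)) := by rw [mul_div_assoc]
    _ ≤ _ := by gcongr; exact hL.le_pairingWeight z

theorem integrable_mul_low (hL : LowFrequency π ι V) (hσ : HomSymbol 1 σ) {f : Pt d → ℂ}
    (hf : Admissible f) (φ : 𝓢(Pt d, ℂ)) {r : ℝ} (hr : 1 ≤ r) :
    Integrable fun z => f z * fourierMul (lowSymbol σ π r) φ z := by
  obtain ⟨C, hC0, hC⟩ := hL.exists_low_bound hσ φ
  exact hf.integrable_mul
    (continuous_fourierMul (hσ.integrable_lowSymbol π r φ)).aestronglyMeasurable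
    fun z => (hC z r hr).trans (hL.low_le_pairingWeight hC0 hr z)

theorem integrable_mul_cut (hσ : HomSymbol 1 σ) {f : Pt d → ℂ} (hf : Admissible f) {r : ℝ}
    (hr : 0 < r) {φ Φ : 𝓢(Pt d, ℂ)} (hΦ : ∀ ζ, (𝓕 Φ : 𝓢(Pt d, ℂ)) ζ
      = ((1 - chi (dil r (π ζ)) : ℝ) : ℂ) * (𝓕 φ : 𝓢(Pt d, ℂ)) ζ) :
    Integrable fun z => f z * fourierMul (fun ζ => σ (π ζ)) Φ z := by
  obtain ⟨Ψ, hΨ⟩ := exists_fourier_eq_mul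
    ((hσ.hasTemperateGrowth_cut hr).comp π.hasTemperateGrowth) φ
  have h1 : fourierMul (fun ζ => σ (π ζ)) Φ = Ψ := by
    rw [coe_eq_fourierMul hΨ]
    exact fourierMul_eq_of_fourier_eq hΦ fun ζ => Or.inr (mul_comm _ _)
  rw [h1]
  exact hf.integrable_mul_schwartz Ψ

theorem tendsto_integral_low (hL : LowFrequency π ι V) (hσ : HomSymbol 1 σ) {f : Pt d → ℂ}
    (hf : Admissible f) (φ : 𝓢(Pt d, ℂ)) :
    Tendsto (fun k : ℕ => ∫ z, f z * fourierMul (lowSymbol σ π (2 ^ k)) φ z) atTop (𝓝 0) := by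
  obtain ⟨C, hC0, hC⟩ := hL.exists_low_bound hσ φ
  have h2 : ∀ k : ℕ, (1 : ℝ) ≤ 2 ^ k := fun k => one_le_pow₀ one_le_two
  rw [← integral_zero (Pt d) ℂ (μ := volume)]
  refine tendsto_integral_of_dominated_convergence (fun z => C * (‖f z‖ * pairingWeight z))
    (fun k => (hL.integrable_mul_low hσ hf φ (h2 k)).aestronglyMeasurable)
    (hf.integrable_norm.const_mul C) (fun k => Eventually.of_forall fun z => ?_)
    (Eventually.of_forall fun z => ?_)
  · rw [norm_mul, mul_left_comm]
    gcongr
    exact (hC z _ (h2 k)).trans (hL.low_le_pairingWeight hC0 (h2 k) z)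
  · have hg := gauge_nonneg (π z)
    have hV := hL.nonneg z
    have h3 : Tendsto (fun k : ℕ => ‖f z‖ * (C * V z) * ((2 : ℝ) ^ k)⁻¹) atTop
        (𝓝 (‖f z‖ * (C * V z) * 0)) :=
      (tendsto_pow_atTop_atTop_of_one_lt one_lt_two).inv_tendsto_atTop.const_mul _
    rw [mul_zero] at h3
    refine squeeze_zero_norm (fun k => ?_) h3
    rw [norm_mul, mul_assoc]
    gcongr
    refine (hC z _ (h2 k)).trans ?_
    rw [div_eq_mul_inv]
    gcongr
    calc (2 : ℝ) ^ k ≤ 2 ^ k + gauge (π z) := by linarith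
      _ ≤ _ := le_self_pow₀ (by linarith [h2 k]) (by omega)

theorem tendsto_integral_low_one (hL : LowFrequency π ι V) {p : ℝ≥0∞} (hp1 : 1 < p) (hp : p < ∞)
    {H : Pt d → ℂ} (hH : MemLp H p) (φ : 𝓢(Pt d, ℂ)) :
    Tendsto (fun k : ℕ => ∫ z, H z * fourierMul (fun ζ => chi (dil (2 ^ k) (π ζ))) φ z) atTop
      (𝓝 0) := by
  obtain ⟨q, hpq, hq1, hq⟩ := exists_holderConjugate hp1 hp
  obtain ⟨C, hC0, hC⟩ := hL.exists_low_bound_one φ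
  have h2 : ∀ k : ℕ, (1 : ℝ) ≤ 2 ^ k := fun k => one_le_pow₀ one_le_two
  have hdom : Integrable fun z => ‖H z‖ * (V z / (1 + gauge (π z)) ^ (e + 2)) :=
    hH.norm.integrable_mul (hL.memLp q hq1 hq)
  rw [← integral_zero (Pt d) ℂ (μ := volume)]
  refine tendsto_integral_of_dominated_convergence
    (fun z => C * (‖H z‖ * (V z / (1 + gauge (π z)) ^ (e + 2))))
    (fun k => hH.aestronglyMeasurable.mul
      (continuous_fourierMul (integrable_chi_mul π _ φ)).aestronglyMeasurable)
    (hdom.const_mul C) (fun k => Eventually.of_forall fun z => ?_)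
    (Eventually.of_forall fun z => ?_)
  · have hg := gauge_nonneg (π z)
    have hV := hL.nonneg z
    have h3 := h2 k
    rw [norm_mul, mul_left_comm]
    gcongr
    refine (hC z _ h3).trans ?_
    rw [mul_assoc, div_eq_mul_inv (V z)]
    gcongr
    rw [← one_div, div_le_div_iff₀ (by positivity) (by positivity), one_mul, pow_succ' _ (e + 2)]
    gcongr
    · linarith
  · have hg := gauge_nonneg (π z)
    have hV := hL.nonneg z
    have h3 : Tendsto (fun k : ℕ => ‖H z‖ * (C * V z) * ((2 : ℝ) ^ k)⁻¹) atTop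
        (𝓝 (‖H z‖ * (C * V z) * 0)) :=
      (tendsto_pow_atTop_atTop_of_one_lt one_lt_two).inv_tendsto_atTop.const_mul _
    rw [mul_zero] at h3
    refine squeeze_zero_norm (fun k => ?_) h3
    have h4 := h2 k
    rw [norm_mul, mul_assoc]
    gcongr
    refine (hC z _ h4).trans ?_
    gcongr
    rw [← one_div, div_le_div_iff₀ (by positivity) (by positivity), one_mul]
    calc (2 : ℝ) ^ k * 2 ^ k = (2 ^ k) ^ 2 := by ring
      _ ≤ (2 ^ k) ^ (e + 3) := pow_le_pow_right₀ h4 (by omega)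
      _ ≤ _ := by gcongr; linarith

/-- An identity between distributions may be tested on functions without low frequencies. Symbols
homogeneous of degree zero are smooth on the remaining frequencies, so that their multiplier
operators preserve the Schwartz functions in question. -/
theorem integral_eq_of_forall_cut (hL : LowFrequency π ι V) (hσ : HomSymbol 1 σ) {p : ℝ≥0∞}
    (hp1 : 1 < p) (hp : p < ∞) {f : Pt d → ℂ} (hf : Admissible f) {H : Pt d → ℂ}
    (hH : MemLp H p) (φ : 𝓢(Pt d, ℂ))
    (h : ∀ (r : ℝ) (Φ : 𝓢(Pt d, ℂ)), 1 ≤ r → (∀ ζ, (𝓕 Φ : 𝓢(Pt d, ℂ)) ζ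
      = ((1 - chi (dil r (π ζ)) : ℝ) : ℂ) * (𝓕 φ : 𝓢(Pt d, ℂ)) ζ) →
      ∫ z, f z * fourierMul (fun ζ => σ (π ζ)) Φ z = ∫ z, H z * Φ z) :
    ∫ z, f z * fourierMul (fun ζ => σ (π ζ)) φ z = ∫ z, H z * φ z := by
  obtain ⟨q, hpq, hq1, hq⟩ := exists_holderConjugate hp1 hp
  have h2 : ∀ k : ℕ, (1 : ℝ) ≤ 2 ^ k := fun k => one_le_pow₀ one_le_two
  have hΦ := fun k : ℕ => exists_cut π (r := 2 ^ k) (by positivity) φ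
  choose Φ hΦ using hΦ
  have hHs : ∀ ψ : 𝓢(Pt d, ℂ), Integrable fun z => H z * ψ z := fun ψ =>
    integrable_mul_of_holderConjugate (q := q) hH (ψ.memLp q volume)
  have hlow : ∀ k : ℕ, ∀ z, fourierMul (fun ζ => chi (dil (2 ^ k) (π ζ))) φ z = φ z - Φ k z :=
    fun k z => by rw [eq_cut_add_low (hΦ k) z]; ring
  have h3 : ∀ k : ℕ, (∫ z, f z * fourierMul (fun ζ => σ (π ζ)) φ z)
      - ∫ z, f z * fourierMul (lowSymbol σ π (2 ^ k)) φ z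
      = (∫ z, H z * φ z)
        - ∫ z, H z * fourierMul (fun ζ => chi (dil (2 ^ k) (π ζ))) φ z := fun k => by
    have h4 : ∫ z, f z * fourierMul (fun ζ => σ (π ζ)) φ z
        = (∫ z, f z * fourierMul (fun ζ => σ (π ζ)) (Φ k) z)
          + ∫ z, f z * fourierMul (lowSymbol σ π (2 ^ k)) φ z := by
      rw [← integral_add (integrable_mul_cut hσ hf (by positivity) (hΦ k))
        (hL.integrable_mul_low hσ hf φ (h2 k))]
      simp only [← mul_add, ← fourierMul_eq_cut_add_low hσ (hΦ k)]
    have h5 : ∫ z, H z * fourierMul (fun ζ => chi (dil (2 ^ k) (π ζ))) φ z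
        = (∫ z, H z * φ z) - ∫ z, H z * Φ k z := by
      rw [← integral_sub (hHs φ) (hHs (Φ k))]
      simp only [hlow, mul_sub]
    rw [h4, h5, h _ (Φ k) (h2 k) (hΦ k)]
    ring
  have h6 := (tendsto_const_nhds (x := ∫ z, f z * fourierMul (fun ζ => σ (π ζ)) φ z)
    (f := (atTop : Filter ℕ))).sub (hL.tendsto_integral_low hσ hf φ)
  have h7 := (tendsto_const_nhds (x := ∫ z, H z * φ z)
    (f := (atTop : Filter ℕ))).sub (hL.tendsto_integral_low_one hp1 hp hH φ)
  rw [sub_zero] at h6 h7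
  exact tendsto_nhds_unique (h6.congr h3) h7

end LowFrequency

end Parabolic

end

/-! ### Isotropic and temporal frequency cutoffs -/

noncomputable section

namespace Parabolic

open Filter Topology

variable {d : ℕ}

theorem rpow_neg_natCast_eq {a : ℝ} (ha : 0 ≤ a) (N : ℕ) : a ^ (-(N : ℝ)) = (a ^ N)⁻¹ := by
  rw [Real.rpow_neg ha, Real.rpow_natCast]

/-- Isotropic cutoffs are matched with the first summand of `pairingWeight`. -/
theorem lowFrequency_id :
    LowFrequency (ContinuousLinearMap.id ℝ (Pt d)) (ContinuousLinearMap.id ℝ (Pt d))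
      (fun _ => 1) where
  adjoint _ _ := rfl
  nonneg _ := zero_le_one
  decay φ N := by
    obtain ⟨W, hW0, hW⟩ := exists_gauge_decay φ N
    refine ⟨W, hW0, fun z w => ?_⟩
    have hg := gauge_nonneg (z - w)
    simp only [ContinuousLinearMap.id_apply, mul_one]
    rw [rpow_neg_natCast_eq (by positivity), ← div_eq_mul_inv, le_div_iff₀ (by positivity),
      mul_comm]
    exact hW _
  le_pairingWeight := inv_gauge_pow_le_pairingWeight
  memLp q hq1 hq := by
    have hqr := one_lt_toReal hq1 hq
    have hc : Continuous fun z : Pt d => 1 / (1 + gauge z) ^ (d + 2) :=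
      Continuous.div (by fun_prop) ((continuous_const.add continuous_gauge).pow _) fun z => by
        have := gauge_nonneg z
        positivity
    refine (integrable_norm_rpow_iff hc.aestronglyMeasurable (one_pos.trans hq1).ne' hq.ne).1 ?_
    refine (integrable_gauge (d := d) (s := q.toReal * (d + 2)) (by nlinarith)).congr
      (Eventually.of_forall fun z => ?_)
    have hg := gauge_nonneg z
    simp only
    rw [Real.norm_of_nonneg (by positivity), one_div, ← rpow_neg_natCast_eq (by positivity),
      ← Real.rpow_mul (by positivity)]
    congr 1
    push_cast
    ring

/-- The projection to the time axis. -/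
def timeProj : Pt d →L[ℝ] Pt 0 :=
  LinearMap.toContinuousLinearMap
    { toFun := fun z => WithLp.toLp 2 fun _ => timeVar z
      map_add' := fun x y => by ext i; simp
      map_smul' := fun c x => by ext i; simp [timeVar] }

/-- The inclusion of the time axis. -/
def timeIncl : Pt 0 →L[ℝ] Pt d :=
  LinearMap.toContinuousLinearMap
    { toFun := fun w => WithLp.toLp 2 fun i => if i = Fin.last d then timeVar w else 0
      map_add' := fun x y => by ext i; by_cases h : i = Fin.last d <;> simp [h]
      map_smul' := fun c x => by ext i; by_cases h : i = Fin.last d <;> simp [h, timeVar] }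

@[simp] theorem timeVar_timeProj (z : Pt d) : timeVar (timeProj z) = timeVar z := rfl

@[simp] theorem timeVar_timeIncl (w : Pt 0) : timeVar (timeIncl w : Pt d) = timeVar w := by
  change (if Fin.last d = Fin.last d then timeVar w else 0) = _
  rw [if_pos rfl]

@[simp] theorem spaceVar_timeIncl (w : Pt 0) : spaceVar (timeIncl w : Pt d) = 0 := by
  ext i
  change (if i.castSucc = Fin.last d then timeVar w else 0) = _
  rw [if_neg (Fin.castSucc_lt_last i).ne]
  rfl

theorem spaceVar_zero_dim (w : Pt 0) : spaceVar w = 0 := Subsingleton.elim _ _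

theorem gauge_zero_dim (w : Pt 0) : gauge w = √|timeVar w| := by
  rw [gauge, spaceVar_zero_dim, norm_zero, zero_add]

/-- Cutoffs in `τ` alone are matched with the second summand of `pairingWeight`. An isotropic cutoff
would not do here, because the half derivative in time of a Schwartz function decays no faster than
`|t|^{-3/2}` near the hyperplane `x = 0`. -/
theorem lowFrequency_time :
    LowFrequency (timeProj : Pt d →L[ℝ] Pt 0) timeIncl
      (fun z => ((1 + ‖spaceVar z‖) ^ (d + 1))⁻¹) where
  adjoint ζ v := by
    rw [inner_eq_split, inner_eq_split, spaceVar_zero_dim v, spaceVar_timeIncl, timeVar_timeIncl,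
      timeVar_timeProj, inner_zero_right, inner_zero_right]
  nonneg _ := by positivity
  decay φ N := by
    obtain ⟨W, hW0, hW⟩ := exists_gauge_decay φ (d + 1 + N)
    refine ⟨W, hW0, fun z w => ?_⟩
    have h := hW (z - timeIncl w)
    rw [gauge_zero_dim, rpow_neg_natCast_eq (by positivity), mul_assoc, ← mul_inv,
      ← div_eq_mul_inv, le_div_iff₀ (by positivity), timeVar_sub, timeVar_timeProj]
    rw [gauge, spaceVar_sub, spaceVar_timeIncl, sub_zero, timeVar_sub, timeVar_timeIncl] at h
    calc _ ≤ ‖φ (z - timeIncl w)‖ *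
          (1 + (‖spaceVar z‖ + √|timeVar z - timeVar w|)) ^ (d + 1 + N) := by
          rw [pow_add _ (d + 1) N]
          gcongr
          · linarith [Real.sqrt_nonneg |timeVar z - timeVar w|]
          · linarith [norm_nonneg (spaceVar z)]
      _ ≤ W := by rwa [mul_comm]
  le_pairingWeight z := by
    rw [pairingWeight, gauge_zero_dim, timeVar_timeProj, inv_eq_one_div, div_div]
    exact le_add_of_nonneg_left (by positivity)
  memLp q hq1 hq := by
    have hqr := one_lt_toReal hq1 hq
    have h1 : Continuous fun z : Pt d => ‖spaceVar z‖ := continuous_spaceVar.norm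
    have h2 : Continuous fun z : Pt d => gauge (timeProj z) :=
      continuous_gauge.comp timeProj.continuous
    have hc : Continuous fun z : Pt d =>
        ((1 + ‖spaceVar z‖) ^ (d + 1))⁻¹ / (1 + gauge (timeProj z)) ^ (0 + 2) :=
      Continuous.div (Continuous.inv₀ (by fun_prop) fun z => by positivity) (by fun_prop)
        fun z => by
          have := gauge_nonneg (timeProj z)
          positivity
    refine (integrable_norm_rpow_iff hc.aestronglyMeasurable (one_pos.trans hq1).ne' hq.ne).1 ?_
    refine (integrable_split_weight (d := d) (α := q.toReal * (d + 1)) (β := q.toReal * 2)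
      (by nlinarith) (by linarith)).congr (Eventually.of_forall fun z => ?_)
    simp only
    rw [gauge_zero_dim, timeVar_timeProj, Real.norm_of_nonneg (by positivity), div_eq_mul_inv,
      Real.mul_rpow (by positivity) (by positivity), ← rpow_neg_natCast_eq (by positivity),
      ← rpow_neg_natCast_eq (by positivity), ← Real.rpow_mul (by positivity),
      ← Real.rpow_mul (by positivity)]
    congr 2
    · push_cast; ring
    · push_cast; ring

theorem homSymbol_halfTimeSymbol_zero_dim : HomSymbol 1 (halfTimeSymbol : Pt 0 → ℝ) where
  smooth z hz := contDiffAt_halfTimeSymbol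
    ((spaceVar_ne_or_timeVar_ne hz).resolve_left fun h => h (spaceVar_zero_dim z))
  hom r hr z := by rw [halfTimeSymbol_dil hr.le, zpow_one]

theorem halfTimeSymbol_timeProj (ζ : Pt d) : halfTimeSymbol (timeProj ζ) = halfTimeSymbol ζ := rfl

/-- Away from the hyperplane `τ = 0` the product of `|τ|^{1/2}` and a smooth homogeneous symbol is
smooth. -/
theorem hasTemperateGrowth_timeCut {a : ℤ} {m : Pt d → ℝ} (hm : HomSymbol a m) {r : ℝ}
    (hr : 1 ≤ r) : Function.HasTemperateGrowth fun ζ : Pt d =>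
      (1 - chi (dil r (timeProj ζ))) * halfTimeSymbol ζ * m ζ := by
  have h1 := (homSymbol_halfTimeSymbol_zero_dim.hasTemperateGrowth_cut
    (one_pos.trans_le hr)).comp (timeProj (d := d)).hasTemperateGrowth
  have h2 := h1.mul (hm.hasTemperateGrowth_cut (r := 2 * r) (by linarith))
  refine (congrArg Function.HasTemperateGrowth (funext fun ζ => ?_)).mpr h2
  simp only [Function.comp_apply, Pi.mul_apply, halfTimeSymbol_timeProj]
  by_cases h : ‖dil r (timeProj ζ)‖ ≤ 1
  · rw [chi_eq_one h]; ring
  -- here `1 < r² |τ|`, so that `ζ` is in the range where the isotropic cutoff at `2r` vanishes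
  · have h3 : ‖dil r (timeProj ζ)‖ ≤ r ^ 2 * |timeVar ζ| := by
      refine (norm_le_split _).trans ?_
      rw [spaceVar_zero_dim, norm_zero, zero_add, timeVar_dil, timeVar_timeProj, abs_mul,
        abs_of_nonneg (by positivity)]
    have h4 : |timeVar (dil (2 * r) ζ)| ≤ ‖dil (2 * r) ζ‖ := abs_timeVar_le _
    rw [timeVar_dil, abs_mul, abs_of_nonneg (by positivity)] at h4
    have h5 : chi (dil (2 * r) ζ) = 0 := chi_eq_zero (by nlinarith)
    rw [h5]
    ring

/-- A spatial derivative is, up to the factor `2πi`, the Fourier multiplier `ξᵢ`. -/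
theorem exists_fderiv_eq_mul (φ : 𝓢(Pt d, ℂ)) (i : Fin d) :
    ∃ ψ : 𝓢(Pt d, ℂ), (∀ ζ, (𝓕 ψ : 𝓢(Pt d, ℂ)) ζ
        = (ζ i.castSucc : ℂ) * (𝓕 φ : 𝓢(Pt d, ℂ)) ζ) ∧
      ∀ z, fderiv ℝ φ z (EuclideanSpace.single i.castSucc 1) = 2 * Real.pi * Complex.I * ψ z := by
  set v : Pt d := EuclideanSpace.single i.castSucc 1 with hv
  have hc : (2 * Real.pi * Complex.I : ℂ) ≠ 0 := Complex.two_pi_I_ne_zero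
  have h1 := SchwartzMap.fourier_lineDerivOp_eq φ v
  refine ⟨(2 * Real.pi * Complex.I : ℂ)⁻¹ • LineDeriv.lineDerivOp v φ, fun ζ => ?_, fun z => ?_⟩
  · rw [FourierTransform.fourier_smul, h1, smul_smul, inv_mul_cancel₀ hc, one_smul,
      SchwartzMap.smulLeftCLM_apply_apply (by fun_prop), Complex.real_smul, hv,
      EuclideanSpace.inner_single_right]
    simp
  · rw [smul_apply, smul_eq_mul, mul_inv_cancel_left₀ hc]
    rfl

end Parabolic

end

/-! ### Comparing the distributions -/

noncomputable section

namespace Parabolic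

open Filter Topology

variable {d : ℕ} {p : ℝ≥0∞}

/-- The operator which extends a multiplier to `Lᵖ`, tested on functions with a cut off Fourier
transform. -/
theorem integral_transfer {m a b : Pt d → ℝ} {g h : Pt d → ℂ} {φ Φ Ψ : 𝓢(Pt d, ℂ)}
    (hh : ∀ φ : 𝓢(Pt d, ℂ), ∫ z, h z * φ z = ∫ z, g z * fourierMul (fun ζ => m (-ζ)) φ z)
    (hΦ : ∀ ζ, (𝓕 Φ : 𝓢(Pt d, ℂ)) ζ = (b ζ : ℂ) * (𝓕 φ : 𝓢(Pt d, ℂ)) ζ)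
    (hΨ : ∀ ζ, (𝓕 Ψ : 𝓢(Pt d, ℂ)) ζ = (a ζ : ℂ) * (𝓕 φ : 𝓢(Pt d, ℂ)) ζ)
    (hab : ∀ ζ, m (-ζ) * b ζ = a ζ) : ∫ z, h z * Φ z = ∫ z, g z * Ψ z := by
  rw [hh, coe_eq_fourierMul hΨ, fourierMul_eq_of_fourier_eq hΦ fun ζ => Or.inr (hab ζ)]

theorem norm_two_pi_I_inv_le : ‖(2 * Real.pi * Complex.I : ℂ)⁻¹‖ ≤ 1 := by
  have h := Real.pi_gt_three
  rw [norm_inv]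
  refine inv_le_one_of_one_le₀ ?_
  simp only [norm_mul, Complex.norm_I, Complex.norm_real, RCLike.norm_ofNat, mul_one,
    Real.norm_eq_abs]
  rw [abs_of_pos (by linarith)]
  linarith

theorem fourier_sum_apply {ι : Type*} (s : Finset ι) (ψ : ι → 𝓢(Pt d, ℂ)) (ζ : Pt d) :
    (𝓕 (∑ i ∈ s, ψ i) : 𝓢(Pt d, ℂ)) ζ = ∑ i ∈ s, (𝓕 (ψ i) : 𝓢(Pt d, ℂ)) ζ := by
  classical
  induction s using Finset.induction_on with
  | empty => simp [FourierTransform.fourier_zero]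
  | insert i s hi ih =>
    rw [Finset.sum_insert hi, Finset.sum_insert hi, FourierTransform.fourier_add, add_apply, ih]

theorem sum_schwartz_apply {ι : Type*} (s : Finset ι) (ψ : ι → 𝓢(Pt d, ℂ)) (z : Pt d) :
    (∑ i ∈ s, ψ i) z = ∑ i ∈ s, ψ i z := by
  classical
  induction s using Finset.induction_on with
  | empty => simp
  | insert i s hi ih => rw [Finset.sum_insert hi, Finset.sum_insert hi, add_apply, ih]

/-- The identity behind the bounds by `D^t_{1/2}` and `∇`, on a function `φ` without low
frequencies. -/
theorem integral_cut_eq_of_halfTime_of_fderiv {σ : Pt d → ℝ} (hσ : HomSymbol 1 σ)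
    {f h H₀ : Pt d → ℂ} {g H : Fin d → Pt d → ℂ} (hf : Admissible f)
    (hh : ∀ φ : 𝓢(Pt d, ℂ), ∫ z, f z * halfTime φ z = ∫ z, h z * φ z)
    (hg : ∀ (i : Fin d) (φ : 𝓢(Pt d, ℂ)),
      ∫ z, f z * fderiv ℝ φ z (EuclideanSpace.single i.castSucc 1) = - ∫ z, g i z * φ z)
    (hH₀ : ∀ φ : 𝓢(Pt d, ℂ),
      ∫ z, H₀ z * φ z = ∫ z, h z * fourierMul (fun ζ => timePart σ (-ζ)) φ z)
    (hH : ∀ (i : Fin d) (φ : 𝓢(Pt d, ℂ)),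
      ∫ z, H i z * φ z = ∫ z, g i z * fourierMul (fun ζ => spacePart σ i (-ζ)) φ z)
    {r : ℝ} (hr : 0 < r) {φ Φ : 𝓢(Pt d, ℂ)} (hΦ : ∀ ζ, (𝓕 Φ : 𝓢(Pt d, ℂ)) ζ
      = ((1 - chi (dil r ζ) : ℝ) : ℂ) * (𝓕 φ : 𝓢(Pt d, ℂ)) ζ) :
    ∫ z, f z * fourierMul (fun ζ => σ (-ζ)) Φ z
      = (∫ z, H₀ z * Φ z) + ∑ i, (2 * Real.pi * Complex.I : ℂ)⁻¹ * ∫ z, H i z * Φ z := by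
  obtain ⟨Ξ, hΞ⟩ := exists_fourier_eq_mul (hσ.comp_neg.hasTemperateGrowth_cut hr) φ
  obtain ⟨Ψ₀, hΨ₀⟩ := exists_fourier_eq_mul
    ((homSymbol_timePart hσ).comp_neg.hasTemperateGrowth_cut hr) φ
  have hΨ := fun i => exists_fourier_eq_mul
    ((homSymbol_spacePart hσ i).comp_neg.hasTemperateGrowth_cut hr) φ
  choose Ψ hΨ using hΨ
  have hψ := fun i => exists_fderiv_eq_mul (Ψ i) i
  choose ψ hψ hψ' using hψ
  have h1 : fourierMul (fun ζ => σ (-ζ)) Φ = Ξ := by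
    rw [coe_eq_fourierMul hΞ]
    exact fourierMul_eq_of_fourier_eq hΦ fun ζ => Or.inr (mul_comm _ _)
  -- the decomposition of `σ (-ζ)`, in which the coordinates `ξᵢ` change their sign
  have h2 : (Ξ + ∑ i, ψ i : 𝓢(Pt d, ℂ)) = halfTime Ψ₀ := by
    rw [halfTime_eq_fourierMul, fourierMul_eq_of_fourier_eq hΨ₀ fun ζ => Or.inr rfl]
    refine coe_eq_fourierMul fun ζ => ?_
    simp only [FourierTransform.fourier_add, add_apply, fourier_sum_apply, hΞ, hψ, hΨ, ← mul_assoc]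
    rw [← Finset.sum_mul, ← add_mul]
    congr 1
    norm_cast
    have h3 := eq_timePart_add_spacePart hσ (-ζ)
    rw [halfTimeSymbol_neg] at h3
    rw [h3, mul_add, Finset.mul_sum, add_assoc, ← Finset.sum_add_distrib]
    rw [Finset.sum_eq_zero fun i _ => by simp; ring]
    ring
  have h4 : ∀ i, ∫ z, f z * ψ i z = -((2 * Real.pi * Complex.I : ℂ)⁻¹ * ∫ z, H i z * Φ z) := by
    intro i
    have h5 : ∀ z, f z * ψ i z = (2 * Real.pi * Complex.I : ℂ)⁻¹ *
        (f z * fderiv ℝ (Ψ i) z (EuclideanSpace.single i.castSucc 1)) := fun z => by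
      rw [hψ', mul_left_comm, inv_mul_cancel_left₀ Complex.two_pi_I_ne_zero]
    simp only [h5, integral_const_mul]
    rw [hg, integral_transfer (hH i) hΦ (hΨ i) fun ζ => mul_comm _ _, mul_neg]
  have h6 : ∫ z, f z * Ξ z = (∫ z, f z * halfTime Ψ₀ z) - ∑ i, ∫ z, f z * ψ i z := by
    rw [← h2]
    simp only [add_apply, sum_schwartz_apply, mul_add, Finset.mul_sum]
    rw [integral_add (hf.integrable_mul_schwartz Ξ)
      (integrable_finsetSum _ fun i _ => hf.integrable_mul_schwartz (ψ i)),
      integral_finsetSum _ fun i _ => hf.integrable_mul_schwartz (ψ i), add_sub_cancel_right]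
  rw [h1, h6, hh, ← integral_transfer hH₀ hΦ hΨ₀ fun ζ => mul_comm _ _]
  simp only [h4, Finset.sum_neg_distrib, sub_neg_eq_add]

theorem eLpNorm_add_sum_smul_le (hp1 : 1 ≤ p) {c : ℂ} (hc : ‖c‖ ≤ 1) {H₀ : Pt d → ℂ}
    {H : Fin d → Pt d → ℂ} (hH₀ : MemLp H₀ p) (hH : ∀ i, MemLp (H i) p) :
    eLpNorm (H₀ + ∑ i, c • H i) p ≤ eLpNorm H₀ p + ∑ i, eLpNorm (H i) p := by
  have hcH : ∀ i, MemLp (c • H i) p := fun i => (hH i).const_smul c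
  have hS : MemLp (∑ i, c • H i) p := memLp_finsetSum' _ fun i _ => hcH i
  have hcn : ‖c‖ₑ ≤ 1 := by rwa [← enorm_one (G := ℂ), enorm_le_iff_norm_le, norm_one]
  have h1 : eLpNorm (∑ i, c • H i) p ≤ ∑ i, eLpNorm (c • H i) p :=
    eLpNorm_sum_le (fun i _ => (hcH i).1) hp1
  have h2 : ∀ i, eLpNorm (c • H i) p ≤ eLpNorm (H i) p := fun i => by
    rw [eLpNorm_const_smul]
    exact mul_le_of_le_one_left' hcn
  exact (eLpNorm_add_le hH₀.1 hS.1 hp1).trans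
    (add_le_add_right (h1.trans (Finset.sum_le_sum fun i _ => h2 i)) _)

/-- If `D^t_{1/2} f` and `∇ f` are in `Lᵖ`, so is `T f` for every smooth multiplier `T` which is
homogeneous of degree one. -/
theorem exists_rep_of_halfTime_of_fderiv (hp1 : 1 < p) (hp : p < ∞) {σ : Pt d → ℝ}
    (hσ : HomSymbol 1 σ) : ∃ C : ℝ≥0, ∀ f : Pt d → ℂ, Admissible f → ∀ (h : Pt d → ℂ)
      (g : Fin d → Pt d → ℂ), MemLp h p → (∀ i, MemLp (g i) p) →
      (∀ φ : 𝓢(Pt d, ℂ), ∫ z, f z * halfTime φ z = ∫ z, h z * φ z) →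
      (∀ (i : Fin d) (φ : 𝓢(Pt d, ℂ)),
        ∫ z, f z * fderiv ℝ φ z (EuclideanSpace.single i.castSucc 1) = - ∫ z, g i z * φ z) →
      ∃ H : Pt d → ℂ, MemLp H p ∧ eLpNorm H p ≤ C * (eLpNorm h p + ∑ i, eLpNorm (g i) p) ∧
        ∀ φ : 𝓢(Pt d, ℂ), ∫ z, f z * fourierMul (fun ζ => σ (-ζ)) φ z = ∫ z, H z * φ z := by
  obtain ⟨C₀, hC₀⟩ := (homSymbol_timePart hσ).exists_transferBound hp1 hp
  have hC := fun i => (homSymbol_spacePart hσ i).exists_transferBound hp1 hp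
  choose C hC using hC
  obtain ⟨q, hpq, hq1, hq⟩ := exists_holderConjugate hp1 hp
  refine ⟨C₀ + ∑ i, C i, fun f hf h g hh hg hfh hfg => ?_⟩
  obtain ⟨H₀, hH₀, hH₀n, hH₀t⟩ := hC₀ h hh
  have hH := fun i => hC i (g i) (hg i)
  choose H hH hHn hHt using hH
  set c : ℂ := (2 * Real.pi * Complex.I : ℂ)⁻¹ with hc
  have hcH : ∀ i, MemLp (c • H i) p := fun i => (hH i).const_smul c
  have hS : MemLp (∑ i, c • H i) p := memLp_finsetSum' _ fun i _ => hcH i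
  have hM : MemLp (H₀ + ∑ i, c • H i) p := hH₀.add hS
  refine ⟨H₀ + ∑ i, c • H i, hM, ?_, fun φ => ?_⟩
  · refine (eLpNorm_add_sum_smul_le hp1.le norm_two_pi_I_inv_le hH₀ hH).trans ?_
    have h1 : (C₀ : ℝ≥0∞) ≤ (C₀ + ∑ i, C i : ℝ≥0) := ENNReal.coe_le_coe.2 le_self_add
    have h2 : ∀ i, (C i : ℝ≥0∞) ≤ (C₀ + ∑ i, C i : ℝ≥0) := fun i => ENNReal.coe_le_coe.2
      ((Finset.single_le_sum (fun _ _ => zero_le) (Finset.mem_univ i)).trans le_add_self)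
    rw [mul_add, Finset.mul_sum]
    exact add_le_add (hH₀n.trans (mul_le_mul_left h1 _))
      (Finset.sum_le_sum fun i _ => (hHn i).trans (mul_le_mul_left (h2 i) _))
  · have hs : ∀ {G : Pt d → ℂ}, MemLp G p → ∀ Φ : 𝓢(Pt d, ℂ), Integrable fun z => G z * Φ z :=
      fun hG Φ => integrable_mul_of_holderConjugate (q := q) hG (Φ.memLp q volume)
    refine lowFrequency_id.integral_eq_of_forall_cut hσ.comp_neg hp1 hp hf hM φ
      fun r Φ hr hΦ => ?_
    refine (integral_cut_eq_of_halfTime_of_fderiv hσ hf hfh hfg hH₀t hHt (one_pos.trans_le hr)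
      hΦ).trans ?_
    simp only [Pi.add_apply, Finset.sum_apply, add_mul, Finset.sum_mul]
    rw [integral_add (hs hH₀ Φ) (integrable_finsetSum _ fun i _ => hs (hcH i) Φ),
      integral_finsetSum _ fun i _ => hs (hcH i) Φ]
    simp only [Pi.smul_apply, smul_eq_mul, mul_assoc, integral_const_mul, hc]

theorem symbolD_neg (ζ : Pt d) : symbolD (-ζ) = symbolD ζ := parNorm_neg ζ

/-- If `𝔻 f` is in `Lᵖ`, so is `∇ f`. -/
theorem exists_gradient_of_symbolD (hp1 : 1 < p) (hp : p < ∞) (i : Fin d) :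
    ∃ C : ℝ≥0, ∀ f : Pt d → ℂ, Admissible f → ∀ G : Pt d → ℂ, MemLp G p →
      (∀ φ : 𝓢(Pt d, ℂ), ∫ z, f z * fourierMul (fun ζ => symbolD (-ζ)) φ z = ∫ z, G z * φ z) →
      ∃ g : Pt d → ℂ, MemLp g p ∧ eLpNorm g p ≤ C * eLpNorm G p ∧ ∀ φ : 𝓢(Pt d, ℂ),
        ∫ z, f z * fderiv ℝ φ z (EuclideanSpace.single i.castSucc 1) = - ∫ z, g z * φ z := by
  have hk : HomSymbol 0 fun ζ : Pt d => ζ i.castSucc / symbolD ζ := by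
    have := (homSymbol_spaceVar i).div homSymbol_symbolD fun z hz => (parNorm_pos hz).ne'
    rwa [sub_self] at this
  obtain ⟨C, hC⟩ := hk.comp_neg.exists_transferBound hp1 hp
  set c : ℂ := 2 * Real.pi * Complex.I with hc
  refine ⟨‖c‖₊ * C, fun f hf G hG hfG => ?_⟩
  obtain ⟨H, hH, hHn, hHt⟩ := hC G hG
  have key : ∀ φ : 𝓢(Pt d, ℂ), ∫ z, f z * fourierMul (fun ζ => ζ i.castSucc) φ z
      = ∫ z, H z * φ z := by
    intro φ
    refine lowFrequency_id.integral_eq_of_forall_cut (homSymbol_spaceVar i) hp1 hp hf hH φ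
      fun r Φ hr hΦ => ?_
    obtain ⟨Ψ, hΨ⟩ := exists_fourier_eq_mul (hk.hasTemperateGrowth_cut (one_pos.trans_le hr)) φ
    rw [integral_transfer (m := fun ζ => (-ζ) i.castSucc / symbolD (-ζ)) hHt hΦ hΨ
      fun ζ => by simp [mul_comm], ← hfG]
    congr 2
    ext z
    congr 1
    rw [fourierMul_eq_of_fourier_eq hΦ fun ζ => Or.inr rfl,
      fourierMul_eq_of_fourier_eq hΨ fun ζ => Or.inr ?_]
    rcases eq_or_ne ζ 0 with rfl | hζ
    · simp
    · have := (parNorm_pos hζ).ne'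
      rw [symbolD_neg, symbolD]
      simp only [ContinuousLinearMap.id_apply]
      field_simp
  -- the sign is that of the integration by parts
  refine ⟨(-c) • H, hH.const_smul _, ?_, fun φ => ?_⟩
  · rw [eLpNorm_const_smul, enorm_neg, ENNReal.coe_mul, mul_assoc]
    exact mul_le_mul_right hHn _
  · obtain ⟨ψ, hψ, hψ'⟩ := exists_fderiv_eq_mul φ i
    have h1 : (ψ : Pt d → ℂ) = fourierMul (fun ζ => ζ i.castSucc) φ := coe_eq_fourierMul hψ
    simp only [hψ', h1, Pi.smul_apply, smul_eq_mul, mul_left_comm (f _), neg_mul, mul_assoc,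
      integral_neg, neg_neg]
    have h2 := congrArg (c * ·) (key φ)
    simp only [← integral_const_mul] at h2
    simpa only [hc, mul_assoc] using h2

/-- If `𝔻 f` is in `Lᵖ`, so is `D^t_{1/2} f`. The multiplier `|τ|^{1/2} / ‖(ξ, τ)‖` is not smooth at
`τ = 0`; it is the product of `halfTimeFraction` and a smooth symbol. -/
theorem exists_halfTime_of_symbolD (hp1 : 1 < p) (hp : p < ∞) :
    ∃ C : ℝ≥0, ∀ f : Pt d → ℂ, Admissible f → ∀ G : Pt d → ℂ, MemLp G p →
      (∀ φ : 𝓢(Pt d, ℂ), ∫ z, f z * fourierMul (fun ζ => symbolD (-ζ)) φ z = ∫ z, G z * φ z) →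
      ∃ h : Pt d → ℂ, MemLp h p ∧ eLpNorm h p ≤ C * eLpNorm G p ∧ ∀ φ : 𝓢(Pt d, ℂ),
        ∫ z, f z * halfTime φ z = ∫ z, h z * φ z := by
  have h1 : HomSymbol 0 fun _ : Pt d => (1 : ℝ) := ⟨fun _ _ => contDiffAt_const, by simp⟩
  have hD0 : ∀ z : Pt d, z ≠ 0 → symbolD z ≠ 0 := fun z hz => (parNorm_pos hz).ne'
  have hQ0 : ∀ z : Pt d, z ≠ 0 → quarticNorm z ≠ 0 := fun z hz => (quarticNorm_pos hz).ne'
  have hk : HomSymbol 0 fun ζ : Pt d => quarticNorm ζ / symbolD ζ := by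
    have := homSymbol_quarticNorm.div homSymbol_symbolD hD0
    rwa [sub_self] at this
  obtain ⟨C, hC⟩ := hk.comp_neg.exists_transferBound hp1 hp
  obtain ⟨D, hD⟩ := exists_transferBound_halfTimeFraction (d := d) hp1 hp
  refine ⟨D * C, fun f hf G hG hfG => ?_⟩
  obtain ⟨g, hg, hgn, hgt⟩ := hC G hG
  obtain ⟨h, hh, hhn, hht⟩ := hD g hg
  refine ⟨h, hh, ?_, fun φ => ?_⟩
  · rw [ENNReal.coe_mul, mul_assoc]
    exact hhn.trans (mul_le_mul_right hgn _)
  · rw [halfTime_eq_fourierMul]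
    refine lowFrequency_time.integral_eq_of_forall_cut homSymbol_halfTimeSymbol_zero_dim hp1 hp
      hf hh φ fun r Φ hr hΦ => ?_
    -- `Ψ` and `Θ` are `Φ` with `|τ|^{1/2} / (τ² + |ξ|⁴)^{1/4}` and `|τ|^{1/2} / ‖(ξ, τ)‖` applied
    obtain ⟨Ψ, hΨ⟩ := exists_fourier_eq_mul
      (hasTemperateGrowth_timeCut (h1.div homSymbol_quarticNorm hQ0) hr) φ
    obtain ⟨Θ, hΘ⟩ := exists_fourier_eq_mul
      (hasTemperateGrowth_timeCut (h1.div homSymbol_symbolD hD0) hr) φ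
    rw [integral_transfer hht hΦ hΨ fun ζ => by
        rw [halfTimeFraction_neg, halfTimeFraction, halfTimeSymbol]; ring,
      integral_transfer (m := fun ζ => quarticNorm (-ζ) / symbolD (-ζ)) hgt hΨ hΘ
        fun ζ => ?_, ← hfG]
    · congr 2
      ext z
      congr 1
      rw [fourierMul_eq_of_fourier_eq hΦ fun ζ => Or.inr rfl,
        fourierMul_eq_of_fourier_eq hΘ fun ζ => Or.inr ?_]
      rcases eq_or_ne ζ 0 with rfl | hζ
      · simp [halfTimeSymbol, timeVar, timeProj]
      · have := hD0 ζ hζ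
        rw [symbolD_neg, halfTimeSymbol_timeProj]
        field_simp
    · rcases eq_or_ne ζ 0 with rfl | hζ
      · simp [halfTimeSymbol, timeVar]
      · have := hD0 ζ hζ
        have := hQ0 ζ hζ
        simp only [neg_neg]
        field_simp

end Parabolic

end

/-! ### The norm inequalities -/

noncomputable section

namespace Parabolic

open Filter Topology

variable {d : ℕ} {p : ℝ≥0∞}

theorem distNorm_le {T' : 𝓢(Pt d, ℂ) → Pt d → ℂ} {f g : Pt d → ℂ} (hg : MemLp g p)
    (h : ∀ φ : 𝓢(Pt d, ℂ), ∫ z, f z * T' φ z = ∫ z, g z * φ z) :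
    distNorm T' p f ≤ eLpNorm g p := iInf₂_le g ⟨hg, h⟩

theorem memLp_coordinate {g : Pt d → EuclideanSpace ℂ (Fin d)} (hg : MemLp g p) (i : Fin d) :
    MemLp (fun z => g z i) p :=
  hg.mono ((EuclideanSpace.proj (𝕜 := ℂ) i).continuous.comp_aestronglyMeasurable hg.1)
    (Eventually.of_forall fun z => PiLp.norm_apply_le (g z) i)

theorem eLpNorm_coordinate_le (g : Pt d → EuclideanSpace ℂ (Fin d)) (i : Fin d) :
    eLpNorm (fun z => g z i) p ≤ eLpNorm g p :=
  eLpNorm_mono fun z => PiLp.norm_apply_le (g z) i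

/-- The gradient is controlled by its coordinates. -/
theorem normGrad_le_sum (hp1 : 1 ≤ p) {f : Pt d → ℂ} {g : Fin d → Pt d → ℂ}
    (hg : ∀ i, MemLp (g i) p) (h : ∀ (i : Fin d) (φ : 𝓢(Pt d, ℂ)),
      ∫ z, f z * fderiv ℝ φ z (EuclideanSpace.single i.castSucc 1) = - ∫ z, g i z * φ z) :
    normGrad p f ≤ ∑ i, eLpNorm (g i) p := by
  set G : Fin d → Pt d → EuclideanSpace ℂ (Fin d) := fun i z =>
    g i z • EuclideanSpace.single i (1 : ℂ) with hG
  have h1 : ∀ i z, ‖G i z‖ = ‖g i z‖ := fun i z => by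
    rw [hG]
    simp [norm_smul]
  have h2 : ∀ i, AEStronglyMeasurable (G i) := fun i =>
    (hg i).1.smul_const (EuclideanSpace.single i (1 : ℂ))
  have h3 : ∀ i, MemLp (G i) p := fun i =>
    (hg i).mono (h2 i) (Eventually.of_forall fun z => (h1 i z).le)
  have h4 : ∀ i z, (∑ j, G j) z i = g i z := fun i z => by
    simp [hG, Finset.sum_apply, Pi.single_apply]
  have h5 : normGrad p f ≤ eLpNorm (∑ i, G i) p :=
    iInf₂_le _ ⟨memLp_finsetSum' _ fun i _ => h3 i, fun i φ => by simp only [h4, h]⟩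
  refine h5.trans ((eLpNorm_sum_le (fun i _ => h2 i) hp1).trans (Finset.sum_le_sum fun i _ => ?_))
  exact eLpNorm_mono fun z => (h1 i z).le

theorem le_mul_distNorm {T' : 𝓢(Pt d, ℂ) → Pt d → ℂ} {f : Pt d → ℂ} {a : ℝ≥0∞} {C : ℝ≥0}
    (hC : C ≠ 0) (h : ∀ g : Pt d → ℂ, MemLp g p →
      (∀ φ : 𝓢(Pt d, ℂ), ∫ z, f z * T' φ z = ∫ z, g z * φ z) → a ≤ C * eLpNorm g p) :
    a ≤ C * distNorm T' p f := by
  have h0 : (C : ℝ≥0∞) ≠ 0 := ENNReal.coe_ne_zero.2 hC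
  simp only [distNorm, ENNReal.mul_iInf_of_ne h0 ENNReal.coe_ne_top]
  exact le_iInf₂ fun g hg => h g hg.1 hg.2

theorem le_mul_distNorm_add_normGrad {T' : 𝓢(Pt d, ℂ) → Pt d → ℂ} {f : Pt d → ℂ} {a : ℝ≥0∞}
    {C : ℝ≥0} (hC : C ≠ 0) (h : ∀ (h : Pt d → ℂ) (g : Pt d → EuclideanSpace ℂ (Fin d)),
      MemLp h p → MemLp g p → (∀ φ : 𝓢(Pt d, ℂ), ∫ z, f z * T' φ z = ∫ z, h z * φ z) →
      (∀ (i : Fin d) (φ : 𝓢(Pt d, ℂ)),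
        ∫ z, f z * fderiv ℝ φ z (EuclideanSpace.single i.castSucc 1) = - ∫ z, g z i * φ z) →
      a ≤ C * (eLpNorm h p + eLpNorm g p)) :
    a ≤ C * (distNorm T' p f + normGrad p f) := by
  have h0 : (C : ℝ≥0∞) ≠ 0 := ENNReal.coe_ne_zero.2 hC
  simp only [distNorm, normGrad, ENNReal.iInf_add, ENNReal.add_iInf,
    ENNReal.mul_iInf_of_ne h0 ENNReal.coe_ne_top]
  refine le_iInf₂ fun u hu => le_iInf₂ fun v hv => ?_
  exact h v u hv.1 hu.1 hv.2 hu.2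

/-- The bound of `𝔻 f` and of `𝔻ₙ f` by `D^t_{1/2} f` and `∇ f`. -/
theorem exists_distNorm_le (hp1 : 1 < p) (hp : p < ∞) {σ : Pt d → ℝ} (hσ : HomSymbol 1 σ) :
    ∃ C : ℝ≥0, ∀ f : Pt d → ℂ, Admissible f →
      distNorm (fourierMul fun ζ => σ (-ζ)) p f ≤ C * (normHalfTime p f + normGrad p f) := by
  obtain ⟨C, hC⟩ := exists_rep_of_halfTime_of_fderiv hp1 hp hσ
  refine ⟨C * (d + 1) + 1, fun f hf => ?_⟩
  refine le_mul_distNorm_add_normGrad (one_pos.trans_le le_add_self).ne' fun h g hh hg hfh hfg => ?_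
  obtain ⟨H, hH, hHn, hfH⟩ := hC f hf h (fun i z => g z i) hh (memLp_coordinate hg) hfh hfg
  refine (distNorm_le hH hfH).trans (hHn.trans ?_)
  have h1 : ∑ i : Fin d, eLpNorm (fun z => g z i) p ≤ d * eLpNorm g p := by
    refine (Finset.sum_le_sum fun i _ => eLpNorm_coordinate_le g i).trans_eq ?_
    rw [Finset.sum_const, Finset.card_univ, Fintype.card_fin, nsmul_eq_mul]
  have h2 : eLpNorm h p + ∑ i : Fin d, eLpNorm (fun z => g z i) p
      ≤ (d + 1) * (eLpNorm h p + eLpNorm g p) := by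
    rw [add_mul, one_mul, add_comm]
    refine add_le_add (h1.trans (mul_le_mul_right le_add_self _)) le_self_add
  have h3 : (C : ℝ≥0∞) * (d + 1) ≤ (C * (d + 1) + 1 : ℝ≥0) := by
    push_cast
    exact le_self_add
  refine (mul_le_mul_right h2 _).trans ?_
  rw [← mul_assoc]
  exact mul_le_mul_left h3 _

/-- The bound of `D^t_{1/2} f` and `∇ f` by `𝔻 f`. -/
theorem exists_normHalfTime_add_normGrad_le (hp1 : 1 < p) (hp : p < ∞) :
    ∃ C : ℝ≥0, ∀ f : Pt d → ℂ, Admissible f →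
      normHalfTime p f + normGrad p f ≤ C * normD p f := by
  obtain ⟨C₀, hC₀⟩ := exists_halfTime_of_symbolD (d := d) hp1 hp
  have hC := fun i => exists_gradient_of_symbolD (d := d) hp1 hp i
  choose C hC using hC
  refine ⟨C₀ + ∑ i, C i + 1, fun f hf => ?_⟩
  refine le_mul_distNorm (one_pos.trans_le le_add_self).ne' fun G hG hfG => ?_
  obtain ⟨h, hh, hhn, hfh⟩ := hC₀ f hf G hG hfG
  have hg := fun i => hC i f hf G hG hfG
  choose g hg hgn hfg using hg
  have h1 : normHalfTime p f + normGrad p f ≤ eLpNorm h p + ∑ i, eLpNorm (g i) p :=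
    add_le_add (distNorm_le hh hfh) (normGrad_le_sum hp1.le hg hfg)
  have h2 : eLpNorm h p + ∑ i, eLpNorm (g i) p ≤ C₀ * eLpNorm G p + ∑ i, C i * eLpNorm G p :=
    add_le_add hhn (Finset.sum_le_sum fun i _ => hgn i)
  have h3 : (C₀ : ℝ≥0∞) + ∑ i, (C i : ℝ≥0∞) ≤ (C₀ + ∑ i, C i + 1 : ℝ≥0) := by
    push_cast
    exact le_self_add
  refine (h1.trans h2).trans ?_
  rw [← Finset.sum_mul, ← add_mul]
  exact mul_le_mul_left h3 _

theorem pairingWeight_le (z : Pt d) : pairingWeight z ≤ 1 / (1 + gauge z) ^ (d + 2)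
    + ((1 + ‖spaceVar z‖) ^ (d + 1))⁻¹ / (1 + gauge (timeProj z)) ^ (0 + 2) := by
  rw [pairingWeight, gauge_zero_dim, timeVar_timeProj, gauge, ← add_assoc]
  have h1 := norm_nonneg (spaceVar z)
  have h2 := Real.sqrt_nonneg |timeVar z|
  gcongr ?_ + ?_
  · exact one_div_le_one_div_of_le (by positivity)
      (pow_le_pow_right₀ (by linarith) (by omega))
  · rw [inv_eq_one_div, div_div]
    refine one_div_le_one_div_of_le (by positivity) ?_
    gcongr
    · linarith
    · norm_num

/-- `Lᵖ` is contained in the class on which the operators are defined. -/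
theorem admissible_of_memLp (hp1 : 1 < p) (hp : p < ∞) {f : Pt d → ℂ} (hf : MemLp f p) :
    Admissible f := by
  obtain ⟨q, hpq, hq1, hq⟩ := exists_holderConjugate hp1 hp
  have h1 := (lowFrequency_id (d := d).memLp q hq1 hq).add
    (lowFrequency_time (d := d).memLp q hq1 hq)
  have h2 : MemLp (fun z : Pt d => (pairingWeight z : ℂ)) q := by
    refine h1.mono (Complex.continuous_ofReal.comp
      continuous_pairingWeight).aestronglyMeasurable (Eventually.of_forall fun z => ?_)
    rw [Complex.norm_real, Real.norm_of_nonneg (pairingWeight_pos z).le]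
    exact (pairingWeight_le z).trans (le_abs_self _)
  refine (integrable_mul_of_holderConjugate (q := q) hf h2).congr (Eventually.of_forall fun z => ?_)
  exact mul_comm _ _

/-- The term `‖f‖_{Lᵖ}` may be added to both sides, and then `f` need not be assumed `Admissible`:
either `f` is in `Lᵖ`, or both sides are infinite. -/
theorem add_eLpNorm_le (hp1 : 1 < p) (hp : p < ∞) {A B : (Pt d → ℂ) → ℝ≥0∞} {C D : ℝ≥0}
    (hCD : C + 1 ≤ D) (h : ∀ f, Admissible f → A f ≤ C * B f) {f : Pt d → ℂ}
    (hf : AEStronglyMeasurable f) : A f + eLpNorm f p ≤ D * (B f + eLpNorm f p) := by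
  have h1 : (C : ℝ≥0∞) ≤ D := ENNReal.coe_le_coe.2 (le_self_add.trans hCD)
  have h2 : 1 ≤ (D : ℝ≥0∞) := ENNReal.one_le_coe_iff.2 (le_add_self.trans hCD)
  rcases eq_or_ne (eLpNorm f p) ∞ with hft | hft
  · rw [hft, add_top, add_top, ENNReal.mul_top (one_pos.trans_le h2).ne']
  · rw [mul_add]
    exact add_le_add ((h f (admissible_of_memLp hp1 hp ⟨hf, hft.lt_top⟩)).trans
      (mul_le_mul_left h1 _)) (le_mul_of_one_le_left' h2)

end Parabolic

end

theorem theorem2p2 (d : ℕ) (p : ℝ≥0∞) (hp₁ : 1 < p) (hp : p < ∞) :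
    (∃ C : ℝ≥0, ∀ f : Parabolic.Pt d → ℂ, Parabolic.Admissible f →
      Parabolic.normDn p f ≤ C * (Parabolic.normHalfTime p f + Parabolic.normGrad p f)) ∧
    (∃ C : ℝ≥0, ∀ f : Parabolic.Pt d → ℂ, Parabolic.Admissible f →
      Parabolic.normD p f ≤ C * (Parabolic.normHalfTime p f + Parabolic.normGrad p f) ∧
      Parabolic.normHalfTime p f + Parabolic.normGrad p f ≤ C * Parabolic.normD p f) ∧
    (∃ C : ℝ≥0, ∀ f : Parabolic.Pt d → ℂ, AEStronglyMeasurable f →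
      Parabolic.normD p f + eLpNorm f p ≤
        C * (Parabolic.normHalfTime p f + Parabolic.normGrad p f + eLpNorm f p) ∧
      Parabolic.normHalfTime p f + Parabolic.normGrad p f + eLpNorm f p ≤
        C * (Parabolic.normD p f + eLpNorm f p)) := by
  obtain ⟨C, hC⟩ := Parabolic.exists_distNorm_le hp₁ hp (Parabolic.homSymbol_symbolD (d := d))
  obtain ⟨D, hD⟩ := Parabolic.exists_normHalfTime_add_normGrad_le (d := d) hp₁ hp
  refine ⟨Parabolic.exists_distNorm_le hp₁ hp Parabolic.homSymbol_symbolDn,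
    ⟨max C D, fun f hf => ⟨(hC f hf).trans ?_, (hD f hf).trans ?_⟩⟩,
    ⟨max C D + 1, fun f hf => ⟨Parabolic.add_eLpNorm_le hp₁ hp ?_ hC hf,
      Parabolic.add_eLpNorm_le hp₁ hp ?_ hD hf⟩⟩⟩
  · exact mul_le_mul_left (ENNReal.coe_le_coe.2 (le_max_left C D)) _
  · exact mul_le_mul_left (ENNReal.coe_le_coe.2 (le_max_right C D)) _
  · gcongr
    exact le_max_left C D
  · gcongr
    exact le_max_right C D
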